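/- Let $m\ge 3$ be odd and $q=2^m$, $s=\sqrt{2q}$. Let $R=GR(4,m)=\mathbb Z_4[x]/(f)$, where $f\in\mathbb Z_4[x]$ is monic of degree $m$ with irreducible reduction modulo $2$; let $\mu:R\to R/2R=\mathbb F_q$ be reduction modulo $2$, let $\beta\in R^*$ have order $2^m-1$, and put $\mathcal T=\{0,1,\beta,\dots,\beta^{2^m-2}\}$, $\mathcal T^*=\mathcal T\setminus\{0\}$. Every $z\in R$ is uniquely $z=A+2B$ with $A,B\in\mathcal T$; put $\sigma(z)=A^2+2B^2$ and $\mathrm T(z)=\sum_{j=0}^{m-1}\sigma^j(z)\in\mathbb Z_4$. Since $\mu$ restricts to a bijection $\mathcal T\to\mathbb F_q$, in expressions over $R$ an element of $\mathbb F_q$ stands for its preimage in $\mathcal T$. Capital letters $X,Y,Z,Y_j$ denote elements of $\mathcal T$, and the corresponding lower-case letters their images under $\mu$. Let $G=\mathbb Z_4\times R\times\mathbb F_q$ (an additive group), and for $(u,a,b)\in G$ let $$S(u,a,b)=\sum_{X\in\mathcal T} i^{\,u+\mathrm T(aX+2bX^3)}+\sum_{X\in\mathcal T} i^{-u-\mathrm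 T(aX+2bX^3)} .$$ Define $\mathcal R_0,\dots,\mathcal R_9\subseteq G$ as the sets of all $(u,a,b)$ with, respectively: $\mathcal R_0$: $S=2q$; $\mathcal R_1$: $S=2\sqrt{2q}$; $\mathcal R_2$: $S=\sqrt{2q},\,b=0$; $\mathcal R_3$: $S=\sqrt{2q},\,b\ne0$; $\mathcal R_4$: $S=0,\,b=0$; $\mathcal R_5$: $S=0,\,b\neq0$; $\mathcal R_6$: $S=-\sqrt{2q},\,b\ne0$; $\mathcal R_7$: $S=-\sqrt{2q},\,b=0$; $\mathcal R_8$: $S=-2\sqrt{2q}$; $\mathcal R_9$: $S=-2q$. Define also - $\mathcal E_0=\{(0,0,0)\}$ and $\mathcal E_1=\{(0,0,r): r\in\mathbb F_q^*\}$; - $\mathcal E_2=\{(1,X,x^3)\}\cup\{(3,-X,x^3)\}$; - $\mathcal E_3=\{(1,X,r),(3,-X,r): X\in\mathcal T,\ r\in\mathbb F_q\}\setminus\mathcal E_2$; - $\mathcal E_4=\{(0,-X+Y,x^3+y^3): X\ne Y\}\cup\{(2,X+Y,x^3+y^3)\}\cup\{(2,-X-Y,x^3+y^3)\}$; - $\mathcal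 E_5=\big(\{(0,c,r): c\in R\setminus 2R,\ r\in\mathbb F_q\}\cup\{(2,c,r): c\in R,\ r\in\mathbb F_q\}\big)\setminus\mathcal E_4$; - $\mathcal E_6$ is the set of all $(1,2X-Y,y^3)$ and $(3,2X+Y,y^3)$ with $X\neq Y$, together with all $(1,-X-Y-Z,t)$, $(1,X+Y-Z,t)$, $(3,X+Y+Z,t)$, $(3,-X-Y+Z,t)$ with $X,Y,Z$ pairwise distinct and $t=x^3+y^3+z^3$; - $\mathcal E_7=\mathcal E_7^{+}\setminus\mathcal E_6$, where $\mathcal E_7^{+}$ is the set of all $(1,2X-Y,r)$, $(3,2X+Y,r)$ with $X\ne Y$ and $r\in\mathbb F_q$, together with all $(1,-X-Y-Z,r)$, $(1,X+Y-Z,r)$, $(3,X+Y+Z,r)$, $(3,-X-Y+Z,r)$ with $X,Y,Z$ pairwise distinct and $r\in\mathbb F_q$; - $\mathcal E_8=\{(0,2X,\sum_{j=1}^4y_j^3): X\in\mathcal T^*,\ Y_j\in\mathcal T,\ 2X=Y_1+Y_2+Y_3+Y_4\text{ or }2X=Y_1+Y_2-Y_3-Y_4\}$; - $\mathcal E_9=\{(0,2X,r):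 X\in\mathcal T^*,\ r\in\mathbb F_q\}\setminus\mathcal E_8$. A $d$-class association scheme on a nonempty finite set $V$ is a partition of $V\times V$ into nonempty symmetric relations $R_0=\{(x,x)\},R_1,\dots,R_d$ whose adjacency matrices $A_j$ satisfy $A_iA_j=\sum_k p_{ij}^kA_k$ for some numbers $p_{ij}^k$. For an ordering $E_0=\frac1{|V|}J,E_1,\dots,E_d$ of the minimal idempotents of the span of the $A_j$ ($J$ is the all-ones matrix), the first and second eigenmatrices $P,Q$ are defined by $A_j=\sum_iP_{ij}E_i$ and $E_j=\frac1{|V|}\sum_iQ_{ij}A_i$. If $V$ is a finite abelian group and the relations are $\{(g,h):g-h\in S_i\}$, then the dual scheme is given by the partition of the character group $\widehat V$ into the classes of the equivalence relation "$\chi(S_j)=\chi'(S_j)$ for all $j$", where $\chi(S)=\sum_{g\in S}\chi(g)$, the class with index $0$ consisting of the principal character only. For $g=(v,c,d)\in G$ let $\chi_g(u,a,b)=i^{\,uv+\mathrm T(ac+2bd)}$. **Theorem.** 1. The relations $R_i=\{(g,h): g-h\in\mathcal R_i\}$, $0\le i\le 9$, form a $9$-class association scheme $\mathfrak B'$ on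 $G$, with first and second eigenmatrices $P$ and $Q$ below. Row $i$ of $P$ belongs to $\mathcal E_i$: $\chi_g(\mathcal R_j)=P_{ij}$ for all $g\in\mathcal E_i$. 2. The relations $R_i'=\{(g,h): g-h\in\mathcal E_i\}$, $0\le i\le 9$, form a $9$-class association scheme on $G$, with first and second eigenmatrices $P'=Q$ and $Q'=P$; and $\chi_g(\mathcal E_j)=Q_{ij}$ for all $g\in\mathcal R_i$. 3. The scheme in 2 is the dual of $\mathfrak B'$: $g\mapsto\chi_g$ is a group isomorphism $G\to\widehat G$, and it maps $\mathcal E_0,\dots,\mathcal E_9$ onto the ten classes of the dual scheme, with $\mathcal E_0$ mapped to the principal character. Here (rows and columns indexed by $0,\dots,9$) {\scriptsize $$P=\begin{pmatrix} 1 & s^6/24-s^4/8+s^2/12 & s^4/2-s^2 & s^6/12-s^2/3 & -2+2s^2 & s^6/4-3s^4/4+s^2/2 & s^6/12-s^2/3 & s^4/2-s^2 & s^6/24-s^4/8+s^2/12 & 1 \\ 1 & -s^4/12+s^2/12 & s^4/2-s^2 & -s^4/6-s^2/3 & -2+2s^2 & -s^4/2+s^2/2 & -s^4/6-s^2/3 &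 s^4/2-s^2 & -s^4/12+s^2/12 & 1 \\ 1 & s^5/12-s^3/4+s/6 & s^3/2-s & s^5/12-s/3 & 0 & 0 & -s^5/12+s/3 & -s^3/2+s & -s^5/12+s^3/4-s/6 & -1 \\ 1 & -s^3/6+s/6 & s^3/2-s & -s^3/6-s/3 & 0 & 0 & s^3/6+s/3 & -s^3/2+s & s^3/6-s/6 & -1 \\ 1 & s^4/8-s^2/4 & 0 & 0 & -2 & -s^4/4+s^2/2 & 0 & 0 & s^4/8-s^2/4 & 1 \\ 1 & -s^2/4 & 0 & 0 & -2 & s^2/2 & 0 & 0 & -s^2/4 & 1 \\ 1 & s^3/12+s/6 & -s & -s^3/6-s/3 & 0 & 0 & s^3/6+s/3 & s & -s^3/12-s/6 & -1 \\ 1 & -s^3/6+s/6 & -s & -s/3+s^3/3 & 0 & 0 & s/3-s^3/3 & s & s^3/6-s/6 & -1 \\ 1 & s^4/24+s^2/12 & -s^2 & -s^4/6-s^2/3 & -2+2s^2 & s^4/4+s^2/2 & -s^4/6-s^2/3 & -s^2 & s^4/24+s^2/12 & 1 \\ 1 & -s^4/12+s^2/12 & -s^2 & -s^2/3+s^4/3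 & -2+2s^2 & -s^4/2+s^2/2 & -s^2/3+s^4/3 & -s^2 & -s^4/12+s^2/12 & 1 \end{pmatrix},$$ $$Q=\begin{pmatrix} 1 & s^2/2-1 & s^2 & (s^2-2)s^2/2 & s^2(s^2-1)/2 & s^2(s^4-3s^2+2)/4 & s^2(s^4-3s^2+2)/6 & s^2(s^4-4)/12 & s^4/6-s^2/2+1/3 & s^4/12-1/3 \\ 1 & -1 & 2s & -2s & 3s^2/2 & -3s^2/2 & s(s^2+2)/3 & -s(s^2+2)/3 & s^2/6+1/3 & -s^2/6-1/3 \\ 1 & s^2/2-1 & s & (s^2-2)s/2 & 0 & 0 & -s(s^2-1)/3 & -s(s^2+2)/6 & 1/3-s^2/3 & -s^2/6-1/3 \\ 1 & -1 & s & -s & 0 & 0 & -s(s^2-1)/3 & s(s^2-1)/3 & 1/3-s^2/3 & -1/3+s^2/3 \\ 1 & s^2/2-1 & 0 & 0 & -s^2/2 & -(s^2-2)s^2/4 & 0 & 0 & s^4/6-s^2/2+1/3 & s^4/12-1/3 \\ 1 & -1 & 0 & 0 & -s^2/2 & s^2/2 & 0 & 0 & s^2/6+1/3 & -s^2/6-1/3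 \\ 1 & -1 & -s & s & 0 & 0 & s(s^2-1)/3 & -s(s^2-1)/3 & 1/3-s^2/3 & -1/3+s^2/3 \\ 1 & s^2/2-1 & -s & -(s^2-2)s/2 & 0 & 0 & s(s^2-1)/3 & s(s^2+2)/6 & 1/3-s^2/3 & -s^2/6-1/3 \\ 1 & -1 & -2s & 2s & 3s^2/2 & -3s^2/2 & -s(s^2+2)/3 & s(s^2+2)/3 & s^2/6+1/3 & -s^2/6-1/3 \\ 1 & s^2/2-1 & -s^2 & -(s^2-2)s^2/2 & s^2(s^2-1)/2 & s^2(s^4-3s^2+2)/4 & -s^2(s^4-3s^2+2)/6 & -s^2(s^4-4)/12 & s^4/6-s^2/2+1/3 & s^4/12-1/3 \end{pmatrix}.$$ } -/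

import Mathlib

noncomputable section

open Polynomial

namespace DGScheme

/-! ### Association schemes, eigenmatrices and duality -/

section Schemes

/-- The adjacency matrix of a binary relation. -/
def adj {X : Type*} (R : X → X → Prop) : Matrix X X ℂ :=
  open Classical in fun x y => if R x y then 1 else 0

/-- `(X, R 0, …, R d)` is a (symmetric) `d`-class association scheme. -/
structure IsAssociationScheme {X : Type*} [Fintype X] {d : ℕ}
    (R : Fin (d + 1) → X → X → Prop) : Prop where
  nonempty : Nonempty X
  rel_nonempty : ∀ i, ∃ x y, R i x y
  symm : ∀ i x y, R i x y → R i y x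
  partition : ∀ x y, ∃! i, R i x y
  diagonal : ∀ x y, R 0 x y ↔ x = y
  intersection_numbers : ∃ p : Fin (d + 1) → Fin (d + 1) → Fin (d + 1) → ℕ,
    ∀ i j, adj (R i) * adj (R j) = ∑ k, (p i j k : ℂ) • adj (R k)

/-- The complex span of the adjacency matrices. -/
def boseMesner {X : Type*} {d : ℕ} (R : Fin (d + 1) → X → X → Prop) :
    Submodule ℂ (Matrix X X ℂ) :=
  Submodule.span ℂ (Set.range fun i => adj (R i))

/-- `e` is a minimal (primitive) idempotent of the matrix algebra with underlying space `A`. -/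
structure IsMinimalIdempotent {X : Type*} [Fintype X] (A : Submodule ℂ (Matrix X X ℂ))
    (e : Matrix X X ℂ) : Prop where
  mem : e ∈ A
  ne_zero : e ≠ 0
  idem : e * e = e
  minimal : ∀ f ∈ A, f * f = f → f * e = f → e * f = f → f = 0 ∨ f = e

/-- `P` and `Q` are the first and the second eigenmatrix with respect to one ordering
`E 0, …, E d` of the minimal idempotents of the Bose-Mesner algebra, where
`E 0 = |X|⁻¹ J` with `J` the all-ones matrix:
`A_j = ∑ i, P i j • E i` and `E_j = |X|⁻¹ • ∑ i, Q i j • A_i`. -/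
def HasEigenmatrices {X : Type*} [Fintype X] {d : ℕ} (R : Fin (d + 1) → X → X → Prop)
    (P Q : Matrix (Fin (d + 1)) (Fin (d + 1)) ℂ) : Prop :=
  ∃ E : Fin (d + 1) → Matrix X X ℂ,
    (∀ i, IsMinimalIdempotent (boseMesner R) (E i)) ∧
    LinearIndependent ℂ E ∧
    Submodule.span ℂ (Set.range E) = boseMesner R ∧
    E 0 = ((Fintype.card X : ℂ)⁻¹ • Matrix.of fun _ _ => 1) ∧
    (∀ j, adj (R j) = ∑ i, P i j • E i) ∧
    (∀ j, E j = (Fintype.card X : ℂ)⁻¹ • ∑ i, Q i j • adj (R i))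

/-- The translation relations `{(g, h) | g - h ∈ S i}` of a family of subsets of a group. -/
def translationRel {X : Type*} [AddCommGroup X] {d : ℕ} (S : Fin (d + 1) → Set X) :
    Fin (d + 1) → X → X → Prop :=
  fun i g h => g - h ∈ S i

/-- `χ(S) = ∑_{g ∈ S} χ(g)`. -/
def charSum {X : Type*} [Fintype X] (χ : X → ℂ) (S : Set X) : ℂ :=
  ∑ g, S.indicator χ g

/-- `D 0, …, D d` are the classes of the equivalence relation `χ(S j) = χ'(S j)` for all `j`
on the character group of `X`, and `D 0` consists of the principal character only. -/
structure IsDualPartition {X : Type*} [AddCommGroup X] [Fintype X] {d : ℕ}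
    (S : Fin (d + 1) → Set X) (D : Fin (d + 1) → Set (AddChar X ℂ)) : Prop where
  principal : D 0 = {1}
  class_nonempty : ∀ i, (D i).Nonempty
  partition : ∀ χ, ∃! i, χ ∈ D i
  classes : ∀ χ χ' : AddChar X ℂ,
    (∃ i, χ ∈ D i ∧ χ' ∈ D i) ↔ ∀ j, charSum χ (S j) = charSum χ' (S j)

end Schemes

/-! ### The Galois ring `GR(4, m)` -/

/-- A monic basic irreducible polynomial of degree `m` over `ℤ/4`. -/
structure BasicIrreducible (m : ℕ) where
  poly : (ZMod 4)[X]
  monic : poly.Monic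
  irreducible_mod_two :
    Irreducible (poly.map (ZMod.castHom (by decide : 2 ∣ 4) (ZMod 2)))
  natDegree_eq : poly.natDegree = m

section GaloisRing

variable {m : ℕ}

/-- The Galois ring `R = (ℤ/4)[x]/(f)`. -/
abbrev GR (F : BasicIrreducible m) : Type := AdjoinRoot F.poly

/-- The residue field `𝔽_q = R/2R`. -/
abbrev ResField (F : BasicIrreducible m) : Type := GR F ⧸ Ideal.span {(2 : GR F)}

instance instFiniteGR (F : BasicIrreducible m) : Finite (GR F) := by
  have : Module.Finite (ZMod 4) (AdjoinRoot F.poly) := F.monic.finite_adjoinRoot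
  exact Module.finite_of_finite (ZMod 4)

instance instFintypeGR (F : BasicIrreducible m) : Fintype (GR F) := Fintype.ofFinite _

instance instFintypeResField (F : BasicIrreducible m) : Fintype (ResField F) :=
  @Fintype.ofFinite _ (Finite.of_surjective _ Ideal.Quotient.mk_surjective)

/-- The group `G = ℤ/4 × R × 𝔽_q`. -/
abbrev Grp (F : BasicIrreducible m) : Type := ZMod 4 × GR F × ResField F

variable {F : BasicIrreducible m}

/-- Reduction modulo 2. -/
def red (F : BasicIrreducible m) : GR F →+* ResField F := Ideal.Quotient.mk _

/-- `𝒯 = {0, 1, β, …, β^(2^m - 2)}`. -/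
def teich (β : (GR F)ˣ) : Set (GR F) :=
  {0} ∪ {x | ∃ i < 2 ^ m - 1, x = (β : GR F) ^ i}

/-- `𝒯* = 𝒯 \ {0}`. -/
def teichStar (β : (GR F)ˣ) : Set (GR F) := teich β \ {0}

/-- The preimage in `𝒯` of an element of `𝔽_q`. -/
def teichLift (β : (GR F)ˣ) (b : ResField F) : GR F := Function.invFunOn (red F) (teich β) b

/-- The Frobenius map `σ(A + 2B) = A² + 2B²` for `A, B ∈ 𝒯`. -/
def frob (β : (GR F)ˣ) (z : GR F) : GR F :=
  let AB := Classical.epsilon fun p : GR F × GR F =>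
    p.1 ∈ teich β ∧ p.2 ∈ teich β ∧ z = p.1 + 2 * p.2
  AB.1 ^ 2 + 2 * AB.2 ^ 2

/-- The trace `T(z) = ∑_{i < m} σ^i(z)` from `R` to `ℤ/4`. -/
def grTrace (β : (GR F)ˣ) (z : GR F) : ZMod 4 :=
  Function.invFun (algebraMap (ZMod 4) (GR F)) (∑ i ∈ Finset.range m, (frob β)^[i] z)

/-- `k ↦ i^k` for `k ∈ ℤ/4`. -/
def iPow (k : ZMod 4) : ℂ := Complex.I ^ k.val

/-- The exponential sum `S(u, a, b)`. -/
def expSum (β : (GR F)ˣ) (g : Grp F) : ℂ :=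
  (∑ᶠ X ∈ teich β, iPow (g.1 + grTrace β (g.2.1 * X + 2 * teichLift β g.2.2 * X ^ 3))) +
    ∑ᶠ X ∈ teich β, iPow (-g.1 - grTrace β (g.2.1 * X + 2 * teichLift β g.2.2 * X ^ 3))

/-- The value at `h = (u, a, b)` of the character labelled by `g = (v, c, d)`,
that is `i^(uv + T(ac + 2bd))`. -/
def pairing (β : (GR F)ˣ) (g h : Grp F) : ℂ :=
  iPow (h.1 * g.1 + grTrace β (h.2.1 * g.2.1 + 2 * (teichLift β h.2.2 * teichLift β g.2.2)))

/-! ### The two partitions of `G` -/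

/-- `q = 2^m`, as a complex number. -/
def qC (m : ℕ) : ℂ := 2 ^ m

/-- `s = √(2q)`, as a complex number. -/
def sC (m : ℕ) : ℂ := ((Real.sqrt (2 * 2 ^ m) : ℝ) : ℂ)

/-- The classes `ℛ_0, …, ℛ_9`. -/
def classR (β : (GR F)ˣ) : Fin 10 → Set (Grp F) :=
  ![{g | expSum β g = 2 * qC m},
    {g | expSum β g = 2 * sC m},
    {g | expSum β g = sC m ∧ g.2.2 = 0},
    {g | expSum β g = sC m ∧ g.2.2 ≠ 0},
    {g | expSum β g = 0 ∧ g.2.2 = 0},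
    {g | expSum β g = 0 ∧ g.2.2 ≠ 0},
    {g | expSum β g = -sC m ∧ g.2.2 ≠ 0},
    {g | expSum β g = -sC m ∧ g.2.2 = 0},
    {g | expSum β g = -(2 * sC m)},
    {g | expSum β g = -(2 * qC m)}]

def E0 (F : BasicIrreducible m) : Set (Grp F) := {(0, 0, 0)}

def E1 (F : BasicIrreducible m) : Set (Grp F) := {g | ∃ r : ResField F, r ≠ 0 ∧ g = (0, 0, r)}

def E2 (β : (GR F)ˣ) : Set (Grp F) :=
  {g | ∃ X ∈ teich β, g = (1, X, red F X ^ 3)} ∪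
  {g | ∃ X ∈ teich β, g = (3, -X, red F X ^ 3)}

def E3 (β : (GR F)ˣ) : Set (Grp F) :=
  ({g | ∃ X ∈ teich β, ∃ r : ResField F, g = (1, X, r)} ∪
    {g | ∃ X ∈ teich β, ∃ r : ResField F, g = (3, -X, r)}) \ E2 β

def E4 (β : (GR F)ˣ) : Set (Grp F) :=
  {g | ∃ X ∈ teich β, ∃ Y ∈ teich β, X ≠ Y ∧ g = (0, -X + Y, red F X ^ 3 + red F Y ^ 3)} ∪
  {g | ∃ X ∈ teich β, ∃ Y ∈ teich β, g = (2, X + Y, red F X ^ 3 + red F Y ^ 3)} ∪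
  {g | ∃ X ∈ teich β, ∃ Y ∈ teich β, g = (2, -X - Y, red F X ^ 3 + red F Y ^ 3)}

def E5 (β : (GR F)ˣ) : Set (Grp F) :=
  ({g | ∃ S : GR F, S ∉ Ideal.span {(2 : GR F)} ∧ ∃ r : ResField F, g = (0, S, r)} ∪
    {g | ∃ (S : GR F) (r : ResField F), g = (2, S, r)}) \ E4 β

def E6 (β : (GR F)ˣ) : Set (Grp F) :=
  {g | ∃ X ∈ teich β, ∃ Y ∈ teich β, X ≠ Y ∧ g = (1, 2 * X - Y, red F Y ^ 3)} ∪
  {g | ∃ X ∈ teich β, ∃ Y ∈ teich β, ∃ Z ∈ teich β, X ≠ Y ∧ X ≠ Z ∧ Y ≠ Z ∧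
    g = (1, -X - Y - Z, red F X ^ 3 + red F Y ^ 3 + red F Z ^ 3)} ∪
  {g | ∃ X ∈ teich β, ∃ Y ∈ teich β, ∃ Z ∈ teich β, X ≠ Y ∧ X ≠ Z ∧ Y ≠ Z ∧
    g = (1, X + Y - Z, red F X ^ 3 + red F Y ^ 3 + red F Z ^ 3)} ∪
  {g | ∃ X ∈ teich β, ∃ Y ∈ teich β, X ≠ Y ∧ g = (3, 2 * X + Y, red F Y ^ 3)} ∪
  {g | ∃ X ∈ teich β, ∃ Y ∈ teich β, ∃ Z ∈ teich β, X ≠ Y ∧ X ≠ Z ∧ Y ≠ Z ∧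
    g = (3, X + Y + Z, red F X ^ 3 + red F Y ^ 3 + red F Z ^ 3)} ∪
  {g | ∃ X ∈ teich β, ∃ Y ∈ teich β, ∃ Z ∈ teich β, X ≠ Y ∧ X ≠ Z ∧ Y ≠ Z ∧
    g = (3, -X - Y + Z, red F X ^ 3 + red F Y ^ 3 + red F Z ^ 3)}

def E7 (β : (GR F)ˣ) : Set (Grp F) :=
  ({g | ∃ X ∈ teich β, ∃ Y ∈ teich β, ∃ r : ResField F, X ≠ Y ∧ g = (1, 2 * X - Y, r)} ∪
    {g | ∃ X ∈ teich β, ∃ Y ∈ teich β, ∃ Z ∈ teich β, ∃ r : ResField F,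
      X ≠ Y ∧ X ≠ Z ∧ Y ≠ Z ∧ g = (1, -X - Y - Z, r)} ∪
    {g | ∃ X ∈ teich β, ∃ Y ∈ teich β, ∃ Z ∈ teich β, ∃ r : ResField F,
      X ≠ Y ∧ X ≠ Z ∧ Y ≠ Z ∧ g = (1, X + Y - Z, r)} ∪
    {g | ∃ X ∈ teich β, ∃ Y ∈ teich β, ∃ r : ResField F, X ≠ Y ∧ g = (3, 2 * X + Y, r)} ∪
    {g | ∃ X ∈ teich β, ∃ Y ∈ teich β, ∃ Z ∈ teich β, ∃ r : ResField F,
      X ≠ Y ∧ X ≠ Z ∧ Y ≠ Z ∧ g = (3, X + Y + Z, r)} ∪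
    {g | ∃ X ∈ teich β, ∃ Y ∈ teich β, ∃ Z ∈ teich β, ∃ r : ResField F,
      X ≠ Y ∧ X ≠ Z ∧ Y ≠ Z ∧ g = (3, -X - Y + Z, r)}) \ E6 β

def E8 (β : (GR F)ˣ) : Set (Grp F) :=
  {g | ∃ X ∈ teichStar β, ∃ Y : Fin 4 → GR F, (∀ i, Y i ∈ teich β) ∧
    (2 * X = ∑ i, Y i ∨ 2 * X = Y 0 + Y 1 - Y 2 - Y 3) ∧
    g = (0, 2 * X, ∑ i, red F (Y i) ^ 3)}

def E9 (β : (GR F)ˣ) : Set (Grp F) :=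
  {g | ∃ X ∈ teichStar β, ∃ r : ResField F, g = (0, 2 * X, r)} \ E8 β

/-- The classes `ℰ_0, …, ℰ_9`. -/
def classE (β : (GR F)ˣ) : Fin 10 → Set (Grp F) :=
  ![E0 F, E1 F, E2 β, E3 β, E4 β, E5 β, E6 β, E7 β, E8 β, E9 β]

end GaloisRing

/-! ### The eigenmatrices, as functions of `s = √(2q)` -/

def matP (s : ℂ) : Matrix (Fin 10) (Fin 10) ℂ :=
  !![1, s ^ 6 / 24 - s ^ 4 / 8 + s ^ 2 / 12, s ^ 4 / 2 - s ^ 2, s ^ 6 / 12 - s ^ 2 / 3, -2 + 2 * s ^ 2, s ^ 6 / 4 - 3 * s ^ 4 / 4 + s ^ 2 / 2, s ^ 6 / 12 - s ^ 2 / 3, s ^ 4 / 2 - s ^ 2, s ^ 6 / 24 - s ^ 4 / 8 + s ^ 2 / 12, 1;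
     1, -s ^ 4 / 12 + s ^ 2 / 12, s ^ 4 / 2 - s ^ 2, -s ^ 4 / 6 - s ^ 2 / 3, -2 + 2 * s ^ 2, -s ^ 4 / 2 + s ^ 2 / 2, -s ^ 4 / 6 - s ^ 2 / 3, s ^ 4 / 2 - s ^ 2, -s ^ 4 / 12 + s ^ 2 / 12, 1;
     1, s ^ 5 / 12 - s ^ 3 / 4 + s / 6, s ^ 3 / 2 - s, s ^ 5 / 12 - s / 3, 0, 0, -s ^ 5 / 12 + s / 3, -s ^ 3 / 2 + s, -s ^ 5 / 12 + s ^ 3 / 4 - s / 6, -1;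
     1, -s ^ 3 / 6 + s / 6, s ^ 3 / 2 - s, -s ^ 3 / 6 - s / 3, 0, 0, s ^ 3 / 6 + s / 3, -s ^ 3 / 2 + s, s ^ 3 / 6 - s / 6, -1;
     1, s ^ 4 / 8 - s ^ 2 / 4, 0, 0, -2, -s ^ 4 / 4 + s ^ 2 / 2, 0, 0, s ^ 4 / 8 - s ^ 2 / 4, 1;
     1, -s ^ 2 / 4, 0, 0, -2, s ^ 2 / 2, 0, 0, -s ^ 2 / 4, 1;
     1, s ^ 3 / 12 + s / 6, -s, -s ^ 3 / 6 - s / 3, 0, 0, s ^ 3 / 6 + s / 3, s, -s ^ 3 / 12 - s / 6, -1;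
     1, -s ^ 3 / 6 + s / 6, -s, -s / 3 + s ^ 3 / 3, 0, 0, s / 3 - s ^ 3 / 3, s, s ^ 3 / 6 - s / 6, -1;
     1, s ^ 4 / 24 + s ^ 2 / 12, -s ^ 2, -s ^ 4 / 6 - s ^ 2 / 3, -2 + 2 * s ^ 2, s ^ 4 / 4 + s ^ 2 / 2, -s ^ 4 / 6 - s ^ 2 / 3, -s ^ 2, s ^ 4 / 24 + s ^ 2 / 12, 1;
     1, -s ^ 4 / 12 + s ^ 2 / 12, -s ^ 2, -s ^ 2 / 3 + s ^ 4 / 3, -2 + 2 * s ^ 2, -s ^ 4 / 2 + s ^ 2 / 2, -s ^ 2 / 3 + s ^ 4 / 3, -s ^ 2, -s ^ 4 / 12 + s ^ 2 / 12, 1]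

def matQ (s : ℂ) : Matrix (Fin 10) (Fin 10) ℂ :=
  !![1, s ^ 2 / 2 - 1, s ^ 2, (s ^ 2 - 2) * s ^ 2 / 2, s ^ 2 * (s ^ 2 - 1) / 2, s ^ 2 * (s ^ 4 - 3 * s ^ 2 + 2) / 4, s ^ 2 * (s ^ 4 - 3 * s ^ 2 + 2) / 6, s ^ 2 * (s ^ 4 - 4) / 12, s ^ 4 / 6 - s ^ 2 / 2 + 1 / 3, s ^ 4 / 12 - 1 / 3;
     1, -1, 2 * s, -2 * s, 3 * s ^ 2 / 2, -3 * s ^ 2 / 2, s * (s ^ 2 + 2) / 3, -s * (s ^ 2 + 2) / 3, s ^ 2 / 6 + 1 / 3, -s ^ 2 / 6 - 1 / 3;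
     1, s ^ 2 / 2 - 1, s, (s ^ 2 - 2) * s / 2, 0, 0, -s * (s ^ 2 - 1) / 3, -s * (s ^ 2 + 2) / 6, 1 / 3 - s ^ 2 / 3, -s ^ 2 / 6 - 1 / 3;
     1, -1, s, -s, 0, 0, -s * (s ^ 2 - 1) / 3, s * (s ^ 2 - 1) / 3, 1 / 3 - s ^ 2 / 3, -1 / 3 + s ^ 2 / 3;
     1, s ^ 2 / 2 - 1, 0, 0, -s ^ 2 / 2, -(s ^ 2 - 2) * s ^ 2 / 4, 0, 0, s ^ 4 / 6 - s ^ 2 / 2 + 1 / 3, s ^ 4 / 12 - 1 / 3;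
     1, -1, 0, 0, -s ^ 2 / 2, s ^ 2 / 2, 0, 0, s ^ 2 / 6 + 1 / 3, -s ^ 2 / 6 - 1 / 3;
     1, -1, -s, s, 0, 0, s * (s ^ 2 - 1) / 3, -s * (s ^ 2 - 1) / 3, 1 / 3 - s ^ 2 / 3, -1 / 3 + s ^ 2 / 3;
     1, s ^ 2 / 2 - 1, -s, -(s ^ 2 - 2) * s / 2, 0, 0, s * (s ^ 2 - 1) / 3, s * (s ^ 2 + 2) / 6, 1 / 3 - s ^ 2 / 3, -s ^ 2 / 6 - 1 / 3;
     1, -1, -2 * s, 2 * s, 3 * s ^ 2 / 2, -3 * s ^ 2 / 2, -s * (s ^ 2 + 2) / 3, s * (s ^ 2 + 2) / 3, s ^ 2 / 6 + 1 / 3, -s ^ 2 / 6 - 1 / 3;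
     1, s ^ 2 / 2 - 1, -s ^ 2, -(s ^ 2 - 2) * s ^ 2 / 2, s ^ 2 * (s ^ 2 - 1) / 2, s ^ 2 * (s ^ 4 - 3 * s ^ 2 + 2) / 4, -s ^ 2 * (s ^ 4 - 3 * s ^ 2 + 2) / 6, -s ^ 2 * (s ^ 4 - 4) / 12, s ^ 4 / 6 - s ^ 2 / 2 + 1 / 3, s ^ 4 / 12 - 1 / 3]

end DGScheme

end

open DGScheme

/-!
The group `G = ℤ/4 × R × 𝔽_q` is identified with its character group by the symmetric pairing
`g ↦ χ_g`. Two partitions of such a group, both containing `{0}` and stable under negation, form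
translation schemes dual to each other as soon as the character sums over the classes of either one
are constant on the classes of the other (`DualPartitions`). By Fourier inversion one half of this
is enough: if the sums over the `ℰ_j` are constant on the `ℛ_i`, with matrix `Q`, and
`Q P = |G|`, then the sums over the `ℛ_j` are constant on the `ℰ_i`, with matrix `P`
(`charSum_of_mul_eq`). So everything reduces to computing the sums of `χ_g` over the `ℰ_j` and
finding that they depend only on the value of `S = expSum g` and on whether `b = 0`.

Let `D = ℰ_2` be the set of the vectors `±(1, X, x³)` (`codeSet`); then `S` is the sum of `χ_g`
over `D`, twice the real part of the sum over the vectors `(1, X, x³)`. The latter is a quadratic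
Gauss sum: its squared modulus is `0` or `q` times the order of the radical of a symmetric form
on `𝔽_q` attached to `(a mod 2, b)`, and for `b ≠ 0` this order is `1`, `2` or `4`. Being a Gaussian
integer whose norm is `0` or a power of two, the Gauss sum has its real part determined up to few
choices. So `S` is `±s` when the radical is trivial, `0` or `±2s` when it is not and `b ≠ 0`, and
`0` or `±s²` when `b = 0` and `a ∈ 2R`.

On the other side, the `ℰ_i` are described by sums of elements of `D`: `ℰ_4` consists of the nonzero
sums of two elements, `ℰ_6` of the sums of three that are not in `D`, and `ℰ_8` of those sums of
four that lie in `{0} × (2R \ {0}) × 𝔽_q`. Sums of two elements of `D` have no coincidences except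
the obvious ones (`isSignedSidon_codeSet`), already after the last coordinate is dropped, because
`𝔽_q` has no primitive cube root of unity. Hence every element of `ℰ_6` has at least six
representations. As `S² (S² - s²) (S² - 4s²)` vanishes at all but two elements of `G`, the sixth
moment of `S` follows from the second and the fourth, and its value shows that there are exactly six
(`IsSignedSidon.repCount_two_of_not_mem`). The number of representations of an element of `ℰ_8`
follows, because the translations of `𝔽_q` extend to maps of `G` that permute `D` transitively up
to sign and fix the elements of `ℰ_8` (`repCount_three_codeSet`). The sums of `χ_g` over `ℰ_4` and
`ℰ_6` are therefore polynomials in `S`, while the sum over `ℰ_8` is obtained by averaging `S⁴` over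
a coset of the annihilator of `{0} × 2R × 𝔽_q`, on which the radical is constant. The remaining
classes are the complements of these in inverse images of subsets of `ℤ/4 × R`, and the character
sums over such inverse images are immediate.
-/

noncomputable section

open Polynomial

namespace DGScheme

set_option linter.unusedSectionVars false

/-! ### Translation schemes from a pair of dual partitions -/

section DualPair

variable {X : Type*} [AddCommGroup X] [Fintype X]

open Classical in
lemma charSum_eq_sum_ite (χ : X → ℂ) (S : Set X) :
    charSum χ S = ∑ g, if g ∈ S then χ g else 0 := by
  simp only [charSum, Set.indicator_apply]

open Classical in
lemma charSum_one (S : Set X) :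
    charSum (fun _ => 1) S = ((Finset.univ.filter (· ∈ S)).card : ℂ) := by
  simp [charSum_eq_sum_ite]

/-- A symmetric identification of a finite abelian group with its character group. -/
structure SelfDual (Φ : X ≃+ AddChar X ℂ) : Prop where
  comm : ∀ g h, Φ g h = Φ h g

variable {Φ : X ≃+ AddChar X ℂ}

lemma apply_add_left (g g' h : X) : Φ (g + g') h = Φ g h * Φ g' h := by
  simp [AddChar.add_apply]

lemma apply_zero_left (h : X) : Φ 0 h = 1 := by simp

lemma apply_neg_left (g h : X) : Φ (-g) h = Φ g (-h) := by
  simp [AddChar.neg_apply]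

open Classical in
lemma sum_apply (g : X) : ∑ h, Φ g h = if g = 0 then (Fintype.card X : ℂ) else 0 := by
  rw [AddChar.sum_eq_ite]
  simp

open Classical in
/-- Fourier inversion for the transform `f ↦ (g ↦ ∑ h, f h * Φ g h)`. -/
lemma fourier_inversion (hΦ : SelfDual Φ) (f : X → ℂ) (t : X) :
    ∑ g, (∑ h, f h * Φ g h) * Φ g (-t) = Fintype.card X * f t := by
  have h1 : ∀ g, (∑ h, f h * Φ g h) * Φ g (-t) = ∑ h, f h * Φ (h - t) g := by
    intro g
    rw [Finset.sum_mul]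
    refine Finset.sum_congr rfl fun h _ => ?_
    rw [mul_assoc, ← AddChar.map_add_eq_mul, hΦ.comm, sub_eq_add_neg]
  simp_rw [h1]
  rw [Finset.sum_comm]
  simp_rw [← Finset.mul_sum, sum_apply, sub_eq_zero]
  simp [mul_comm]

open Classical in
lemma charSum_eq_sum_mul (χ : X → ℂ) (S : Set X) :
    charSum χ S = ∑ h, (if h ∈ S then 1 else 0) * χ h := by
  simp [charSum_eq_sum_ite]

/-- Two partitions of `X`, indexed in the same way, whose character sums are constant on the
classes of each other, with values given by the matrices `P` and `Q`. -/
structure DualPartitions (Φ : X ≃+ AddChar X ℂ) {d : ℕ} (R E : Fin (d + 1) → Set X)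
    (P Q : Matrix (Fin (d + 1)) (Fin (d + 1)) ℂ) : Prop where
  selfDual : SelfDual Φ
  partR : ∀ g, ∃! i, g ∈ R i
  partE : ∀ g, ∃! i, g ∈ E i
  zeroR : R 0 = {0}
  zeroE : E 0 = {0}
  negR : ∀ i, ∀ g ∈ R i, -g ∈ R i
  negE : ∀ i, ∀ g ∈ E i, -g ∈ E i
  nonemptyR : ∀ i, (R i).Nonempty
  nonemptyE : ∀ i, (E i).Nonempty
  sumR : ∀ i, ∀ g ∈ E i, ∀ j, charSum (Φ g) (R j) = P i j
  sumE : ∀ i, ∀ g ∈ R i, ∀ j, charSum (Φ g) (E j) = Q i j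

variable {d : ℕ} {R E : Fin (d + 1) → Set X} {P Q : Matrix (Fin (d + 1)) (Fin (d + 1)) ℂ}

lemma DualPartitions.swap (h : DualPartitions Φ R E P Q) : DualPartitions Φ E R Q P :=
  ⟨h.selfDual, h.partE, h.partR, h.zeroE, h.zeroR, h.negE, h.negR, h.nonemptyE, h.nonemptyR,
    h.sumE, h.sumR⟩

open Classical in
lemma sum_partition (hE : ∀ g, ∃! i, g ∈ E i) (f : X → ℂ) :
    ∑ g, f g = ∑ i, ∑ g, if g ∈ E i then f g else 0 := by
  rw [Finset.sum_comm]
  refine Finset.sum_congr rfl fun g _ => ?_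
  obtain ⟨i, hi, hu⟩ := hE g
  rw [Finset.sum_eq_single i]
  · simp [hi]
  · intro j _ hj
    rw [if_neg fun h => hj (hu j h)]
  · simp

open Classical in
/-- If the character sums of the classes `E j` on the classes `R i` form a matrix `Q` with
`Q * P = |X|`, then those of the classes `R j` on the classes `E i` form the matrix `P`. -/
lemma charSum_of_mul_eq (hΦ : SelfDual Φ) (hR : ∀ g, ∃! i, g ∈ R i) (hE : ∀ g, ∃! i, g ∈ E i)
    (negE : ∀ i, ∀ g ∈ E i, -g ∈ E i)
    (hQ : ∀ i, ∀ g ∈ R i, ∀ j, charSum (Φ g) (E j) = Q i j)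
    (hQP : Q * P = (Fintype.card X : ℂ) • 1) (i : Fin (d + 1)) (g : X) (hg : g ∈ E i)
    (k : Fin (d + 1)) : charSum (Φ g) (R k) = P i k := by
  have hX : (Fintype.card X : ℂ) ≠ 0 := by
    exact_mod_cast (Fintype.card_pos_iff.mpr ⟨(0 : X)⟩).ne'
  have h1 : ∀ h, (Fintype.card X : ℂ) * (if h ∈ R k then 1 else 0)
      = ∑ j, P j k * charSum (Φ h) (E j) := by
    intro h
    obtain ⟨l, hl, hu⟩ := hR h
    have h2 : ∑ j, P j k * charSum (Φ h) (E j) = (Q * P) l k := by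
      rw [Matrix.mul_apply]
      exact Finset.sum_congr rfl fun j _ => by rw [hQ l h hl, mul_comm]
    rw [h2, hQP]
    by_cases hlk : l = k
    · subst hlk; simp [hl]
    · have : h ∉ R k := fun hk => hlk (hu k hk).symm
      simp [this, hlk]
  apply mul_left_cancel₀ hX
  rw [charSum_eq_sum_mul, Finset.mul_sum]
  simp_rw [← mul_assoc, h1, Finset.sum_mul]
  rw [Finset.sum_comm]
  have h3 : ∀ j, ∑ h, P j k * charSum (Φ h) (E j) * Φ g h
      = P j k * ((Fintype.card X : ℂ) * if -g ∈ E j then 1 else 0) := by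
    intro j
    rw [← fourier_inversion hΦ (fun x => if x ∈ E j then (1 : ℂ) else 0), Finset.mul_sum]
    refine Finset.sum_congr rfl fun h _ => ?_
    rw [charSum_eq_sum_mul, neg_neg, hΦ.comm g h, mul_assoc]
  simp_rw [h3]
  rw [Finset.sum_eq_single i]
  · rw [if_pos (negE i g hg)]; ring
  · intro j _ hj
    rw [if_neg, mul_zero, mul_zero]
    intro h
    exact hj ((hE g).unique (by simpa using negE j _ h) hg)
  · simp

open Classical in
lemma DualPartitions.inversion (h : DualPartitions Φ R E P Q) (f : Fin (d + 1) → ℂ)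
    (F : X → ℂ) (hF : ∀ l, ∀ g ∈ E l, ∑ x, F x * Φ g x = f l)
    (k : Fin (d + 1)) (t : X) (ht : t ∈ R k) :
    (Fintype.card X : ℂ) * F t = ∑ l, f l * Q k l := by
  rw [← fourier_inversion h.selfDual, sum_partition h.partE]
  refine Finset.sum_congr rfl fun l _ => ?_
  rw [← h.sumE k (-t) (h.negR k t ht) l, charSum_eq_sum_ite, Finset.mul_sum]
  refine Finset.sum_congr rfl fun g _ => ?_
  split_ifs with hg
  · rw [hF l g hg, h.selfDual.comm]
  · simp

open Classical in
lemma DualPartitions.conv_eq (h : DualPartitions Φ R E P Q) (i j k : Fin (d + 1)) (t : X)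
    (ht : t ∈ R k) :
    (Fintype.card X : ℂ) * ((Finset.univ.filter fun w => w ∈ R i ∧ t - w ∈ R j).card : ℂ)
      = ∑ l, (P l i * P l j) * Q k l := by
  rw [← h.inversion (fun l => P l i * P l j)
    (fun t => ((Finset.univ.filter fun w => w ∈ R i ∧ t - w ∈ R j).card : ℂ)) _ k t ht]
  intro l g hg
  rw [← h.sumR l g hg i, ← h.sumR l g hg j]
  simp_rw [charSum_eq_sum_ite, Finset.sum_mul_sum, Finset.card_filter, Nat.cast_sum,
    Finset.sum_mul]
  rw [Finset.sum_comm]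
  refine Finset.sum_congr rfl fun w _ => ?_
  rw [← Equiv.sum_comp (Equiv.addRight w)]
  refine Finset.sum_congr rfl fun x _ => ?_
  by_cases h1 : w ∈ R i <;> by_cases h2 : x ∈ R j <;>
    simp [h1, h2, AddChar.map_add_eq_mul, mul_comm]

open Classical in
lemma adj_translationRel (S : Fin (d + 1) → Set X) (i : Fin (d + 1)) (x y : X) :
    adj (translationRel S i) x y = if x - y ∈ S i then 1 else 0 := by
  simp only [adj, translationRel]
  congr

open Classical in
lemma adj_mul_adj_apply (i j : Fin (d + 1)) (x y : X) :
    (adj (translationRel R i) * adj (translationRel R j)) x y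
      = ((Finset.univ.filter fun w => w ∈ R i ∧ (x - y) - w ∈ R j).card : ℂ) := by
  rw [Matrix.mul_apply, Finset.card_filter, Nat.cast_sum,
    ← Equiv.sum_comp (Equiv.subLeft x)]
  refine Finset.sum_congr rfl fun w _ => ?_
  have : x - w - y = x - y - w := by abel
  by_cases h1 : w ∈ R i <;> by_cases h2 : x - y - w ∈ R j <;>
    simp [adj_translationRel, h1, h2, this]

open Classical in
lemma sum_smul_adj_apply (hR : ∀ g, ∃! i, g ∈ R i) (c : Fin (d + 1) → ℂ) (k : Fin (d + 1))
    (x y : X) (hk : x - y ∈ R k) : (∑ i, c i • adj (translationRel R i)) x y = c k := by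
  rw [Matrix.sum_apply, Finset.sum_eq_single k]
  · simp [adj_translationRel, hk]
  · intro j _ hj
    have : x - y ∉ R j := fun h => hj ((hR _).unique h hk)
    simp [adj_translationRel, this]
  · simp

theorem DualPartitions.isAssociationScheme (h : DualPartitions Φ R E P Q) :
    IsAssociationScheme (translationRel R) where
  nonempty := ⟨0⟩
  rel_nonempty i := by
    obtain ⟨g, hg⟩ := h.nonemptyR i
    exact ⟨g, 0, by simpa [translationRel] using hg⟩
  symm i x y hxy := by
    simpa [translationRel] using h.negR i _ hxy
  partition x y := h.partR (x - y)
  diagonal x y := by simp [translationRel, h.zeroR, sub_eq_zero]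
  intersection_numbers := by
    classical
    have hX : (Fintype.card X : ℂ) ≠ 0 := by
      exact_mod_cast (Fintype.card_pos_iff.mpr ⟨(0 : X)⟩).ne'
    choose t ht using h.nonemptyR
    refine ⟨fun i j k => (Finset.univ.filter fun w => w ∈ R i ∧ t k - w ∈ R j).card,
      fun i j => ?_⟩
    ext x y
    obtain ⟨k, hk, -⟩ := h.partR (x - y)
    rw [sum_smul_adj_apply h.partR _ k x y hk, adj_mul_adj_apply]
    apply mul_left_cancel₀ hX
    rw [h.conv_eq i j k _ hk, h.conv_eq i j k _ (ht k)]

/-- The idempotent `(x, y) ↦ |X|⁻¹ ∑_{g ∈ S} Φ g (x - y)` attached to a set `S` of characters. -/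
def charIdem (Φ : X ≃+ AddChar X ℂ) (S : Set X) : Matrix X X ℂ :=
  Matrix.of fun x y => (Fintype.card X : ℂ)⁻¹ * charSum (Φ (x - y)) S

open Classical in
lemma charIdem_mul (hΦ : SelfDual Φ) (S T : Set X) :
    charIdem Φ S * charIdem Φ T = charIdem Φ (S ∩ T) := by
  have hX : (Fintype.card X : ℂ) ≠ 0 := by
    exact_mod_cast (Fintype.card_pos_iff.mpr ⟨(0 : X)⟩).ne'
  ext x y
  simp only [Matrix.mul_apply, charIdem, Matrix.of_apply, charSum_eq_sum_ite]
  have h1 : ∀ z, (Fintype.card X : ℂ)⁻¹ * (∑ g, if g ∈ S then Φ (x - z) g else 0) *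
      ((Fintype.card X : ℂ)⁻¹ * ∑ g, if g ∈ T then Φ (z - y) g else 0)
      = (Fintype.card X : ℂ)⁻¹ * (Fintype.card X : ℂ)⁻¹ * ∑ g, ∑ h,
        (if g ∈ S ∧ h ∈ T then Φ g x * Φ h (-y) * Φ (h - g) z else 0) := by
    intro z
    rw [mul_mul_mul_comm, Finset.sum_mul_sum]
    congr 1
    refine Finset.sum_congr rfl fun g _ => Finset.sum_congr rfl fun h _ => ?_
    by_cases hg : g ∈ S <;> by_cases hh : h ∈ T <;> simp only [hg, hh, and_self, and_true,
      and_false, if_true, if_false, mul_zero, zero_mul]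
    rw [hΦ.comm _ g, hΦ.comm _ h, sub_eq_add_neg, sub_eq_add_neg, sub_eq_add_neg,
      AddChar.map_add_eq_mul, AddChar.map_add_eq_mul, apply_add_left, apply_neg_left]
    ring
  simp_rw [h1]
  rw [← Finset.mul_sum, Finset.sum_comm, mul_assoc]
  congr 1
  rw [inv_mul_eq_iff_eq_mul₀ hX, Finset.mul_sum]
  refine Finset.sum_congr rfl fun g _ => ?_
  rw [Finset.sum_comm, Finset.sum_eq_single g]
  · by_cases hg : g ∈ S ∧ g ∈ T
    · have hg' : g ∈ S ∩ T := hg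
      simp only [hg, hg', and_self, if_true, sub_self, apply_zero_left, mul_one,
        Finset.sum_const, Finset.card_univ, nsmul_eq_mul]
      rw [← AddChar.map_add_eq_mul, hΦ.comm, sub_eq_add_neg]
    · have hg' : g ∉ S ∩ T := hg
      simp [hg, hg']
  · intro h _ hne
    by_cases hg : g ∈ S ∧ h ∈ T
    · simp only [hg, and_self, if_true, ← Finset.mul_sum, sum_apply, sub_eq_zero, hne,
        if_false, mul_zero]
    · simp [hg]
  · simp

lemma charIdem_empty : charIdem Φ (∅ : Set X) = 0 := by
  ext x y; simp [charIdem, charSum]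

lemma charIdem_ne_zero {S : Set X} (hS : S.Nonempty) : charIdem Φ S ≠ 0 := by
  classical
  intro h
  have h0 := congrFun (congrFun h 0) 0
  have h1 : charSum (Φ (0 - 0 : X)) S = charSum (fun _ => 1) S := by
    congr 1; ext x; simp
  rw [charIdem, Matrix.of_apply, h1, charSum_one] at h0
  obtain ⟨x, hx⟩ := hS
  simp only [Matrix.zero_apply, mul_eq_zero, inv_eq_zero, Nat.cast_eq_zero,
    Finset.card_eq_zero] at h0
  rcases h0 with h0 | h0
  · exact (Fintype.card_pos_iff.mpr ⟨x⟩).ne' h0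
  · exact absurd (Finset.mem_filter.mpr ⟨Finset.mem_univ x, hx⟩) (by simp [h0])

lemma charIdem_zero (hE : E 0 = {0}) :
    charIdem Φ (E 0) = ((Fintype.card X : ℂ)⁻¹ • Matrix.of fun _ _ => 1) := by
  classical
  ext x y
  simp [charIdem, charSum_eq_sum_ite, hE]

lemma DualPartitions.charIdem_mul_ite (h : DualPartitions Φ R E P Q) (i j : Fin (d + 1)) :
    charIdem Φ (E i) * charIdem Φ (E j) = if i = j then charIdem Φ (E i) else 0 := by
  rw [charIdem_mul h.selfDual]
  split_ifs with hij
  · subst hij; rw [Set.inter_self]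
  · have : E i ∩ E j = ∅ := by
      ext x
      simp only [Set.mem_inter_iff, Set.mem_empty_iff_false, iff_false, not_and]
      intro h1 h2
      exact hij ((h.partE x).unique h1 h2)
    rw [this, charIdem_empty]

/-- Nonzero orthogonal idempotents are minimal in the algebra they span. -/
lemma isMinimalIdempotent_of_orthogonal {ι : Type*} [Fintype ι] [DecidableEq ι]
    {e : ι → Matrix X X ℂ} (he : ∀ i j, e i * e j = if i = j then e i else 0)
    (hne : ∀ i, e i ≠ 0) (i : ι) :
    IsMinimalIdempotent (Submodule.span ℂ (Set.range e)) (e i) where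
  mem := Submodule.subset_span ⟨i, rfl⟩
  ne_zero := hne i
  idem := by simp [he]
  minimal f hf hff _ hef := by
    obtain ⟨c, rfl⟩ := (Submodule.mem_span_range_iff_exists_fun ℂ).mp hf
    have h1 : e i * ∑ j, c j • e j = c i • e i := by
      simp [Finset.mul_sum, he]
    rw [h1] at hef
    rw [← hef] at hff ⊢
    rw [smul_mul_smul_comm, he, if_pos rfl] at hff
    have h2 := smul_left_injective ℂ (hne i) hff
    have h3 : c i = 0 ∨ c i = 1 := by
      have : c i * (c i - 1) = 0 := by linear_combination h2
      rcases mul_eq_zero.mp this with h | h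
      · exact Or.inl h
      · exact Or.inr (by linear_combination h)
    rcases h3 with h | h <;> simp [h]

lemma linearIndependent_of_orthogonal {ι : Type*} [Fintype ι] [DecidableEq ι]
    {e : ι → Matrix X X ℂ} (he : ∀ i j, e i * e j = if i = j then e i else 0)
    (hne : ∀ i, e i ≠ 0) : LinearIndependent ℂ e := by
  rw [Fintype.linearIndependent_iff]
  intro c hc i
  have h1 : e i * ∑ j, c j • e j = c i • e i := by
    simp [Finset.mul_sum, he]
  rw [hc, mul_zero] at h1
  exact (smul_eq_zero.mp h1.symm).resolve_right (hne i)

theorem DualPartitions.hasEigenmatrices (h : DualPartitions Φ R E P Q) :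
    HasEigenmatrices (translationRel R) P Q := by
  classical
  have hX : (Fintype.card X : ℂ) ≠ 0 := by
    exact_mod_cast (Fintype.card_pos_iff.mpr ⟨(0 : X)⟩).ne'
  have hne : ∀ i, charIdem Φ (E i) ≠ 0 := fun i => charIdem_ne_zero (h.nonemptyE i)
  have hA : ∀ j, adj (translationRel R j) = ∑ i, P i j • charIdem Φ (E i) := by
    intro j
    ext x y
    obtain ⟨k, hk, -⟩ := h.partR (x - y)
    apply mul_left_cancel₀ hX
    rw [adj_translationRel, h.inversion (fun l => P l j)
      (fun t => if t ∈ R j then 1 else 0) (fun l g hg => by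
        rw [← charSum_eq_sum_mul, h.sumR l g hg]) k _ hk, Matrix.sum_apply, Finset.mul_sum]
    refine Finset.sum_congr rfl fun i _ => ?_
    rw [Matrix.smul_apply, charIdem, Matrix.of_apply, h.sumE k _ hk, smul_eq_mul]
    field_simp
  have hE : ∀ j, charIdem Φ (E j) =
      (Fintype.card X : ℂ)⁻¹ • ∑ i, Q i j • adj (translationRel R i) := by
    intro j
    ext x y
    obtain ⟨k, hk, -⟩ := h.partR (x - y)
    rw [Matrix.smul_apply, sum_smul_adj_apply h.partR _ k x y hk, charIdem, Matrix.of_apply,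
      h.sumE k _ hk, smul_eq_mul]
  have hspan : Submodule.span ℂ (Set.range fun i => charIdem Φ (E i)) =
      boseMesner (translationRel R) := by
    apply le_antisymm
    · rw [Submodule.span_le]
      rintro _ ⟨j, rfl⟩
      simp only [SetLike.mem_coe]
      rw [hE j]
      exact Submodule.smul_mem _ _ (Submodule.sum_mem _ fun i _ =>
        Submodule.smul_mem _ _ (Submodule.subset_span ⟨i, rfl⟩))
    · rw [boseMesner, Submodule.span_le]
      rintro _ ⟨j, rfl⟩
      simp only [SetLike.mem_coe]
      rw [hA j]
      exact Submodule.sum_mem _ fun i _ =>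
        Submodule.smul_mem _ _ (Submodule.subset_span ⟨i, rfl⟩)
  refine ⟨fun i => charIdem Φ (E i), fun i => ?_,
    linearIndependent_of_orthogonal h.charIdem_mul_ite hne, hspan, charIdem_zero h.zeroE, hA, hE⟩
  rw [← hspan]
  exact isMinimalIdempotent_of_orthogonal h.charIdem_mul_ite hne i

theorem DualPartitions.isDualPartition (h : DualPartitions Φ R E P Q) :
    IsDualPartition R (fun i => Φ '' E i) where
  principal := by
    simp only [h.zeroE, Set.image_singleton, map_zero]
    rfl
  class_nonempty i := (h.nonemptyE i).image _
  partition χ := by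
    obtain ⟨g, rfl⟩ := Φ.surjective χ
    simpa [Φ.injective.mem_set_image] using h.partE g
  classes χ χ' := by
    classical
    obtain ⟨g, rfl⟩ := Φ.surjective χ
    obtain ⟨g', rfl⟩ := Φ.surjective χ'
    simp only [Φ.injective.mem_set_image]
    constructor
    · rintro ⟨i, hg, hg'⟩ j
      rw [h.sumR i g hg, h.sumR i g' hg']
    · intro hs
      obtain ⟨i, hi, -⟩ := h.partE g
      obtain ⟨i', hi', -⟩ := h.partE g'
      have hrow : ∀ j, P i j = P i' j := fun j => by
        rw [← h.sumR i g hi j, ← h.sumR i' g' hi' j, hs j]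
      have hX : (Fintype.card X : ℂ) ≠ 0 := by
        exact_mod_cast (Fintype.card_pos_iff.mpr ⟨(0 : X)⟩).ne'
      -- equal rows of `P` give equal rows of `P Q`, a multiple of the identity
      have hmem := h.swap.inversion (fun l => Q l i)
        (fun t => if t ∈ E i then (1 : ℂ) else 0)
        (fun l g hg => by rw [← charSum_eq_sum_mul, h.sumE l g hg])
      have h1 := hmem i g hi
      have h2 := hmem i' g' hi'
      simp_rw [← hrow] at h2
      rw [← h1, if_pos hi] at h2
      have h3 := mul_left_cancel₀ hX h2
      refine ⟨i, hi, ?_⟩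
      by_contra hc
      simp [hc] at h3

end DualPair

/-! ### The residue field and the Teichmüller lift -/

section Galois

variable {m : ℕ} {F : BasicIrreducible m}

lemma four_eq_zero : (4 : GR F) = 0 := by
  have h : algebraMap (ZMod 4) (GR F) 4 = 4 := map_ofNat _ 4
  rw [← h, show (4 : ZMod 4) = 0 from rfl, map_zero]

/-- The reduction `(ℤ/4)[x]/(f) → 𝔽₂[x]/(f mod 2)`. -/
def reductionModTwo (F : BasicIrreducible m) :
    GR F →+* AdjoinRoot (F.poly.map (ZMod.castHom (by decide : 2 ∣ 4) (ZMod 2))) :=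
  AdjoinRoot.map (ZMod.castHom (by decide : 2 ∣ 4) (ZMod 2)) _ _ dvd_rfl

lemma reductionModTwo_mk (p : (ZMod 4)[X]) :
    reductionModTwo F (AdjoinRoot.mk _ p)
      = AdjoinRoot.mk _ (p.map (ZMod.castHom (by decide : 2 ∣ 4) (ZMod 2))) := by
  rw [reductionModTwo, AdjoinRoot.map, AdjoinRoot.lift_mk, ← Polynomial.eval₂_map,
    ← AdjoinRoot.algebraMap_eq, ← Polynomial.aeval_def, AdjoinRoot.aeval_eq]

lemma map_surjective_two : Function.Surjective
    (Polynomial.map (ZMod.castHom (by decide : 2 ∣ 4) (ZMod 2))) :=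
  Polynomial.map_surjective _ (ZMod.castHom_surjective _)

lemma eq_two_mul_of_map_eq_zero {p : (ZMod 4)[X]}
    (hp : p.map (ZMod.castHom (by decide : 2 ∣ 4) (ZMod 2)) = 0) : ∃ r, p = 2 * r := by
  have h2 : (2 : (ZMod 4)[X]) = C 2 := rfl
  have : C (2 : ZMod 4) ∣ p := by
    rw [Polynomial.C_dvd_iff_dvd_coeff]
    intro i
    have h1 : ZMod.castHom (by decide : 2 ∣ 4) (ZMod 2) (p.coeff i) = 0 := by
      rw [← Polynomial.coeff_map, hp, coeff_zero]
    generalize p.coeff i = c at h1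
    revert h1 c
    decide
  rw [h2]
  exact this

lemma ker_reductionModTwo : RingHom.ker (reductionModTwo F) = Ideal.span {(2 : GR F)} := by
  apply le_antisymm
  · intro z hz
    obtain ⟨p, rfl⟩ := AdjoinRoot.mk_surjective z
    rw [RingHom.mem_ker, reductionModTwo_mk, AdjoinRoot.mk_eq_zero] at hz
    obtain ⟨g, hg⟩ := hz
    obtain ⟨g', rfl⟩ := map_surjective_two g
    rw [← Polynomial.map_mul, ← sub_eq_zero, ← Polynomial.map_sub] at hg
    obtain ⟨r, hr⟩ := eq_two_mul_of_map_eq_zero hg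
    rw [Ideal.mem_span_singleton]
    refine ⟨AdjoinRoot.mk _ r, ?_⟩
    rw [sub_eq_iff_eq_add.mp hr, map_add, map_mul, map_mul, AdjoinRoot.mk_self, zero_mul,
      add_zero, map_ofNat]
  · rw [Ideal.span_singleton_le_iff_mem, RingHom.mem_ker, map_ofNat]
    rw [show (2 : AdjoinRoot (F.poly.map (ZMod.castHom (by decide : 2 ∣ 4) (ZMod 2))))
      = AdjoinRoot.of _ (2 : ZMod 2) from (map_ofNat _ 2).symm,
      show (2 : ZMod 2) = 0 from rfl, map_zero]

instance isMaximal_span_two : (Ideal.span {(2 : GR F)}).IsMaximal := by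
  have : Fact (Irreducible (F.poly.map (ZMod.castHom (by decide : 2 ∣ 4) (ZMod 2)))) :=
    ⟨F.irreducible_mod_two⟩
  rw [← ker_reductionModTwo]
  refine RingHom.ker_isMaximal_of_surjective _ ?_
  intro y
  obtain ⟨g, rfl⟩ := AdjoinRoot.mk_surjective y
  obtain ⟨g', rfl⟩ := map_surjective_two g
  exact ⟨AdjoinRoot.mk _ g', reductionModTwo_mk g'⟩

lemma two_mul_eq_zero_iff {z : GR F} : 2 * z = 0 ↔ z ∈ Ideal.span {(2 : GR F)} := by
  constructor
  · intro hz
    let b := (AdjoinRoot.powerBasis' F.monic).basis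
    have h1 : ∀ i, ∃ c : ZMod 4, b.repr z i = 2 * c := by
      intro i
      have : b.repr (2 * z) i = 2 * b.repr z i := by
        rw [two_mul, map_add, Finsupp.add_apply, two_mul]
      rw [hz, map_zero, Finsupp.zero_apply] at this
      generalize b.repr z i = c at this
      revert this c
      decide
    choose c hc using h1
    rw [Ideal.mem_span_singleton]
    refine ⟨∑ i, c i • b i, ?_⟩
    conv_lhs => rw [← b.sum_repr z]
    rw [Finset.mul_sum]
    refine Finset.sum_congr rfl fun i _ => ?_
    rw [hc, two_mul, add_smul, two_mul]
  · rw [Ideal.mem_span_singleton]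
    rintro ⟨w, rfl⟩
    linear_combination w * (four_eq_zero (F := F))

lemma red_eq_zero_iff {z : GR F} : red F z = 0 ↔ z ∈ Ideal.span {(2 : GR F)} :=
  Ideal.Quotient.eq_zero_iff_mem

lemma red_surjective : Function.Surjective (red F) := Ideal.Quotient.mk_surjective

lemma two_mul_eq_iff {z w : GR F} : 2 * z = 2 * w ↔ red F z = red F w := by
  rw [← sub_eq_zero, ← mul_sub, two_mul_eq_zero_iff, ← red_eq_zero_iff, map_sub, sub_eq_zero]

lemma two_eq_zero_res : (2 : ResField F) = 0 := by
  have : red F 2 = 2 := map_ofNat _ 2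
  rw [← this, red_eq_zero_iff]
  exact Ideal.mem_span_singleton_self _

instance charTwo_res : CharP (ResField F) 2 :=
  CharTwo.of_one_ne_zero_of_two_eq_zero one_ne_zero two_eq_zero_res

lemma card_GR : Fintype.card (GR F) = 4 ^ m := by
  rw [Module.card_fintype (AdjoinRoot.powerBasis' F.monic).basis, ZMod.card, Fintype.card_fin,
    AdjoinRoot.powerBasis'_dim, F.natDegree_eq]

lemma card_res : Fintype.card (ResField F) = 2 ^ m := by
  have h1 := (AddMonoidHom.mulLeft (2 : GR F)).ker.card_mul_index
  have h2 := (red F).toAddMonoidHom.ker.card_mul_index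
  rw [AddSubgroup.index_ker] at h1 h2
  have e1 : Nat.card (red F).toAddMonoidHom.range = Fintype.card (ResField F) := by
    rw [AddMonoidHom.range_eq_top.mpr red_surjective, AddSubgroup.card_top,
      Nat.card_eq_fintype_card]
  have e2 : (red F).toAddMonoidHom.ker = (AddMonoidHom.mulLeft (2 : GR F)).ker := by
    ext z
    simp only [AddMonoidHom.mem_ker, AddMonoidHom.coe_mulLeft, two_mul_eq_zero_iff,
      ← red_eq_zero_iff]
    rfl
  have e3 : (AddMonoidHom.mulLeft (2 : GR F)).range = (AddMonoidHom.mulLeft (2 : GR F)).ker := by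
    ext z
    simp only [AddMonoidHom.mem_ker, AddMonoidHom.mem_range, AddMonoidHom.coe_mulLeft,
      two_mul_eq_zero_iff, Ideal.mem_span_singleton]
    exact ⟨fun ⟨w, hw⟩ => ⟨w, hw.symm⟩, fun ⟨w, hw⟩ => ⟨w, hw.symm⟩⟩
  rw [e1, e2] at h2
  rw [e3] at h1
  rw [Nat.card_eq_fintype_card (α := GR F), card_GR] at h1 h2
  have hpos : 0 < Nat.card (AddMonoidHom.mulLeft (2 : GR F)).ker := Nat.card_pos
  have h3 := Nat.eq_of_mul_eq_mul_left hpos (h1.trans h2.symm)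
  rw [← h3]
  have h4 : (2 ^ m) * 2 ^ m = 4 ^ m := by rw [← mul_pow]; norm_num
  exact Nat.mul_self_inj.mp (h1.trans h4.symm)

lemma pow_card_res (x : ResField F) : x ^ 2 ^ m = x := by
  let _ : Field (ResField F) := Ideal.Quotient.field _
  rw [← card_res (F := F)]
  exact FiniteField.pow_card x

lemma sq_bijective : Function.Bijective fun x : ResField F => x ^ 2 := by
  have hinj : Function.Injective fun x : ResField F => x ^ 2 := frobenius_inj (ResField F) 2
  exact ⟨hinj, Finite.surjective_of_injective hinj⟩

lemma algebraMap_eq_zero {k : ZMod 4} (h : algebraMap (ZMod 4) (GR F) k = 0) : k = 0 := by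
  have h2 : (2 : GR F) ≠ 0 := by
    intro h0
    have h1 : (1 : GR F) ∈ Ideal.span {(2 : GR F)} := two_mul_eq_zero_iff.mp (by rw [h0, zero_mul])
    exact isMaximal_span_two.ne_top ((Ideal.eq_top_iff_one _).mpr h1)
  by_contra hk
  apply h2
  have key : ∀ k : ZMod 4, k ≠ 0 → ∃ c : ZMod 4, c * k = 2 := by decide
  obtain ⟨c, hc⟩ := key k hk
  rw [← map_ofNat (algebraMap (ZMod 4) (GR F)) 2, ← hc, map_mul, h, mul_zero]

lemma algebraMap_GR_injective : Function.Injective (algebraMap (ZMod 4) (GR F)) :=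
  (injective_iff_map_eq_zero _).mpr fun _ => algebraMap_eq_zero

lemma sq_eq_of_red_eq {z w : GR F} (h : red F z = red F w) : z ^ 2 = w ^ 2 := by
  have h3 : z - w ∈ Ideal.span {(2 : GR F)} := by
    rw [← red_eq_zero_iff, map_sub, h, sub_self]
  obtain ⟨c, hc⟩ := Ideal.mem_span_singleton.mp h3
  rw [sub_eq_iff_eq_add.mp hc]
  linear_combination (c ^ 2 + c * w) * four_eq_zero (F := F)

variable (β : (GR F)ˣ) [hm : Fact (3 ≤ m)] [hβ : Fact (orderOf β = 2 ^ m - 1)]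

lemma mem_teich_iff {z : GR F} : z ∈ teich β ↔ z = 0 ∨ ∃ i : ℕ, z = (β : GR F) ^ i := by
  have hpos : 0 < 2 ^ m - 1 := by rw [← hβ.out]; exact orderOf_pos β
  constructor
  · rintro (h | ⟨i, -, h⟩)
    · exact Or.inl h
    · exact Or.inr ⟨i, h⟩
  · rintro (h | ⟨i, h⟩)
    · exact Or.inl h
    · refine Or.inr ⟨i % (2 ^ m - 1), Nat.mod_lt _ hpos, ?_⟩
      rw [h, ← Units.val_pow_eq_pow_val, ← Units.val_pow_eq_pow_val, ← hβ.out, pow_mod_orderOf]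

lemma mul_mem_teich {z w : GR F} (hz : z ∈ teich β) (hw : w ∈ teich β) : z * w ∈ teich β := by
  rw [mem_teich_iff] at *
  rcases hz with rfl | ⟨i, rfl⟩
  · simp
  rcases hw with rfl | ⟨j, rfl⟩
  · simp
  exact Or.inr ⟨i + j, by rw [pow_add]⟩

lemma pow_card_teich {z : GR F} (hz : z ∈ teich β) : z ^ 2 ^ m = z := by
  have h2 : 2 ^ m = (2 ^ m - 1) + 1 := by have := Nat.one_le_two_pow (n := m); omega
  rw [mem_teich_iff] at hz
  rcases hz with rfl | ⟨i, rfl⟩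
  · exact zero_pow (by positivity)
  · rw [← Units.val_pow_eq_pow_val, ← Units.val_pow_eq_pow_val, ← pow_mul, mul_comm, pow_mul]
    nth_rw 1 [h2]
    rw [pow_succ β, ← hβ.out, pow_orderOf_eq_one, one_mul]

lemma red_injOn_teich : Set.InjOn (red F) (teich β) := by
  intro z hz w hw h
  have hm' : 2 ^ m = 2 * 2 ^ (m - 1) := by
    rw [← pow_succ', Nat.sub_add_cancel (by have := hm.out; omega)]
  rw [← pow_card_teich β hz, ← pow_card_teich β hw, hm', pow_mul, pow_mul,
    sq_eq_of_red_eq h]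

lemma red_surjOn_teich (x : ResField F) : ∃ z ∈ teich β, red F z = x := by
  let g : Option (Fin (2 ^ m - 1)) → GR F := fun o => o.elim 0 fun i => (β : GR F) ^ (i : ℕ)
  have hg : ∀ o, g o ∈ teich β := by
    rintro (_ | i)
    · exact Or.inl rfl
    · exact Or.inr ⟨i, i.2, rfl⟩
  have : Nontrivial (GR F) := (red_surjective (F := F)).nontrivial
  have hne : ∀ i : ℕ, (β : GR F) ^ i ≠ 0 := fun i => (β.isUnit.pow i).ne_zero
  have hinj : Function.Injective g := by
    rintro (_ | i) (_ | j) h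
    · rfl
    · exact absurd h.symm (hne _)
    · exact absurd h (hne _)
    · have h1 : β ^ (i : ℕ) = β ^ (j : ℕ) := Units.ext (by simpa [g] using h)
      have h2 := pow_injOn_Iio_orderOf (x := β) (by simp [hβ.out])
        (by simp [hβ.out]) h1
      rw [Fin.ext h2]
  have hbij : Function.Bijective fun o => red F (g o) := by
    rw [Fintype.bijective_iff_injective_and_card]
    refine ⟨fun o o' h => hinj (red_injOn_teich β (hg o) (hg o') h), ?_⟩
    rw [Fintype.card_option, Fintype.card_fin, card_res]
    have := Nat.one_le_two_pow (n := m); omega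
  obtain ⟨o, ho⟩ := hbij.2 x
  exact ⟨g o, hg o, ho⟩

lemma teichLift_mem (x : ResField F) : teichLift β x ∈ teich β :=
  Function.invFunOn_mem (red_surjOn_teich β x)

@[simp] lemma red_teichLift (x : ResField F) : red F (teichLift β x) = x :=
  Function.invFunOn_eq (red_surjOn_teich β x)

lemma teichLift_red {z : GR F} (hz : z ∈ teich β) : teichLift β (red F z) = z :=
  red_injOn_teich β (teichLift_mem β _) hz (red_teichLift β _)

lemma teichLift_injective : Function.Injective (teichLift β) :=
  Function.LeftInverse.injective (red_teichLift β)

lemma exists_teichLift {z : GR F} (hz : z ∈ teich β) : ∃ x, z = teichLift β x :=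
  ⟨red F z, (teichLift_red β hz).symm⟩

lemma teichLift_zero : teichLift β 0 = 0 := by
  rw [← map_zero (red F)]; exact teichLift_red β (Or.inl rfl)

lemma teichLift_one : teichLift β 1 = 1 := by
  rw [← map_one (red F)]
  exact teichLift_red β ((mem_teich_iff β).mpr (Or.inr ⟨0, by simp⟩))

lemma teichLift_mul (x y : ResField F) :
    teichLift β (x * y) = teichLift β x * teichLift β y := by
  rw [← teichLift_red β (mul_mem_teich β (teichLift_mem β x) (teichLift_mem β y)), map_mul,
    red_teichLift, red_teichLift]

lemma teichLift_pow (x : ResField F) (n : ℕ) : teichLift β (x ^ n) = teichLift β x ^ n := by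
  induction n with
  | zero => simp [teichLift_one]
  | succ n ih => rw [pow_succ, teichLift_mul, ih, pow_succ]

/-- The additive embedding `x ↦ 2x` of the residue field, with image `2R`. -/
def dbl (x : ResField F) : GR F := 2 * teichLift β x

lemma dbl_red (z : GR F) : dbl β (red F z) = 2 * z :=
  two_mul_eq_iff.mpr (red_teichLift β _)

lemma dbl_add (x y : ResField F) : dbl β (x + y) = dbl β x + dbl β y := by
  obtain ⟨z, rfl⟩ := red_surjective x
  obtain ⟨w, rfl⟩ := red_surjective y
  rw [← map_add, dbl_red, dbl_red, dbl_red, mul_add]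

lemma dbl_zero : dbl β 0 = 0 := by rw [dbl, teichLift_zero, mul_zero]

lemma dbl_injective : Function.Injective (dbl β) := by
  intro x y h
  simpa using two_mul_eq_iff.mp h

lemma mul_dbl (z : GR F) (x : ResField F) : z * dbl β x = dbl β (red F z * x) := by
  obtain ⟨w, rfl⟩ := red_surjective x
  rw [← map_mul, dbl_red, dbl_red]; ring

lemma red_dbl (x : ResField F) : red F (dbl β x) = 0 := by
  rw [dbl, map_mul, map_ofNat, two_eq_zero_res, zero_mul]

lemma neg_dbl (x : ResField F) : -dbl β x = dbl β x := by
  rw [dbl]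
  linear_combination (-teichLift β x) * four_eq_zero (F := F)

lemma exists_dbl {z : GR F} (hz : red F z = 0) : ∃ x, z = dbl β x := by
  obtain ⟨w, rfl⟩ := Ideal.mem_span_singleton.mp (red_eq_zero_iff.mp hz)
  exact ⟨red F w, (dbl_red β w).symm⟩

lemma exists_teich_decomp (z : GR F) : ∃ a b, z = teichLift β a + dbl β b := by
  obtain ⟨b, hb⟩ := exists_dbl β (z := z - teichLift β (red F z)) (by simp)
  exact ⟨red F z, b, by rw [← hb]; ring⟩

lemma teich_decomp_unique {a b c d : ResField F}
    (h : teichLift β a + dbl β b = teichLift β c + dbl β d) : a = c ∧ b = d := by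
  have h1 := congrArg (red F) h
  simp only [map_add, red_teichLift, red_dbl, add_zero] at h1
  subst h1
  exact ⟨rfl, dbl_injective β (add_left_cancel h)⟩

/-- Addition of Teichmüller lifts, written on squares to avoid square roots. -/
lemma teichLift_sq_add_sq (x y : ResField F) :
    teichLift β (x ^ 2) + teichLift β (y ^ 2)
      = teichLift β ((x + y) ^ 2) + dbl β (x * y) := by
  have h : teichLift β (x + y) ^ 2 = (teichLift β x + teichLift β y) ^ 2 :=
    sq_eq_of_red_eq (by simp)
  rw [teichLift_pow, teichLift_pow, teichLift_pow, h, dbl, teichLift_mul]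
  linear_combination (-teichLift β x * teichLift β y) * four_eq_zero (F := F)

/-! ### The Frobenius map and the trace -/

lemma frob_decomp (a b : ResField F) :
    frob β (teichLift β a + dbl β b) = teichLift β (a ^ 2) + dbl β (b ^ 2) := by
  have hex : ∃ p : GR F × GR F, p.1 ∈ teich β ∧ p.2 ∈ teich β ∧
      teichLift β a + dbl β b = p.1 + 2 * p.2 :=
    ⟨(teichLift β a, teichLift β b), teichLift_mem β a, teichLift_mem β b, rfl⟩
  have hs := Classical.epsilon_spec hex
  rw [frob]
  generalize (Classical.epsilon fun p : GR F × GR F => p.1 ∈ teich β ∧ p.2 ∈ teich β ∧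
      teichLift β a + dbl β b = p.1 + 2 * p.2) = p at hs ⊢
  obtain ⟨h1, h2, h3⟩ := hs
  obtain ⟨c, hc⟩ := exists_teichLift β h1
  obtain ⟨d, hd⟩ := exists_teichLift β h2
  rw [hc, hd] at h3
  obtain ⟨rfl, rfl⟩ := teich_decomp_unique β h3
  simp only [hc, hd, dbl, teichLift_pow]

lemma frob_add (z w : GR F) : frob β (z + w) = frob β z + frob β w := by
  obtain ⟨a, b, rfl⟩ := exists_teich_decomp β z
  obtain ⟨c, d, rfl⟩ := exists_teich_decomp β w
  obtain ⟨a, rfl⟩ := sq_bijective.2 a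
  obtain ⟨c, rfl⟩ := sq_bijective.2 c
  have h1 : teichLift β (a ^ 2) + dbl β b + (teichLift β (c ^ 2) + dbl β d)
      = teichLift β ((a + c) ^ 2) + dbl β (a * c + b + d) := by
    rw [dbl_add, dbl_add]
    linear_combination teichLift_sq_add_sq β a c
  have h2 : (a ^ 2 + c ^ 2) = (a + c) ^ 2 := (CharTwo.add_sq _ _).symm
  have h3 : (a * c + b + d) ^ 2 = a ^ 2 * c ^ 2 + b ^ 2 + d ^ 2 := by
    rw [CharTwo.add_sq, CharTwo.add_sq, mul_pow]
  simp only
  rw [h1, frob_decomp, frob_decomp, frob_decomp, h3, dbl_add, dbl_add]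
  have := teichLift_sq_add_sq β (a ^ 2) (c ^ 2)
  rw [h2] at this
  linear_combination -this

lemma frob_iterate_decomp (j : ℕ) (a b : ResField F) :
    (frob β)^[j] (teichLift β a + dbl β b)
      = teichLift β (a ^ 2 ^ j) + dbl β (b ^ 2 ^ j) := by
  induction j with
  | zero => simp
  | succ j ih => rw [Function.iterate_succ_apply', ih, frob_decomp, ← pow_mul, ← pow_mul, pow_succ]

lemma frob_iterate_add (j : ℕ) (z w : GR F) :
    (frob β)^[j] (z + w) = (frob β)^[j] z + (frob β)^[j] w := by
  induction j with
  | zero => rfl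
  | succ j ih => simp only [Function.iterate_succ_apply', ih, frob_add]

lemma frob_iterate_card (z : GR F) : (frob β)^[m] z = z := by
  obtain ⟨a, b, rfl⟩ := exists_teich_decomp β z
  rw [frob_iterate_decomp, pow_card_res, pow_card_res]

lemma frob_zero : frob β 0 = 0 := by
  have h := frob_add β 0 0
  rw [add_zero] at h
  exact left_eq_add.mp h

lemma frob_sum {ι : Type*} (s : Finset ι) (f : ι → GR F) :
    frob β (∑ i ∈ s, f i) = ∑ i ∈ s, frob β (f i) :=
  map_sum (⟨⟨frob β, frob_zero β⟩, frob_add β⟩ : GR F →+ GR F) f s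

/-- The fixed points of the Frobenius map are the elements of `ℤ/4`. -/
lemma mem_range_of_frob_eq {z : GR F} (h : frob β z = z) :
    ∃ k, algebraMap (ZMod 4) (GR F) k = z := by
  obtain ⟨a, b, rfl⟩ := exists_teich_decomp β z
  rw [frob_decomp] at h
  obtain ⟨ha, hb⟩ := teich_decomp_unique β h
  have h01 : ∀ {x : ResField F}, x ^ 2 = x → x = 0 ∨ x = 1 := by
    intro x hx
    have : x * (x - 1) = 0 := by linear_combination hx
    exact (mul_eq_zero.mp this).imp id sub_eq_zero.mp
  rcases h01 ha with rfl | rfl <;> rcases h01 hb with rfl | rfl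
  · exact ⟨0, by simp [teichLift_zero, dbl_zero]⟩
  · exact ⟨2, by rw [teichLift_zero, dbl, teichLift_one, map_ofNat]; norm_num⟩
  · exact ⟨1, by simp [teichLift_one, dbl_zero]⟩
  · exact ⟨3, by rw [teichLift_one, dbl, teichLift_one, map_ofNat]; norm_num⟩

lemma algebraMap_grTrace (z : GR F) :
    algebraMap (ZMod 4) (GR F) (grTrace β z) = ∑ i ∈ Finset.range m, (frob β)^[i] z := by
  apply Function.invFun_eq
  apply mem_range_of_frob_eq β
  rw [frob_sum]
  have h1 := Finset.sum_range_succ' (fun i => (frob β)^[i] z) m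
  rw [Finset.sum_range_succ, frob_iterate_card] at h1
  simp only [Function.iterate_zero, id_eq, Function.iterate_succ_apply'] at h1
  exact (add_right_cancel h1).symm

lemma grTrace_add (z w : GR F) : grTrace β (z + w) = grTrace β z + grTrace β w := by
  apply algebraMap_GR_injective (F := F)
  rw [map_add, algebraMap_grTrace, algebraMap_grTrace, algebraMap_grTrace,
    ← Finset.sum_add_distrib]
  exact Finset.sum_congr rfl fun i _ => frob_iterate_add β i z w

lemma grTrace_frob (z : GR F) : grTrace β (frob β z) = grTrace β z := by
  apply algebraMap_GR_injective (F := F)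
  rw [algebraMap_grTrace, algebraMap_grTrace]
  have h1 := Finset.sum_range_succ' (fun i => (frob β)^[i] z) m
  rw [Finset.sum_range_succ, frob_iterate_card] at h1
  simp only [Function.iterate_zero, id_eq, Function.iterate_succ_apply] at h1
  exact (add_right_cancel h1).symm

/-- The trace as an additive homomorphism. -/
def traceHom : GR F →+ ZMod 4 := AddMonoidHom.mk' (grTrace β) (grTrace_add β)

lemma grTrace_zero : grTrace β (0 : GR F) = 0 := map_zero (traceHom β)

lemma grTrace_neg (z : GR F) : grTrace β (-z) = -grTrace β z := map_neg (traceHom β) z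

lemma grTrace_dbl_sq (x : ResField F) : grTrace β (dbl β (x ^ 2)) = grTrace β (dbl β x) := by
  have h := frob_decomp β 0 x
  rw [zero_pow two_ne_zero, teichLift_zero, zero_add, zero_add] at h
  rw [← h, grTrace_frob]

lemma exists_grTrace_dbl_ne_zero : ∃ x : ResField F, grTrace β (dbl β x) ≠ 0 := by
  by_contra! hall
  have hsum : ∀ x : ResField F, ∑ i ∈ Finset.range m, x ^ 2 ^ i = 0 := by
    intro x
    have h1 := algebraMap_grTrace β (dbl β x)
    rw [hall x, map_zero] at h1
    apply dbl_injective β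
    rw [dbl_zero, h1]
    have h2 : dbl β (∑ i ∈ Finset.range m, x ^ 2 ^ i)
        = ∑ i ∈ Finset.range m, dbl β (x ^ 2 ^ i) :=
      map_sum (AddMonoidHom.mk' (dbl β) (dbl_add β)) _ _
    rw [h2]
    refine Finset.sum_congr rfl fun i _ => ?_
    have h := frob_iterate_decomp β i 0 x
    rw [zero_pow (by positivity), teichLift_zero, zero_add, zero_add] at h
    exact h.symm
  -- the trace polynomial has degree `2 ^ (m - 1)`, so it cannot vanish on the whole field
  let p : (ResField F)[X] := ∑ i ∈ Finset.range m, X ^ 2 ^ i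
  have hcoeff : p.coeff 1 = 1 := by
    simp only [p, finsetSum_coeff, coeff_X_pow]
    rw [Finset.sum_eq_single 0]
    · simp
    · intro i _ hi
      rw [if_neg]
      exact (Nat.one_lt_two_pow hi).ne
    · intro h
      exact absurd (Finset.mem_range.mpr (by have := hm.out; omega)) h
  have hp : p ≠ 0 := by
    intro h0
    rw [h0, coeff_zero] at hcoeff
    exact zero_ne_one hcoeff
  have hdeg : p.natDegree ≤ 2 ^ (m - 1) := by
    refine natDegree_sum_le_of_forall_le _ _ fun i hi => ?_
    rw [natDegree_X_pow]
    exact Nat.pow_le_pow_right (by norm_num) (by have := Finset.mem_range.mp hi; omega)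
  have hcard := p.card_roots'
  have hsub : (Finset.univ : Finset (ResField F)).val ≤ p.roots := by
    rw [Multiset.le_iff_subset Finset.univ.nodup]
    intro x _
    rw [mem_roots hp, IsRoot.def]
    simpa [p, eval_finsetSum] using hsum x
  have h3 := (Multiset.card_le_card hsub).trans (hcard.trans hdeg)
  rw [Finset.card_val, Finset.card_univ, card_res] at h3
  exact absurd h3 (not_le.mpr (Nat.pow_lt_pow_right (by norm_num) (by have := hm.out; omega)))

lemma exists_grTrace_dbl_mul_ne_zero {y : ResField F} (hy : y ≠ 0) :
    ∃ x : ResField F, grTrace β (dbl β (x * y)) ≠ 0 := by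
  obtain ⟨x, hx⟩ := exists_grTrace_dbl_ne_zero β
  obtain ⟨w, hw⟩ := Ideal.Quotient.exists_inv hy
  exact ⟨x * w, by rwa [mul_assoc, mul_comm w, hw, mul_one]⟩

/-- Nondegeneracy of the trace form of the Galois ring. -/
lemma exists_grTrace_mul_ne_zero {c : GR F} (hc : c ≠ 0) : ∃ a, grTrace β (a * c) ≠ 0 := by
  by_cases h : red F c = 0
  · obtain ⟨y, rfl⟩ := exists_dbl β h
    have hy : y ≠ 0 := by rintro rfl; exact hc (dbl_zero β)
    obtain ⟨x, hx⟩ := exists_grTrace_dbl_mul_ne_zero β hy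
    exact ⟨teichLift β x, by rwa [mul_dbl, red_teichLift]⟩
  · obtain ⟨x, hx⟩ := exists_grTrace_dbl_mul_ne_zero β h
    exact ⟨dbl β x, by rwa [mul_comm, mul_dbl, mul_comm]⟩

end Galois

/-! ### The pairing on `G` -/

section Pairing

lemma iPow_add (k l : ZMod 4) : iPow (k + l) = iPow k * iPow l := by
  rw [iPow, iPow, iPow, ← pow_add, ZMod.val_add, ← Complex.I_pow_eq_pow_mod]

lemma iPow_zero : iPow 0 = 1 := by simp [iPow]

/-- The character `k ↦ i ^ k` of `ℤ/4`. -/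
def iChar : AddChar (ZMod 4) ℂ := ⟨iPow, iPow_zero, iPow_add⟩

lemma iPow_one : iPow 1 = Complex.I := by
  rw [iPow, show (1 : ZMod 4).val = 1 from rfl, pow_one]

lemma iPow_two : iPow 2 = -1 := by
  rw [show (2 : ZMod 4) = 1 + 1 from rfl, iPow_add, iPow_one, Complex.I_mul_I]

lemma iPow_three : iPow 3 = -Complex.I := by
  rw [show (3 : ZMod 4) = 2 + 1 from rfl, iPow_add, iPow_one, iPow_two, neg_one_mul]

lemma zmod_four_cases (k : ZMod 4) : k = 0 ∨ k = 1 ∨ k = 2 ∨ k = 3 := by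
  revert k; decide

lemma iPow_eq_one_iff {k : ZMod 4} : iPow k = 1 ↔ k = 0 := by
  constructor
  · intro h
    rcases zmod_four_cases k with rfl | rfl | rfl | rfl
    · rfl
    · rw [iPow_one] at h
      simpa using congrArg Complex.re h
    · rw [iPow_two] at h
      norm_num at h
    · rw [iPow_three] at h
      simpa using congrArg Complex.re h
  · rintro rfl; exact iPow_zero

lemma iPow_neg (k : ZMod 4) : iPow (-k) = (starRingEnd ℂ) (iPow k) := by
  rcases zmod_four_cases k with rfl | rfl | rfl | rfl
  · simp [iPow_zero]
  · rw [show (-1 : ZMod 4) = 3 from rfl, iPow_three, iPow_one, Complex.conj_I]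
  · rw [show (-2 : ZMod 4) = 2 from rfl, iPow_two]; simp
  · rw [show (-3 : ZMod 4) = 1 from rfl, iPow_three, iPow_one]; simp

open Classical in
lemma sum_iPow {A : Type*} [AddCommGroup A] [Fintype A] (φ : A →+ ZMod 4) :
    ∑ x, iPow (φ x) = if (∀ x, φ x = 0) then (Fintype.card A : ℂ) else 0 := by
  have h := AddChar.sum_eq_ite (iChar.compAddMonoidHom φ)
  have h1 : iChar.compAddMonoidHom φ = 0 ↔ ∀ x, φ x = 0 := by
    rw [DFunLike.ext_iff]
    exact forall_congr' fun x => iPow_eq_one_iff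
  simp only [h1] at h
  exact h

variable {m : ℕ} {F : BasicIrreducible m} (β : (GR F)ˣ) [hm : Fact (3 ≤ m)]
  [hβ : Fact (orderOf β = 2 ^ m - 1)]

lemma two_mul_teichLift_mul (x y : ResField F) :
    2 * (teichLift β x * teichLift β y) = dbl β (x * y) := by
  rw [dbl, teichLift_mul]

lemma pairing_eq (g h : Grp F) : pairing β g h =
    iPow (h.1 * g.1 + grTrace β (h.2.1 * g.2.1 + dbl β (h.2.2 * g.2.2))) := by
  rw [pairing, two_mul_teichLift_mul]

lemma pairing_comm (g h : Grp F) : pairing β g h = pairing β h g := by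
  rw [pairing_eq, pairing_eq, mul_comm g.1, mul_comm g.2.1, mul_comm g.2.2]

lemma pairing_add_right (g h h' : Grp F) :
    pairing β g (h + h') = pairing β g h * pairing β g h' := by
  rw [pairing_eq, pairing_eq, pairing_eq, ← iPow_add]
  simp only [Prod.fst_add, Prod.snd_add, add_mul, dbl_add, grTrace_add]
  congr 1
  abel

lemma pairing_zero_right (g : Grp F) : pairing β g 0 = 1 := by
  rw [pairing_eq]
  simp [dbl_zero, grTrace_zero, iPow_zero]

/-- The character `χ_g`, additively in `g`. -/
def pairingHom : Grp F →+ AddChar (Grp F) ℂ :=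
  AddMonoidHom.mk' (fun g => ⟨pairing β g, pairing_zero_right β g, pairing_add_right β g⟩)
    fun g g' => by
      ext h
      change pairing β (g + g') h = pairing β g h * pairing β g' h
      rw [pairing_comm, pairing_add_right, pairing_comm β h, pairing_comm β h]

lemma pairingHom_apply (g h : Grp F) : pairingHom β g h = pairing β g h := rfl

lemma pairingHom_injective : Function.Injective (pairingHom β) := by
  rw [injective_iff_map_eq_zero]
  rintro ⟨v, c, d⟩ hg
  have h1 : ∀ h, pairing β (v, c, d) h = 1 := fun h => by
    rw [← pairingHom_apply, hg]; rfl
  simp only [pairing_eq, iPow_eq_one_iff] at h1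
  have hv : v = 0 := by simpa [dbl_zero, grTrace_zero] using h1 (1, 0, 0)
  have hd : d = 0 := by
    by_contra hd
    obtain ⟨x, hx⟩ := exists_grTrace_dbl_mul_ne_zero β hd
    exact hx (by simpa using h1 (0, 0, x))
  have hc : c = 0 := by
    by_contra hc
    obtain ⟨x, hx⟩ := exists_grTrace_mul_ne_zero β hc
    exact hx (by simpa [dbl_zero] using h1 (0, x, 0))
  rw [hv, hc, hd]; rfl

/-- The isomorphism `g ↦ χ_g` of `G` with its character group. -/
def pairingEquiv : Grp F ≃+ AddChar (Grp F) ℂ :=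
  AddEquiv.ofBijective (pairingHom β) ((Fintype.bijective_iff_injective_and_card _).mpr
    ⟨pairingHom_injective β, AddChar.card_eq.symm⟩)

lemma pairingEquiv_apply (g h : Grp F) : pairingEquiv β g h = pairing β g h := rfl

lemma selfDual_pairingEquiv : SelfDual (pairingEquiv β) := ⟨pairing_comm β⟩

lemma pairing_add_left (g g' h : Grp F) :
    pairing β (g + g') h = pairing β g h * pairing β g' h := by
  rw [pairing_comm, pairing_add_right, pairing_comm β h, pairing_comm β h]

lemma pairing_neg_right (g h : Grp F) :
    pairing β g (-h) = (starRingEnd ℂ) (pairing β g h) := by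
  rw [pairing_eq, pairing_eq, ← iPow_neg]
  congr 1
  simp only [Prod.fst_neg, Prod.snd_neg, neg_mul, neg_add]
  rw [← grTrace_neg, neg_add, neg_dbl, CharTwo.neg_eq (h.2.2 * g.2.2)]

/-! ### The exponential sum as a quadratic Gauss sum -/

/-- The vector `(1, X, x³)`, a column of the parity-check matrix of the code. -/
def codeVec (x : ResField F) : Grp F := (1, teichLift β x, x ^ 3)

/-- The first half of the exponential sum. -/
def halfSum (g : Grp F) : ℂ := ∑ x, pairing β g (codeVec β x)

lemma pairing_codeVec (g : Grp F) (x : ResField F) : pairing β g (codeVec β x) =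
    iPow (g.1 + grTrace β (g.2.1 * teichLift β x +
      2 * teichLift β g.2.2 * teichLift β x ^ 3)) := by
  rw [pairing_eq, codeVec, one_mul, mul_comm g.2.1, mul_comm (x ^ 3), dbl, teichLift_mul,
    teichLift_pow, mul_assoc 2]

lemma range_teichLift : Set.range (teichLift β) = teich β := by
  ext z
  exact ⟨fun ⟨x, hx⟩ => hx ▸ teichLift_mem β x, fun h => (exists_teichLift β h).imp fun _ => Eq.symm⟩

lemma expSum_eq_halfSum (g : Grp F) :
    expSum β g = halfSum β g + (starRingEnd ℂ) (halfSum β g) := by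
  rw [expSum, ← range_teichLift, finsum_mem_range (teichLift_injective β),
    finsum_mem_range (teichLift_injective β), finsum_eq_sum_of_fintype,
    finsum_eq_sum_of_fintype, halfSum, map_sum]
  congr 1
  · exact Finset.sum_congr rfl fun x _ => (pairing_codeVec β g x).symm
  · refine Finset.sum_congr rfl fun x _ => ?_
    rw [pairing_codeVec, ← iPow_neg, neg_add, sub_eq_add_neg]

/-- The polarisation of the `ℤ/4`-valued quadratic form `x ↦ T(a X² + 2 b X⁶)`. Its values are even,
and it involves `a` through `α = a mod 2` only. -/
def polar (α b y : ResField F) : ResField F →+ ZMod 4 :=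
  AddMonoidHom.mk' (fun x => grTrace β (dbl β (α * x * y + b * (x ^ 4 * y ^ 2 + x ^ 2 * y ^ 4))))
    fun x x' => by
      rw [← grTrace_add, ← dbl_add]
      congr 2
      have h2 : (x + x') ^ 2 = x ^ 2 + x' ^ 2 := CharTwo.add_sq _ _
      have h4 : (x + x') ^ 4 = x ^ 4 + x' ^ 4 := by
        rw [show (x + x') ^ 4 = ((x + x') ^ 2) ^ 2 by ring, h2, CharTwo.add_sq]
        ring
      rw [h2, h4]
      ring

lemma polar_apply (α b y x : ResField F) : polar β α b y x =
    grTrace β (dbl β (α * x * y + b * (x ^ 4 * y ^ 2 + x ^ 2 * y ^ 4))) := rfl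

lemma polar_comm (α b y x : ResField F) : polar β α b y x = polar β α b x y := by
  rw [polar_apply, polar_apply]
  congr 2
  ring

/-- The radical of the polarisation. -/
def radical (α b : ResField F) : AddSubgroup (ResField F) where
  carrier := {y | ∀ x, polar β α b y x = 0}
  zero_mem' x := by rw [polar_comm, map_zero]
  add_mem' {y z} hy hz x := by rw [polar_comm, map_add, polar_comm, hy, polar_comm, hz, add_zero]
  neg_mem' {y} hy x := by rw [polar_comm, map_neg, polar_comm, hy, neg_zero]

lemma mem_radical {α b y : ResField F} : y ∈ radical β α b ↔ ∀ x, polar β α b y x = 0 := Iff.rfl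

/-- The quadratic form `x ↦ T(a X² + 2 b X⁶)`. -/
def quadForm (a : GR F) (b x : ResField F) : ZMod 4 :=
  grTrace β (a * teichLift β (x ^ 2) + dbl β (b * x ^ 6))

lemma quadForm_add (a : GR F) (b x y : ResField F) :
    quadForm β a b (x + y)
      = quadForm β a b x + quadForm β a b y + polar β (red F a) b y x := by
  rw [quadForm, quadForm, quadForm, polar_apply, ← grTrace_add, ← grTrace_add]
  congr 1
  have h1 : a * teichLift β ((x + y) ^ 2) = a * teichLift β (x ^ 2) + a * teichLift β (y ^ 2)
      + dbl β (red F a * (x * y)) := by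
    rw [← mul_dbl]
    have h2 := neg_dbl β (x * y)
    linear_combination (-a) * teichLift_sq_add_sq β x y + a * h2
  have h2 : b * (x + y) ^ 6 = b * x ^ 6 + b * y ^ 6 + b * (x ^ 4 * y ^ 2 + x ^ 2 * y ^ 4) := by
    linear_combination (b * (3 * x ^ 5 * y + 7 * x ^ 4 * y ^ 2 + 10 * x ^ 3 * y ^ 3
      + 7 * x ^ 2 * y ^ 4 + 3 * x * y ^ 5)) * two_eq_zero_res (F := F)
  rw [h1, h2, dbl_add, dbl_add, dbl_add, mul_assoc]
  ring

lemma quadForm_zero (a : GR F) (b : ResField F) : quadForm β a b 0 = 0 := by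
  simp [quadForm, teichLift_zero, dbl_zero, grTrace_zero]

lemma halfSum_eq (g : Grp F) :
    halfSum β g = iPow g.1 * ∑ x, iPow (quadForm β g.2.1 g.2.2 x) := by
  rw [halfSum, Finset.mul_sum, ← sq_bijective.sum_comp]
  refine Finset.sum_congr rfl fun x _ => ?_
  rw [← iPow_add, pairing_eq, quadForm, codeVec, one_mul, mul_comm g.2.1, mul_comm g.2.2, ← pow_mul]

open Classical in
/-- The squared modulus of a quadratic Gauss sum, as a sum over the radical. -/
lemma halfSum_mul_conj (g : Grp F) :
    halfSum β g * (starRingEnd ℂ) (halfSum β g)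
      = 2 ^ m * ∑ y : radical β (red F g.2.1) g.2.2, iPow (quadForm β g.2.1 g.2.2 y) := by
  have h1 : iPow g.1 * (starRingEnd ℂ) (iPow g.1) = 1 := by
    rw [← iPow_neg, ← iPow_add, add_neg_cancel, iPow_zero]
  rw [halfSum_eq, map_mul, mul_mul_mul_comm, h1, one_mul, map_sum, Finset.sum_mul_sum,
    Finset.sum_comm]
  have h2 : ∀ x, ∑ z, iPow (quadForm β g.2.1 g.2.2 z) *
      (starRingEnd ℂ) (iPow (quadForm β g.2.1 g.2.2 x))
      = ∑ y, iPow (quadForm β g.2.1 g.2.2 y) * iPow (polar β (red F g.2.1) g.2.2 y x) := by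
    intro x
    rw [← Equiv.sum_comp (Equiv.addLeft x)]
    refine Finset.sum_congr rfl fun y _ => ?_
    rw [Equiv.coe_addLeft, quadForm_add, ← iPow_neg, ← iPow_add, ← iPow_add]
    congr 1
    ring
  simp_rw [h2]
  rw [Finset.sum_comm]
  simp_rw [← Finset.mul_sum, sum_iPow, ← mem_radical]
  rw [card_res, Finset.mul_sum]
  simp_rw [mul_ite, mul_zero]
  rw [← Finset.sum_filter, ← Finset.sum_subtype_eq_sum_filter]
  have e : (Finset.subtype (fun y => y ∈ radical β (red F g.2.1) g.2.2) Finset.univ)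
      = Finset.univ := by ext; simp
  rw [e]
  refine Finset.sum_congr rfl fun y _ => ?_
  push_cast
  ring

/-- The quadratic form restricted to the radical is additive. -/
def quadFormRadical (a : GR F) (b : ResField F) : radical β (red F a) b →+ ZMod 4 :=
  AddMonoidHom.mk' (fun y => quadForm β a b y) fun y z => by
    rw [AddSubgroup.coe_add, quadForm_add, z.2 y, add_zero]

lemma halfSum_mul_conj_cases (g : Grp F) :
    halfSum β g * (starRingEnd ℂ) (halfSum β g) = 0 ∨
    halfSum β g * (starRingEnd ℂ) (halfSum β g)
      = 2 ^ m * (Nat.card (radical β (red F g.2.1) g.2.2) : ℂ) := by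
  classical
  rw [halfSum_mul_conj]
  have h := sum_iPow (quadFormRadical β g.2.1 g.2.2)
  rw [Nat.card_eq_fintype_card]
  change ∑ y : radical β (red F g.2.1) g.2.2, iPow (quadForm β g.2.1 g.2.2 y) = _ at h
  rw [h]
  split_ifs
  · right; rfl
  · left; simp

lemma halfSum_mul_conj_of_radical_eq_bot (g : Grp F) (h : radical β (red F g.2.1) g.2.2 = ⊥) :
    halfSum β g * (starRingEnd ℂ) (halfSum β g) = 2 ^ m := by
  classical
  rw [halfSum_mul_conj, h]
  simp only [Fintype.sum_unique, show ((default : (⊥ : AddSubgroup (ResField F))) : ResField F) = 0 from rfl,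
    quadForm_zero, iPow_zero, mul_one]

/-- Elements of the radical are, up to squaring, roots of a polynomial of degree at most four. -/
lemma eq_zero_of_mem_radical {α b y : ResField F} (hy : y ∈ radical β α b) :
    b ^ 2 * (y ^ 2) ^ 4 + α ^ 4 * (y ^ 2) ^ 2 + b * y ^ 2 = 0 := by
  by_contra hne
  obtain ⟨x, hx⟩ := exists_grTrace_dbl_mul_ne_zero β hne
  apply hx
  obtain ⟨x, rfl⟩ := sq_bijective.2 x
  obtain ⟨x, rfl⟩ := sq_bijective.2 x
  have h1 := mem_radical β |>.mp hy x
  rw [polar_apply, mul_add, dbl_add, dbl_add, grTrace_add, grTrace_add,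
    ← grTrace_dbl_sq β (α * x * y), ← grTrace_dbl_sq β ((α * x * y) ^ 2),
    ← grTrace_dbl_sq β (b * (x ^ 2 * y ^ 4)), ← grTrace_add, ← grTrace_add, ← dbl_add,
    ← dbl_add] at h1
  rw [← h1]
  congr 2
  ring

lemma card_radical_le {α b : ResField F} (hb : b ≠ 0) : Nat.card (radical β α b) ≤ 4 := by
  classical
  let p : (ResField F)[X] := C (b ^ 2) * X ^ 4 + C (α ^ 4) * X ^ 2 + C b * X
  have hp : p ≠ 0 := by
    intro h
    have h1 : p.coeff 1 = b := by
      simp only [p, coeff_add, coeff_C_mul, coeff_X_pow, coeff_X]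
      simp
    rw [h, coeff_zero] at h1
    exact hb h1.symm
  have hdeg : p.natDegree ≤ 4 := by
    simp only [p]
    compute_degree
  have hinj : Function.Injective fun y : radical β α b =>
      (⟨(y : ResField F) ^ 2, by
        rw [Multiset.mem_toFinset, mem_roots hp, IsRoot.def]
        simpa [p] using eq_zero_of_mem_radical β y.2⟩ : p.roots.toFinset) := by
    intro y z h
    exact Subtype.ext (sq_bijective.1 (Subtype.mk_eq_mk.mp h))
  calc Nat.card (radical β α b) ≤ Nat.card p.roots.toFinset := Nat.card_le_card_of_injective _ hinj
    _ = p.roots.toFinset.card := Nat.card_eq_card_toFinset _ |>.trans (by rw [Finset.toFinset_coe])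
    _ ≤ Multiset.card p.roots := Multiset.toFinset_card_le _
    _ ≤ 4 := (card_roots' p).trans hdeg

lemma card_radical_cases {α b : ResField F} (hb : b ≠ 0) (h : radical β α b ≠ ⊥) :
    Nat.card (radical β α b) = 2 ∨ Nat.card (radical β α b) = 4 := by
  have h1 : Nat.card (radical β α b) ∣ 2 ^ m := by
    rw [← card_res (F := F), ← Nat.card_eq_fintype_card]
    exact AddSubgroup.card_addSubgroup_dvd_card _
  obtain ⟨k, -, hk⟩ := (Nat.dvd_prime_pow Nat.prime_two).mp h1
  have h2 := card_radical_le β (α := α) hb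
  have h3 : Nat.card (radical β α b) ≠ 1 := fun h' => h (AddSubgroup.card_eq_one.mp h')
  rw [hk] at h2 h3 ⊢
  have h4 : k ≤ 2 := by
    by_contra hc
    have := Nat.pow_le_pow_right (n := 2) (by norm_num) (by omega : 3 ≤ k)
    omega
  interval_cases k
  · simp at h3
  · simp
  · simp

lemma radical_eq_bot_of_eq_zero {α : ResField F} (hα : α ≠ 0) : radical β α 0 = ⊥ := by
  rw [eq_bot_iff]
  intro y hy
  have h := eq_zero_of_mem_radical β hy
  simp only [ne_eq, OfNat.ofNat_ne_zero, not_false_eq_true, zero_pow, zero_mul, zero_add,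
    add_zero] at h
  have h' := (mul_eq_zero.mp h).resolve_left (pow_ne_zero 4 hα)
  simpa using h'

end Pairing

/-! ### Gaussian integers of norm a power of two -/

section Gaussian

lemma even_of_sq_add_sq {x y : ℤ} {k : ℕ} (h : x ^ 2 + y ^ 2 = 2 ^ (k + 2)) :
    Even x ∧ Even y := by
  have h4 : (x ^ 2 + y ^ 2) % 4 = 0 := by
    rw [h, pow_add]; simp
  rcases Int.even_or_odd' x with ⟨a, rfl | rfl⟩ <;> rcases Int.even_or_odd' y with ⟨b, rfl | rfl⟩
  · exact ⟨⟨a, by ring⟩, ⟨b, by ring⟩⟩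
  all_goals ring_nf at h4; omega

lemma sq_eq_of_sq_add_sq_odd {x y : ℤ} (k : ℕ) (h : x ^ 2 + y ^ 2 = 2 ^ (2 * k + 1)) :
    x ^ 2 = 2 ^ (2 * k) := by
  induction k generalizing x y with
  | zero =>
    norm_num at h ⊢
    have hx : x ^ 2 ≤ 2 := by nlinarith [sq_nonneg y]
    have hx1 : x ≤ 1 := by nlinarith
    have hx2 : -1 ≤ x := by nlinarith
    have hy : y ^ 2 ≤ 2 := by nlinarith [sq_nonneg x]
    have hy1 : y ≤ 1 := by nlinarith
    have hy2 : -1 ≤ y := by nlinarith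
    interval_cases x <;> interval_cases y <;> simp_all
  | succ k ih =>
    obtain ⟨⟨a, ha⟩, ⟨b, hb⟩⟩ := even_of_sq_add_sq (k := 2 * k + 1) h
    subst ha hb
    have := ih (x := a) (y := b) (by
      have e : (2 : ℤ) ^ (2 * (k + 1) + 1) = 4 * 2 ^ (2 * k + 1) := by ring
      rw [e] at h
      linarith)
    have e : (2 : ℤ) ^ (2 * (k + 1)) = 4 * 2 ^ (2 * k) := by ring
    rw [e]
    linarith

lemma sq_eq_of_sq_add_sq_even {x y : ℤ} (k : ℕ) (h : x ^ 2 + y ^ 2 = 2 ^ (2 * k)) :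
    x = 0 ∨ x ^ 2 = 2 ^ (2 * k) := by
  induction k generalizing x y with
  | zero =>
    norm_num at h ⊢
    have hx : x ^ 2 ≤ 1 := by nlinarith [sq_nonneg y]
    have hx1 : x ≤ 1 := by nlinarith
    have hx2 : -1 ≤ x := by nlinarith
    interval_cases x <;> simp_all
  | succ k ih =>
    obtain ⟨⟨a, ha⟩, ⟨b, hb⟩⟩ := even_of_sq_add_sq (k := 2 * k) h
    subst ha hb
    have e : (2 : ℤ) ^ (2 * (k + 1)) = 4 * 2 ^ (2 * k) := by ring
    rcases ih (x := a) (y := b) (by rw [e] at h; linarith) with h0 | h0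
    · left; omega
    · right
      rw [e]
      linarith

lemma iPow_gaussian (k : ZMod 4) : ∃ x y : ℤ, iPow k = x + y * Complex.I := by
  rcases zmod_four_cases k with rfl | rfl | rfl | rfl
  · exact ⟨1, 0, by simp [iPow_zero]⟩
  · exact ⟨0, 1, by simp [iPow_one]⟩
  · exact ⟨-1, 0, by simp [iPow_two]⟩
  · exact ⟨0, -1, by simp [iPow_three]⟩

lemma sum_iPow_gaussian {ι : Type*} [Fintype ι] (f : ι → ZMod 4) :
    ∃ x y : ℤ, ∑ i, iPow (f i) = x + y * Complex.I := by
  choose x y hxy using fun i => iPow_gaussian (f i)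
  refine ⟨∑ i, x i, ∑ i, y i, ?_⟩
  simp_rw [hxy]
  push_cast
  rw [Finset.sum_add_distrib, Finset.sum_mul]

end Gaussian

section Values

variable {m : ℕ} {F : BasicIrreducible m} (β : (GR F)ˣ) [hm : Fact (3 ≤ m)]
  [hodd : Fact (Odd m)] [hβ : Fact (orderOf β = 2 ^ m - 1)]

lemma halfSum_gaussian (g : Grp F) : ∃ x y : ℤ, halfSum β g = x + y * Complex.I := by
  simp only [halfSum, pairing_eq]
  exact sum_iPow_gaussian _

lemma exists_expSum_eq (g : Grp F) : ∃ x y : ℤ, expSum β g = 2 * x ∧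
    halfSum β g * (starRingEnd ℂ) (halfSum β g) = ((x ^ 2 + y ^ 2 : ℤ) : ℂ) := by
  obtain ⟨x, y, h⟩ := halfSum_gaussian β g
  refine ⟨x, y, ?_, ?_⟩
  · rw [expSum_eq_halfSum, h]
    simp
    ring
  · rw [h]
    simp only [map_add, map_mul, Complex.conj_I, map_intCast]
    push_cast
    linear_combination (-(y : ℂ) ^ 2) * Complex.I_mul_I

lemma sC_sq : sC m ^ 2 = 2 * 2 ^ m := by
  rw [sC, ← Complex.ofReal_pow, Real.sq_sqrt (by positivity)]
  push_cast
  rfl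

/-- If the radical is trivial, the exponential sum is `± √(2q)`. -/
lemma expSum_sq_of_radical_eq_bot (g : Grp F) (h : radical β (red F g.2.1) g.2.2 = ⊥) :
    expSum β g ^ 2 = sC m ^ 2 := by
  obtain ⟨x, y, hS, hN⟩ := exists_expSum_eq β g
  obtain ⟨k, hk⟩ := hodd.out
  rw [halfSum_mul_conj_of_radical_eq_bot β g h] at hN
  have hN' : x ^ 2 + y ^ 2 = 2 ^ (2 * k + 1) := by
    rw [← hk]; exact_mod_cast hN.symm
  have h1 : (x : ℂ) ^ 2 = 2 ^ (2 * k) := by exact_mod_cast sq_eq_of_sq_add_sq_odd k hN'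
  rw [hS, sC_sq, mul_pow, h1, hk]
  ring

/-- If `b ≠ 0` and the radical is not trivial, the exponential sum is `0` or `± 2 √(2q)`. -/
lemma expSum_of_radical_ne_bot (g : Grp F) (hb : g.2.2 ≠ 0)
    (h : radical β (red F g.2.1) g.2.2 ≠ ⊥) :
    expSum β g = 0 ∨ expSum β g ^ 2 = 4 * sC m ^ 2 := by
  obtain ⟨x, y, hS, hN⟩ := exists_expSum_eq β g
  obtain ⟨k, hk⟩ := hodd.out
  have hx : x = 0 ∨ x ^ 2 = 2 ^ (2 * (k + 1)) := by
    rcases halfSum_mul_conj_cases β g with h0 | h0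
    · rw [h0] at hN
      have : x ^ 2 + y ^ 2 = 0 := by exact_mod_cast hN.symm
      left
      nlinarith [sq_nonneg x, sq_nonneg y]
    · rw [hN] at h0
      rcases card_radical_cases β hb h with h2 | h2 <;> rw [h2] at h0
      · refine sq_eq_of_sq_add_sq_even (y := y) (k + 1) ?_
        rw [show 2 * (k + 1) = m + 1 by omega, pow_succ 2 m]
        exact_mod_cast h0
      · right
        refine sq_eq_of_sq_add_sq_odd (y := y) (k + 1) ?_
        rw [show 2 * (k + 1) + 1 = m + 2 by omega, pow_add 2 m]
        norm_num
        exact_mod_cast h0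
  rcases hx with hx | hx
  · left; rw [hS, hx]; simp
  · right
    have h1 : (x : ℂ) ^ 2 = 2 ^ (2 * (k + 1)) := by exact_mod_cast hx
    rw [hS, sC_sq, mul_pow, h1, hk]
    ring

end Values

/-! ### Counting representations as sums of elements of a symmetric set -/

section Counting

variable {X : Type*} [AddCommGroup X] [Fintype X]

/-- A symmetric set whose sums of two elements are as distinct as the relations
`a + (-a) = 0` and `2a = -2a` allow. -/
structure IsSignedSidon (D : Finset X) : Prop where
  neg_mem : ∀ {a}, a ∈ D → -a ∈ D
  ne_neg : ∀ {a}, a ∈ D → a ≠ -a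
  add_self : ∀ {a}, a ∈ D → a + a = -a + -a
  eq_cases : ∀ {a b c d}, a ∈ D → b ∈ D → c ∈ D → d ∈ D → a + b = c + d →
    (a = -b ∧ c = -d) ∨ (a = c ∧ b = d) ∨ (a = d ∧ b = c) ∨ (a = b ∧ c = -a ∧ d = -a)

/-- Convolution of `f` with the indicator function of `D`. -/
def convWith (D : Finset X) (f : X → ℕ) (h : X) : ℕ := ∑ c ∈ D, f (h - c)

open Classical in
/-- The number of representations of `h` as an ordered sum of `k + 1` elements of `D`. -/
def repCount (D : Finset X) (k : ℕ) : X → ℕ :=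
  (convWith D)^[k] fun h => if h ∈ D then 1 else 0

open Classical in
lemma repCount_zero (D : Finset X) (h : X) : repCount D 0 h = if h ∈ D then 1 else 0 := rfl

lemma repCount_succ (D : Finset X) (k : ℕ) (h : X) :
    repCount D (k + 1) h = ∑ c ∈ D, repCount D k (h - c) := by
  rw [repCount, Function.iterate_succ_apply']
  rfl

open Classical in
lemma repCount_one (D : Finset X) (h : X) :
    repCount D 1 h = (D.filter fun a => h - a ∈ D).card := by
  rw [repCount_succ, Finset.card_filter]
  rfl

lemma sum_repCount (D : Finset X) (k : ℕ) : ∑ h, repCount D k h = D.card ^ (k + 1) := by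
  classical
  induction k with
  | zero => simp [repCount_zero]
  | succ k ih =>
    simp_rw [repCount_succ]
    rw [Finset.sum_comm]
    have : ∀ c, ∑ h, repCount D k (h - c) = ∑ h, repCount D k h := fun c =>
      Equiv.sum_comp (Equiv.subRight c) (repCount D k)
    simp_rw [this, ih]
    rw [Finset.sum_const, smul_eq_mul, pow_succ' _ (k + 1)]

variable {D : Finset X}

lemma repCount_neg (hD : ∀ {a}, a ∈ D → -a ∈ D) (k : ℕ) (h : X) :
    repCount D k (-h) = repCount D k h := by
  classical
  induction k generalizing h with
  | zero =>
    rw [repCount_zero, repCount_zero]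
    have : -h ∈ D ↔ h ∈ D := ⟨fun h' => by simpa using hD h', hD⟩
    simp [this]
  | succ k ih =>
    rw [repCount_succ, repCount_succ]
    refine Finset.sum_nbij' (fun c => -c) (fun c => -c) (fun c hc => hD hc) (fun c hc => hD hc)
      (fun c _ => neg_neg c) (fun c _ => neg_neg c) fun c _ => ?_
    rw [← ih]
    congr 1
    abel

lemma repCount_add_pos (k : ℕ) {h c : X} (hh : 0 < repCount D k h) (hc : c ∈ D) :
    0 < repCount D (k + 1) (h + c) := by
  rw [repCount_succ]
  exact Finset.sum_pos' (fun _ _ => Nat.zero_le _) ⟨c, hc, by rwa [add_sub_cancel_right]⟩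

lemma exists_of_repCount_succ_pos {k : ℕ} {h : X} (hh : 0 < repCount D (k + 1) h) :
    ∃ c ∈ D, 0 < repCount D k (h - c) := by
  rw [repCount_succ] at hh
  by_contra! hc
  exact hh.ne' (Finset.sum_eq_zero fun c hcD => Nat.le_zero.mp (hc c hcD))

lemma repCount_zero_pos_iff {h : X} : 0 < repCount D 0 h ↔ h ∈ D := by
  classical
  rw [repCount_zero]
  split_ifs with hh <;> simp [hh]

lemma repCount_one_pos_iff {h : X} : 0 < repCount D 1 h ↔ ∃ a ∈ D, ∃ b ∈ D, h = a + b := by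
  constructor
  · intro hh
    obtain ⟨c, hc, hc'⟩ := exists_of_repCount_succ_pos hh
    exact ⟨h - c, repCount_zero_pos_iff.mp hc', c, hc, by abel⟩
  · rintro ⟨a, ha, b, hb, rfl⟩
    exact repCount_add_pos 0 (repCount_zero_pos_iff.mpr ha) hb

lemma repCount_two_pos_iff {h : X} :
    0 < repCount D 2 h ↔ ∃ a ∈ D, ∃ b ∈ D, ∃ c ∈ D, h = a + b + c := by
  constructor
  · intro hh
    obtain ⟨c, hc, hc'⟩ := exists_of_repCount_succ_pos hh
    obtain ⟨a, ha, b, hb, hab⟩ := repCount_one_pos_iff.mp hc'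
    exact ⟨a, ha, b, hb, c, hc, by rw [← hab]; abel⟩
  · rintro ⟨a, ha, b, hb, c, hc, rfl⟩
    exact repCount_add_pos 1 (repCount_one_pos_iff.mpr ⟨a, ha, b, hb, rfl⟩) hc

lemma repCount_three_pos_iff {h : X} :
    0 < repCount D 3 h ↔ ∃ a ∈ D, ∃ b ∈ D, ∃ c ∈ D, ∃ d ∈ D, h = a + b + c + d := by
  constructor
  · intro hh
    obtain ⟨d, hd, hd'⟩ := exists_of_repCount_succ_pos hh
    obtain ⟨a, ha, b, hb, c, hc, habc⟩ := repCount_two_pos_iff.mp hd'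
    exact ⟨a, ha, b, hb, c, hc, d, hd, by rw [← habc]; abel⟩
  · rintro ⟨a, ha, b, hb, c, hc, d, hd, rfl⟩
    exact repCount_add_pos 2 (repCount_two_pos_iff.mpr ⟨a, ha, b, hb, c, hc, rfl⟩) hd

/-- The transform of a representation count is a power of the transform of `D`. -/
lemma sum_repCount_mul {Φ : X ≃+ AddChar X ℂ} (D : Finset X) (k : ℕ) (g : X) :
    ∑ h, (repCount D k h : ℂ) * Φ g h = (∑ c ∈ D, Φ g c) ^ (k + 1) := by
  classical
  induction k with
  | zero => simp [repCount_zero]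
  | succ k ih =>
    simp_rw [repCount_succ]
    push_cast
    simp_rw [Finset.sum_mul]
    rw [Finset.sum_comm, pow_succ, ← ih, Finset.mul_sum]
    refine Finset.sum_congr rfl fun c _ => ?_
    rw [← Equiv.sum_comp (Equiv.addRight c), Finset.sum_mul]
    refine Finset.sum_congr rfl fun h _ => ?_
    simp only [Equiv.coe_addRight, add_sub_cancel_right, AddChar.map_add_eq_mul]
    ring

lemma IsSignedSidon.repCount_one_zero (hD : IsSignedSidon D) : repCount D 1 0 = D.card := by
  classical
  rw [repCount_one, Finset.filter_true_of_mem]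
  intro a ha
  rw [zero_sub]
  exact hD.neg_mem ha

lemma IsSignedSidon.repCount_one_eq_two (hD : IsSignedSidon D) {a b : X} (ha : a ∈ D)
    (hb : b ∈ D) (hne : a + b ≠ 0) : repCount D 1 (a + b) = 2 := by
  classical
  rw [repCount_one]
  have hab : a ≠ -b := fun h => hne (by rw [h, neg_add_cancel])
  by_cases h : a = b
  · subst h
    rw [show (D.filter fun c => a + a - c ∈ D) = {a, -a} from ?_, Finset.card_pair (hD.ne_neg ha)]
    ext c
    rw [Finset.mem_filter, Finset.mem_insert, Finset.mem_singleton]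
    constructor
    · rintro ⟨hc, hc'⟩
      rcases hD.eq_cases ha ha hc hc' (by abel) with h | h | h | h
      · exact absurd h.1 hab
      · exact Or.inl h.1.symm
      · exact Or.inl h.2.symm
      · exact Or.inr h.2.1
    · rintro (rfl | rfl)
      · exact ⟨ha, by rwa [add_sub_cancel_right]⟩
      · refine ⟨hD.neg_mem ha, ?_⟩
        rw [hD.add_self ha, add_sub_cancel_right]
        exact hD.neg_mem ha
  · rw [show (D.filter fun c => a + b - c ∈ D) = {a, b} from ?_, Finset.card_pair h]
    ext c
    rw [Finset.mem_filter, Finset.mem_insert, Finset.mem_singleton]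
    constructor
    · rintro ⟨hc, hc'⟩
      rcases hD.eq_cases ha hb hc hc' (by abel) with h' | h' | h' | h'
      · exact absurd h'.1 hab
      · exact Or.inl h'.1.symm
      · exact Or.inr h'.2.symm
      · exact absurd h'.1 h
    · rintro (rfl | rfl)
      · exact ⟨ha, by rwa [add_sub_cancel_left]⟩
      · exact ⟨hb, by rwa [add_sub_cancel_right]⟩

lemma IsSignedSidon.repCount_one_of_ne_zero (hD : IsSignedSidon D) {h : X} (hh : h ≠ 0) :
    repCount D 1 h = 0 ∨ repCount D 1 h = 2 := by
  rcases Nat.eq_zero_or_pos (repCount D 1 h) with h0 | h0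
  · exact Or.inl h0
  · obtain ⟨a, ha, b, hb, rfl⟩ := repCount_one_pos_iff.mp h0
    exact Or.inr (hD.repCount_one_eq_two ha hb hh)

lemma IsSignedSidon.repCount_two_of_mem (hD : IsSignedSidon D) {h : X} (hh : h ∈ D) :
    repCount D 2 h + 2 = 3 * D.card := by
  classical
  rw [repCount_succ, ← Finset.add_sum_erase _ _ hh, sub_self, hD.repCount_one_zero,
    Finset.sum_congr rfl (g := fun _ => 2), Finset.sum_const, Finset.card_erase_of_mem hh,
    smul_eq_mul]
  · have : 0 < D.card := Finset.card_pos.mpr ⟨h, hh⟩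
    omega
  · intro c hc
    rw [Finset.mem_erase] at hc
    rw [sub_eq_add_neg]
    apply hD.repCount_one_eq_two hh (hD.neg_mem hc.2)
    rw [← sub_eq_add_neg, sub_ne_zero]
    exact hc.1.symm

/-- A sum of three elements of `D` outside `D` has at least six representations. -/
lemma IsSignedSidon.six_le_repCount_two (hD : IsSignedSidon D) {h : X} (hh : h ∉ D)
    (hpos : 0 < repCount D 2 h) : 6 ≤ repCount D 2 h := by
  classical
  have key : ∀ {a b c : X}, a ∈ D → b ∈ D → c ∈ D → h = a + b + c →
      repCount D 1 (h - c) = 2 := by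
    intro a b c ha hb hc hs
    have e : h - c = a + b := by rw [hs]; abel
    rw [e]
    refine hD.repCount_one_eq_two ha hb fun h0 => hh ?_
    rw [hs, h0, zero_add]
    exact hc
  have three : ∀ {a b c : X}, a ≠ b → a ≠ c → b ≠ c → a ∈ D → b ∈ D → c ∈ D →
      repCount D 1 (h - a) = 2 → repCount D 1 (h - b) = 2 → repCount D 1 (h - c) = 2 →
      6 ≤ repCount D 2 h := by
    intro a b c hab hac hbc ha hb hc h1 h2 h3
    rw [repCount_succ]
    calc 6 = ∑ x ∈ ({a, b, c} : Finset X), repCount D 1 (h - x) := by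
          rw [Finset.sum_insert (by simp [hab, hac]), Finset.sum_pair hbc, h1, h2, h3]
          rfl
      _ ≤ _ := Finset.sum_le_sum_of_subset (by
          intro x
          simp only [Finset.mem_insert, Finset.mem_singleton]
          rintro (rfl | rfl | rfl) <;> assumption)
  have pair : ∀ {a c : X}, a ∈ D → c ∈ D → h = a + a + c → 6 ≤ repCount D 2 h := by
    intro a c ha hc hs
    have hac : a ≠ c := by
      rintro rfl
      apply hh
      rw [hs, hD.add_self ha, neg_add_cancel_right]
      exact hD.neg_mem ha
    have hac' : -a ≠ c := by
      rintro rfl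
      exact hh (by rwa [hs, add_neg_cancel_right])
    refine three (hD.ne_neg ha) hac hac' ha (hD.neg_mem ha) hc
      (key ha hc ha (by rw [hs]; abel)) (key (hD.neg_mem ha) hc (hD.neg_mem ha) ?_)
      (key ha ha hc hs)
    rw [hs, hD.add_self ha]
    abel
  obtain ⟨a, ha, b, hb, c, hc, hs⟩ := repCount_two_pos_iff.mp hpos
  by_cases hab : a = b
  · subst hab; exact pair ha hc hs
  by_cases hac : a = c
  · subst hac; exact pair ha hb (by rw [hs]; abel)
  by_cases hbc : b = c
  · subst hbc; exact pair hb ha (by rw [hs]; abel)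
  exact three hab hac hbc ha hb hc (key hb hc ha (by rw [hs]; abel))
    (key ha hc hb (by rw [hs]; abel)) (key ha hb hc hs)

/-- Parseval's identity. -/
lemma parseval {Φ : X ≃+ AddChar X ℂ} (hΦ : SelfDual Φ) (f f' : X → ℂ) :
    ∑ g, (∑ h, f h * Φ g h) * (∑ h, f' h * Φ g h)
      = Fintype.card X * ∑ h, f (-h) * f' h := by
  simp_rw [Finset.mul_sum]
  rw [Finset.sum_comm]
  refine Finset.sum_congr rfl fun h _ => ?_
  have := fourier_inversion hΦ f (-h)
  rw [neg_neg] at this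
  rw [← mul_assoc, ← this, Finset.sum_mul]
  exact Finset.sum_congr rfl fun g _ => by ring

lemma sum_pow_transform {Φ : X ≃+ AddChar X ℂ} (hΦ : SelfDual Φ)
    (hD : ∀ {a}, a ∈ D → -a ∈ D) (k : ℕ) :
    ∑ g, (∑ c ∈ D, Φ g c) ^ (2 * (k + 1))
      = Fintype.card X * ∑ h, (repCount D k h : ℂ) ^ 2 := by
  have h1 := parseval hΦ (fun h => (repCount D k h : ℂ)) (fun h => (repCount D k h : ℂ))
  simp_rw [sum_repCount_mul, ← pow_two, ← pow_mul, repCount_neg hD, ← pow_two] at h1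
  rw [← h1]
  refine Finset.sum_congr rfl fun g _ => ?_
  rw [mul_comm]

open Classical in
lemma sum_repCount_zero_sq : ∑ h, repCount D 0 h ^ 2 = D.card := by
  simp [repCount_zero]

lemma IsSignedSidon.sum_repCount_one_sq (hD : IsSignedSidon D) :
    ∑ h, repCount D 1 h ^ 2 + 2 * D.card = 3 * D.card ^ 2 := by
  classical
  have h1 := sum_repCount D 1
  rw [← Finset.add_sum_erase _ _ (Finset.mem_univ (0 : X)), hD.repCount_one_zero] at h1 ⊢
  have h2 : ∑ h ∈ Finset.univ.erase (0 : X), repCount D 1 h ^ 2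
      = 2 * ∑ h ∈ Finset.univ.erase (0 : X), repCount D 1 h := by
    rw [Finset.mul_sum]
    refine Finset.sum_congr rfl fun h hh => ?_
    rcases hD.repCount_one_of_ne_zero (Finset.ne_of_mem_erase hh) with h0 | h0 <;> simp [h0]
  rw [h2]
  norm_num at h1
  nlinarith

/-- The values of the transform `S` of `D` determine its sixth moment from the second and the
fourth: `S² (S² - n) (S² - 4n)` vanishes unless `S = ± n`. As a sum of three elements outside `D`
has at least six representations, this moment leaves room for no further coincidence. -/
theorem IsSignedSidon.repCount_two_of_not_mem {Φ : X ≃+ AddChar X ℂ} (hΦ : SelfDual Φ)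
    (hD : IsSignedSidon D) (hcard : 2 * Fintype.card X = D.card ^ 3) (z : X) (hz : z ≠ 0)
    (hSz : ∑ c ∈ D, Φ z c = -(D.card : ℂ))
    (hS : ∀ g, g ≠ 0 → g ≠ z → ∑ c ∈ D, Φ g c = 0 ∨ (∑ c ∈ D, Φ g c) ^ 2 = D.card ∨
      (∑ c ∈ D, Φ g c) ^ 2 = 4 * D.card) {h : X} (hh : h ∉ D) :
    repCount D 2 h = 0 ∨ repCount D 2 h = 6 := by
  classical
  have hX : (Fintype.card X : ℂ) ≠ 0 := by
    exact_mod_cast (Fintype.card_pos_iff.mpr ⟨(0 : X)⟩).ne'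
  have m2 := sum_pow_transform hΦ hD.neg_mem 0
  have m4 := sum_pow_transform hΦ hD.neg_mem 1
  have m6 := sum_pow_transform hΦ hD.neg_mem 2
  have r2 : ∑ h, (repCount D 0 h : ℂ) ^ 2 = D.card := by
    exact_mod_cast congrArg (Nat.cast (R := ℂ)) (sum_repCount_zero_sq (D := D))
  have r4 : ∑ h, (repCount D 1 h : ℂ) ^ 2 = 3 * (D.card : ℂ) ^ 2 - 2 * D.card := by
    rw [eq_sub_iff_add_eq]
    exact_mod_cast congrArg (Nat.cast (R := ℂ)) hD.sum_repCount_one_sq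
  rw [r2] at m2
  rw [r4] at m4
  have hn : 2 * (Fintype.card X : ℂ) = (D.card : ℂ) ^ 3 := by exact_mod_cast hcard
  -- only `0` and `z` contribute to the sum of `S² (S² - n) (S² - 4n)`
  have hmom : ∑ g, ((∑ c ∈ D, Φ g c) ^ 6 - 5 * D.card * (∑ c ∈ D, Φ g c) ^ 4
      + 4 * (D.card : ℂ) ^ 2 * (∑ c ∈ D, Φ g c) ^ 2)
      = 2 * ((D.card : ℂ) ^ 6 - 5 * (D.card : ℂ) ^ 5 + 4 * (D.card : ℂ) ^ 4) := by
    rw [← Finset.add_sum_erase _ _ (Finset.mem_univ (0 : X)),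
      ← Finset.add_sum_erase _ _ (Finset.mem_erase.mpr ⟨hz, Finset.mem_univ z⟩),
      Finset.sum_eq_zero (s := (Finset.univ.erase 0).erase z), hSz]
    · have h0 : ∑ c ∈ D, Φ 0 c = (D.card : ℂ) := by simp
      rw [h0]
      ring
    · intro g hg
      rw [Finset.mem_erase, Finset.mem_erase] at hg
      have hSg := hS g hg.2.1 hg.1
      generalize ∑ c ∈ D, Φ g c = S at hSg ⊢
      rcases hSg with h0 | h0 | h0
      · rw [h0]; ring
      · rw [show S ^ 6 = (S ^ 2) ^ 3 by ring, show S ^ 4 = (S ^ 2) ^ 2 by ring, h0]; ring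
      · rw [show S ^ 6 = (S ^ 2) ^ 3 by ring, show S ^ 4 = (S ^ 2) ^ 2 by ring, h0]; ring
  rw [Finset.sum_add_distrib, Finset.sum_sub_distrib, ← Finset.mul_sum, ← Finset.mul_sum] at hmom
  norm_num at m2 m4 m6
  rw [m2, m4, m6] at hmom
  have r6 : ∑ h, (repCount D 2 h : ℂ) ^ 2
      = 15 * (D.card : ℂ) ^ 3 - 30 * (D.card : ℂ) ^ 2 + 16 * D.card := by
    apply mul_left_cancel₀ hX
    linear_combination hmom - (2 * (D.card : ℂ) ^ 3 - 10 * (D.card : ℂ) ^ 2 + 8 * D.card) * hn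
  have r6' : ∑ h, (repCount D 2 h : ℤ) ^ 2
      = 15 * (D.card : ℤ) ^ 3 - 30 * (D.card : ℤ) ^ 2 + 16 * D.card := by
    exact_mod_cast r6
  have r3' : ∑ h, (repCount D 2 h : ℤ) = (D.card : ℤ) ^ 3 := by
    exact_mod_cast congrArg (Nat.cast (R := ℤ)) (sum_repCount D 2)
  have hmem : ∀ a ∈ D, (repCount D 2 a : ℤ) = 3 * D.card - 2 := by
    intro a ha
    have := hD.repCount_two_of_mem ha
    omega
  have hsum : ∑ h, (repCount D 2 h : ℤ) * (repCount D 2 h - 6)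
      = ∑ h ∈ D, (repCount D 2 h : ℤ) * (repCount D 2 h - 6) := by
    have hsD : ∑ h ∈ D, (repCount D 2 h : ℤ) * (repCount D 2 h - 6)
        = D.card * ((3 * D.card - 2) * (3 * D.card - 2 - 6)) := by
      rw [← nsmul_eq_mul, ← Finset.sum_const]
      exact Finset.sum_congr rfl fun a ha => by rw [hmem a ha]
    rw [hsD]
    have e : ∀ h, (repCount D 2 h : ℤ) * (repCount D 2 h - 6)
        = (repCount D 2 h : ℤ) ^ 2 - 6 * repCount D 2 h := fun h => by ring
    simp_rw [e]
    rw [Finset.sum_sub_distrib, ← Finset.mul_sum, r6', r3']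
    ring
  have hcompl : ∑ h ∈ Dᶜ, (repCount D 2 h : ℤ) * (repCount D 2 h - 6) = 0 := by
    have := Finset.sum_add_sum_compl D fun h => (repCount D 2 h : ℤ) * (repCount D 2 h - 6)
    linarith
  rw [Finset.sum_eq_zero_iff_of_nonneg] at hcompl
  · rcases mul_eq_zero.mp (hcompl h (Finset.mem_compl.mpr hh)) with h0 | h0
    · left; exact_mod_cast h0
    · right; omega
  · intro a ha
    rcases Nat.eq_zero_or_pos (repCount D 2 a) with h0 | h0
    · rw [h0]; simp
    · have := hD.six_le_repCount_two (Finset.mem_compl.mp ha) h0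
      exact mul_nonneg (by positivity) (by omega)

/-- If the three-fold sums behave as in `IsSignedSidon.repCount_two_of_not_mem`, a sum of four
elements whose difference with every element of `D` is a sum of three elements outside `D` has
`6 |D|` representations. -/
lemma repCount_three_eq {h : X} (h6 : ∀ a, a ∉ D → repCount D 2 a = 0 ∨ repCount D 2 a = 6)
    (hpos : ∀ e ∈ D, h - e ∉ D ∧ 0 < repCount D 2 (h - e)) : repCount D 3 h = 6 * D.card := by
  rw [repCount_succ, Finset.sum_congr rfl (g := fun _ => 6), Finset.sum_const, smul_eq_mul,
    mul_comm]
  intro e he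
  exact (h6 _ (hpos e he).1).resolve_left (hpos e he).2.ne'

end Counting

/-! ### Sums of two columns of the parity-check matrix -/

section Code

variable {m : ℕ} {F : BasicIrreducible m} (β : (GR F)ˣ) [hm : Fact (3 ≤ m)]
  [hodd : Fact (Odd m)] [hβ : Fact (orderOf β = 2 ^ m - 1)]

/-- For odd `m` the field with `2 ^ m` elements has no primitive cube root of unity. -/
lemma eq_zero_of_sq_add_mul_add_sq {u v : ResField F} (h : u ^ 2 + u * v + v ^ 2 = 0) :
    u = 0 ∧ v = 0 := by
  have h3 : u ^ 3 = v ^ 3 := by linear_combination (u - v) * h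
  have hk : ∃ k, 2 ^ m = 3 * k + 2 := by
    obtain ⟨j, hj⟩ := hodd.out
    have h1 : 4 ^ j % 3 = 1 := by rw [Nat.pow_mod]; simp
    refine ⟨2 ^ m / 3, ?_⟩
    have h2 : 2 ^ m = 4 ^ j * 2 := by rw [hj, pow_succ, pow_mul]; norm_num
    omega
  obtain ⟨k, hk⟩ := hk
  have hu := pow_card_res u
  have hv := pow_card_res v
  rw [hk, pow_add, pow_mul] at hu hv
  rw [h3] at hu
  have h4 : u * v * (u - v) = 0 := by linear_combination v ^ 2 * hu - u ^ 2 * hv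
  rcases mul_eq_zero.mp h4 with h5 | h5
  · rcases mul_eq_zero.mp h5 with rfl | rfl <;> simpa using h
  · have : u = v := sub_eq_zero.mp h5
    subst this
    have : u ^ 2 = 0 := by linear_combination h - u ^ 2 * two_eq_zero_res (F := F)
    simpa using this

lemma teichLift_add_eq {x y z w : ResField F}
    (h : teichLift β x + teichLift β y = teichLift β z + teichLift β w) :
    (x = z ∧ y = w) ∨ (x = w ∧ y = z) := by
  obtain ⟨x, rfl⟩ := sq_bijective.2 x
  obtain ⟨y, rfl⟩ := sq_bijective.2 y
  obtain ⟨z, rfl⟩ := sq_bijective.2 z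
  obtain ⟨w, rfl⟩ := sq_bijective.2 w
  simp only at h ⊢
  rw [teichLift_sq_add_sq, teichLift_sq_add_sq] at h
  obtain ⟨h1, h2⟩ := teich_decomp_unique β h
  have h3 : x + y = z + w := sq_bijective.1 h1
  have h4 : (x - z) * (x - w) = 0 := by linear_combination x * h3 - h2
  rcases mul_eq_zero.mp h4 with h5 | h5
  · have : x = z := sub_eq_zero.mp h5
    subst this
    left
    rw [add_left_cancel h3]
    simp
  · have : x = w := sub_eq_zero.mp h5
    subst this
    right
    rw [add_comm z] at h3
    rw [add_left_cancel h3]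
    simp

lemma eq_of_teichLift_add_add_add_eq_zero {x y z w : ResField F}
    (h : teichLift β x + teichLift β y + (teichLift β z + teichLift β w) = 0) :
    y = x ∧ z = x ∧ w = x := by
  obtain ⟨x, rfl⟩ := sq_bijective.2 x
  obtain ⟨y, rfl⟩ := sq_bijective.2 y
  obtain ⟨z, rfl⟩ := sq_bijective.2 z
  obtain ⟨w, rfl⟩ := sq_bijective.2 w
  simp only at h ⊢
  have h0 : teichLift β ((x + y + (z + w)) ^ 2) +
      dbl β ((x + y) * (z + w) + x * y + z * w) = teichLift β 0 + dbl β 0 := by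
    rw [dbl_add, dbl_add, teichLift_zero, dbl_zero, add_zero, ← h, teichLift_sq_add_sq,
      teichLift_sq_add_sq]
    have := teichLift_sq_add_sq β (x + y) (z + w)
    linear_combination -this
  obtain ⟨h1, h2⟩ := teich_decomp_unique β h0
  have h3 : x + y + (z + w) = 0 := by simpa using h1
  have hw : w = x + y + z := by
    linear_combination h3 - (x + y + z) * two_eq_zero_res (F := F)
  subst hw
  have h4 : (x + z) ^ 2 + (x + z) * (y + z) + (y + z) ^ 2 = 0 := by
    linear_combination h2 + (z ^ 2 - x * y) * two_eq_zero_res (F := F)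
  obtain ⟨h5, h6⟩ := eq_zero_of_sq_add_mul_add_sq h4
  have hx : x = z := CharTwo.add_eq_zero.mp h5
  have hy : y = z := CharTwo.add_eq_zero.mp h6
  subst hx hy
  refine ⟨rfl, rfl, ?_⟩
  rw [CharTwo.add_self_eq_zero, zero_add]

lemma codeVec_injective : Function.Injective (codeVec β) := by
  intro x y h
  exact teichLift_injective β (congrArg (fun g : Grp F => g.2.1) h)

lemma codeVec_inj {x y : ResField F} : codeVec β x = codeVec β y ↔ x = y :=
  (codeVec_injective β).eq_iff

lemma codeVec_ne_neg (x y : ResField F) : codeVec β x ≠ -codeVec β y := by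
  intro h
  have : (1 : ZMod 4) = -1 := congrArg (fun g : Grp F => g.1) h
  revert this; decide

lemma neg_codeVec (x : ResField F) : -codeVec β x = (3, -teichLift β x, x ^ 3) := by
  refine Prod.ext ?_ (Prod.ext rfl (CharTwo.neg_eq _))
  change (-1 : ZMod 4) = 3
  decide

open Classical in
/-- The columns of the parity-check matrix and their negatives. -/
def codeSet : Finset (Grp F) := Finset.univ.filter (· ∈ E2 β)

lemma mem_codeSet_iff_mem_E2 {g : Grp F} : g ∈ codeSet β ↔ g ∈ E2 β := by simp [codeSet]

lemma mem_codeSet {g : Grp F} :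
    g ∈ codeSet β ↔ ∃ x, g = codeVec β x ∨ g = -codeVec β x := by
  rw [mem_codeSet_iff_mem_E2]
  constructor
  · rintro (⟨X, hX, rfl⟩ | ⟨X, hX, rfl⟩) <;> obtain ⟨x, rfl⟩ := exists_teichLift β hX
    · exact ⟨x, Or.inl (by rw [codeVec, red_teichLift])⟩
    · exact ⟨x, Or.inr (by rw [neg_codeVec, red_teichLift])⟩
  · rintro ⟨x, rfl | rfl⟩
    · exact Or.inl ⟨teichLift β x, teichLift_mem β x, by rw [codeVec, red_teichLift]⟩
    · exact Or.inr ⟨teichLift β x, teichLift_mem β x, by rw [neg_codeVec, red_teichLift]⟩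

lemma codeVec_mem (x : ResField F) : codeVec β x ∈ codeSet β := (mem_codeSet β).mpr ⟨x, Or.inl rfl⟩

lemma neg_codeVec_mem (x : ResField F) : -codeVec β x ∈ codeSet β :=
  (mem_codeSet β).mpr ⟨x, Or.inr rfl⟩

lemma neg_mem_codeSet {g : Grp F} (hg : g ∈ codeSet β) : -g ∈ codeSet β := by
  obtain ⟨x, rfl | rfl⟩ := (mem_codeSet β).mp hg
  · exact neg_codeVec_mem β x
  · rw [neg_neg]; exact codeVec_mem β x

open Classical in
lemma sum_codeSet (f : Grp F → ℂ) :
    ∑ g ∈ codeSet β, f g = ∑ x, f (codeVec β x) + ∑ x, f (-codeVec β x) := by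
  have h : codeSet β = Finset.univ.image (codeVec β) ∪
      Finset.univ.image (fun x => -codeVec β x) := by
    ext g
    simp only [mem_codeSet, Finset.mem_union, Finset.mem_image, Finset.mem_univ, true_and,
      exists_or, eq_comm]
  rw [h, Finset.sum_union, Finset.sum_image, Finset.sum_image]
  · exact fun x _ y _ hxy => codeVec_injective β (neg_injective hxy)
  · exact fun x _ y _ hxy => codeVec_injective β hxy
  · rw [Finset.disjoint_left]
    intro g hg hg'
    obtain ⟨x, -, rfl⟩ := Finset.mem_image.mp hg
    obtain ⟨y, -, hy⟩ := Finset.mem_image.mp hg'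
    exact codeVec_ne_neg β x y hy.symm

lemma sum_pairing_codeSet (g : Grp F) : ∑ c ∈ codeSet β, pairing β g c = expSum β g := by
  rw [sum_codeSet, expSum_eq_halfSum, halfSum, map_sum]
  simp_rw [pairing_neg_right]

lemma card_codeSet : (codeSet β).card = 2 * 2 ^ m := by
  have h := sum_codeSet β (fun _ => 1)
  simp only [Finset.sum_const, nsmul_eq_mul, mul_one, Finset.card_univ, card_res] at h
  rw [two_mul]
  exact_mod_cast h

/-- The projection forgetting the last coordinate. -/
def proj (F : BasicIrreducible m) : Grp F →+ ZMod 4 × GR F :=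
  AddMonoidHom.mk' (fun g => (g.1, g.2.1)) fun _ _ => rfl

lemma proj_apply (g : Grp F) : proj F g = (g.1, g.2.1) := rfl

lemma add_self_eq_neg_add_neg (g : Grp F) : g + g = -g + -g := by
  refine Prod.ext ?_ (Prod.ext ?_ ?_)
  · change g.1 + g.1 = -g.1 + -g.1
    generalize g.1 = k
    revert k; decide
  · change g.2.1 + g.2.1 = -g.2.1 + -g.2.1
    linear_combination g.2.1 * four_eq_zero (F := F)
  · change g.2.2 + g.2.2 = -g.2.2 + -g.2.2
    rw [CharTwo.neg_eq]

/-- Coincidences between sums of two columns, even without the cubes, are the trivial ones. -/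
lemma eq_cases_of_proj_eq {a b c d : Grp F} (ha : a ∈ codeSet β) (hb : b ∈ codeSet β)
    (hc : c ∈ codeSet β) (hd : d ∈ codeSet β) (h : proj F (a + b) = proj F (c + d)) :
    (a = -b ∧ c = -d) ∨ (a = c ∧ b = d) ∨ (a = d ∧ b = c) ∨ (a = b ∧ c = -a ∧ d = -a) := by
  have h1 : a.1 + b.1 = c.1 + d.1 := congrArg Prod.fst h
  have h2 : a.2.1 + b.2.1 = c.2.1 + d.2.1 := congrArg Prod.snd h
  obtain ⟨x, rfl | rfl⟩ := (mem_codeSet β).mp ha <;>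
  obtain ⟨y, rfl | rfl⟩ := (mem_codeSet β).mp hb <;>
  obtain ⟨z, rfl | rfl⟩ := (mem_codeSet β).mp hc <;>
  obtain ⟨w, rfl | rfl⟩ := (mem_codeSet β).mp hd <;>
  simp only [codeVec, Prod.fst_neg, Prod.snd_neg] at h1 h2
  -- the four signs are `+ + = + +`
  · rcases teichLift_add_eq β h2 with ⟨rfl, rfl⟩ | ⟨rfl, rfl⟩ <;> simp
  · exact absurd h1 (by decide)
  · exact absurd h1 (by decide)
  -- `+ + = - -`
  · obtain ⟨rfl, rfl, rfl⟩ := eq_of_teichLift_add_add_add_eq_zero β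
      (x := x) (y := y) (z := z) (w := w) (by linear_combination h2)
    simp
  · exact absurd h1 (by decide)
  -- `+ - = + -`
  · rcases teichLift_add_eq β (x := x) (y := w) (z := z) (w := y)
      (by linear_combination h2) with ⟨rfl, rfl⟩ | ⟨rfl, rfl⟩ <;> simp
  -- `+ - = - +`
  · rcases teichLift_add_eq β (x := x) (y := z) (z := w) (w := y)
      (by linear_combination h2) with ⟨rfl, rfl⟩ | ⟨rfl, rfl⟩ <;> simp
  · exact absurd h1 (by decide)
  · exact absurd h1 (by decide)
  -- `- + = + -`
  · rcases teichLift_add_eq β (x := y) (y := w) (z := z) (w := x)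
      (by linear_combination h2) with ⟨rfl, rfl⟩ | ⟨rfl, rfl⟩ <;> simp
  -- `- + = - +`
  · rcases teichLift_add_eq β (x := y) (y := z) (z := w) (w := x)
      (by linear_combination h2) with ⟨rfl, rfl⟩ | ⟨rfl, rfl⟩ <;> simp
  · exact absurd h1 (by decide)
  -- `- - = + +`
  · obtain ⟨rfl, rfl, rfl⟩ := eq_of_teichLift_add_add_add_eq_zero β
      (x := x) (y := y) (z := z) (w := w) (by linear_combination -h2)
    simp
  · exact absurd h1 (by decide)
  · exact absurd h1 (by decide)
  -- `- - = - -`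
  · rcases teichLift_add_eq β (x := x) (y := y) (z := z) (w := w)
      (by linear_combination -h2) with ⟨rfl, rfl⟩ | ⟨rfl, rfl⟩ <;> simp

lemma isSignedSidon_codeSet : IsSignedSidon (codeSet β) where
  neg_mem := neg_mem_codeSet β
  ne_neg {a} ha h := by
    obtain ⟨x, rfl | rfl⟩ := (mem_codeSet β).mp ha
    · exact codeVec_ne_neg β x x h
    · rw [neg_neg] at h
      exact codeVec_ne_neg β x x h.symm
  add_self {a} _ := add_self_eq_neg_add_neg a
  eq_cases ha hb hc hd h := eq_cases_of_proj_eq β ha hb hc hd (congrArg _ h)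

/-- A sum of three columns projects to a column only if it is degenerate. -/
lemma degenerate_of_proj_eq {a b c d : Grp F} (ha : a ∈ codeSet β) (hb : b ∈ codeSet β)
    (hc : c ∈ codeSet β) (hd : d ∈ codeSet β) (h : proj F (a + b + c) = proj F d) :
    a = -b ∨ a = -c ∨ b = -c ∨ (a = b ∧ b = c) := by
  have h1 : proj F (a + b) = proj F (d + -c) := by
    rw [map_add (proj F) d, ← h, ← map_add, add_neg_cancel_right]
  rcases eq_cases_of_proj_eq β ha hb hd (neg_mem_codeSet β hc) h1 with h2 | h2 | h2 | h2
  · exact Or.inl h2.1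
  · exact Or.inr (Or.inr (Or.inl h2.2))
  · exact Or.inr (Or.inl h2.1)
  · exact Or.inr (Or.inr (Or.inr ⟨h2.1, by rw [← h2.1]; exact (neg_injective h2.2.2).symm⟩))

end Code

/-! ### The classes `ℰ_i` as sets of sums of columns -/

section Classes

variable {m : ℕ} {F : BasicIrreducible m} (β : (GR F)ˣ) [hm : Fact (3 ≤ m)]
  [hodd : Fact (Odd m)] [hβ : Fact (orderOf β = 2 ^ m - 1)]

lemma mem_E1_iff {g : Grp F} : g ∈ E1 F ↔ g ≠ 0 ∧ g.1 = 0 ∧ g.2.1 = 0 := by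
  obtain ⟨u, c, r⟩ := g
  constructor
  · rintro ⟨t, ht, h⟩
    obtain ⟨rfl, rfl, rfl⟩ : u = 0 ∧ c = 0 ∧ r = t := by simpa using h
    exact ⟨fun h0 => ht (congrArg (fun g : Grp F => g.2.2) h0), rfl, rfl⟩
  · rintro ⟨h0, h1, h2⟩
    dsimp only at h1 h2
    subst h1 h2
    exact ⟨r, fun hr => h0 (by rw [hr]; rfl), rfl⟩

lemma cube_add_cube_sub (x y : ResField F) : x ^ 3 + x ^ 3 + y ^ 3 = y ^ 3 := by
  rw [CharTwo.add_self_eq_zero, zero_add]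

lemma codeVec_add_codeVec (x y : ResField F) : codeVec β x + codeVec β y
    = (2, teichLift β x + teichLift β y, x ^ 3 + y ^ 3) := rfl

lemma neg_codeVec_add_codeVec (x y : ResField F) : -codeVec β x + codeVec β y
    = (0, -teichLift β x + teichLift β y, x ^ 3 + y ^ 3) := by
  rw [neg_codeVec]
  exact Prod.ext (show (3 : ZMod 4) + 1 = 0 by decide) rfl

lemma neg_codeVec_add_neg_codeVec (x y : ResField F) : -codeVec β x + -codeVec β y
    = (2, -teichLift β x - teichLift β y, x ^ 3 + y ^ 3) := by
  rw [neg_codeVec, neg_codeVec, sub_eq_add_neg]; rfl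

lemma mem_E4_iff {g : Grp F} :
    g ∈ E4 β ↔ g ≠ 0 ∧ ∃ a ∈ codeSet β, ∃ b ∈ codeSet β, g = a + b := by
  have h2 : ∀ {c : GR F} {r : ResField F}, ((2, c, r) : Grp F) ≠ 0 := fun h =>
    absurd (congrArg Prod.fst h) (by change ¬(2 : ZMod 4) = 0; decide)
  constructor
  · rintro ((⟨X, hX, Y, hY, hne, rfl⟩ | ⟨X, hX, Y, hY, rfl⟩) | ⟨X, hX, Y, hY, rfl⟩) <;>
    obtain ⟨x, rfl⟩ := exists_teichLift β hX <;> obtain ⟨y, rfl⟩ := exists_teichLift β hY <;>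
    rw [red_teichLift, red_teichLift]
    · refine ⟨fun h => hne ?_, _, neg_codeVec_mem β x, _, codeVec_mem β y,
        (neg_codeVec_add_codeVec β x y).symm⟩
      have h1 : -teichLift β x + teichLift β y = 0 := congrArg (fun g : Grp F => g.2.1) h
      linear_combination -h1
    · exact ⟨h2, _, codeVec_mem β x, _, codeVec_mem β y, (codeVec_add_codeVec β x y).symm⟩
    · exact ⟨h2, _, neg_codeVec_mem β x, _, neg_codeVec_mem β y,
        (neg_codeVec_add_neg_codeVec β x y).symm⟩
  · have mixed : ∀ x y, -codeVec β x + codeVec β y ≠ 0 → -codeVec β x + codeVec β y ∈ E4 β := by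
      intro x y h
      refine Or.inl (Or.inl ⟨_, teichLift_mem β x, _, teichLift_mem β y, fun hxy => h ?_, ?_⟩)
      · rw [teichLift_injective β hxy, neg_add_cancel]
      · rw [red_teichLift, red_teichLift, neg_codeVec_add_codeVec]
    rintro ⟨h0, a, ha, b, hb, rfl⟩
    obtain ⟨x, rfl | rfl⟩ := (mem_codeSet β).mp ha <;>
    obtain ⟨y, rfl | rfl⟩ := (mem_codeSet β).mp hb
    · refine Or.inl (Or.inr ⟨_, teichLift_mem β x, _, teichLift_mem β y, ?_⟩)
      rw [red_teichLift, red_teichLift, codeVec_add_codeVec]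
    · rw [add_comm] at h0 ⊢
      exact mixed y x h0
    · exact mixed x y h0
    · refine Or.inr ⟨_, teichLift_mem β x, _, teichLift_mem β y, ?_⟩
      rw [red_teichLift, red_teichLift, neg_codeVec_add_neg_codeVec]

lemma mem_E3_iff {g : Grp F} :
    g ∈ E3 β ↔ g ∉ codeSet β ∧ ∃ a ∈ codeSet β, proj F g = proj F a := by
  rw [E3, Set.mem_sdiff, ← mem_codeSet_iff_mem_E2, and_comm]
  refine and_congr_right fun _ => ?_
  obtain ⟨u, c, r⟩ := g
  constructor
  · rintro (⟨X, hX, t, h⟩ | ⟨X, hX, t, h⟩) <;> obtain ⟨x, rfl⟩ := exists_teichLift β hX <;>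
    rw [h]
    · exact ⟨_, codeVec_mem β x, rfl⟩
    · exact ⟨_, neg_codeVec_mem β x, by rw [neg_codeVec]; rfl⟩
  · rintro ⟨a, ha, h⟩
    obtain ⟨x, rfl | rfl⟩ := (mem_codeSet β).mp ha
    · obtain ⟨rfl, rfl⟩ := Prod.ext_iff.mp h
      exact Or.inl ⟨_, teichLift_mem β x, r, rfl⟩
    · rw [neg_codeVec] at h
      obtain ⟨rfl, rfl⟩ := Prod.ext_iff.mp h
      exact Or.inr ⟨_, teichLift_mem β x, r, rfl⟩

lemma mem_E5_iff {g : Grp F} :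
    g ∈ E5 β ↔ g ∉ E4 β ∧ ((g.1 = 0 ∧ red F g.2.1 ≠ 0) ∨ g.1 = 2) := by
  rw [E5, Set.mem_sdiff, and_comm]
  refine and_congr_right fun _ => ?_
  obtain ⟨u, c, r⟩ := g
  simp only [Set.mem_union, Set.mem_ofPred_eq, Prod.mk.injEq, ne_eq, red_eq_zero_iff]
  constructor
  · rintro (⟨S, hS, t, rfl, rfl, rfl⟩ | ⟨S, t, rfl, rfl, rfl⟩)
    · exact Or.inl ⟨rfl, hS⟩
    · exact Or.inr rfl
  · rintro (⟨rfl, hS⟩ | rfl)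
    · exact Or.inl ⟨c, hS, r, rfl, rfl, rfl⟩
    · exact Or.inr ⟨c, r, rfl, rfl, rfl⟩

/-! The nondegenerate sums of three columns, by the pattern of signs. -/

lemma codeVec_ppp (x y z : ResField F) : codeVec β x + codeVec β y + codeVec β z
    = (3, teichLift β x + teichLift β y + teichLift β z, x ^ 3 + y ^ 3 + z ^ 3) := rfl

lemma codeVec_ppm (x y z : ResField F) : codeVec β x + codeVec β y + -codeVec β z
    = (1, teichLift β x + teichLift β y - teichLift β z, x ^ 3 + y ^ 3 + z ^ 3) := by
  rw [neg_codeVec, sub_eq_add_neg]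
  exact Prod.ext (show (1 : ZMod 4) + 1 + 3 = 1 by decide) rfl

lemma codeVec_mmp (x y z : ResField F) : -codeVec β x + -codeVec β y + codeVec β z
    = (3, -teichLift β x - teichLift β y + teichLift β z, x ^ 3 + y ^ 3 + z ^ 3) := by
  rw [neg_codeVec, neg_codeVec, sub_eq_add_neg]; rfl

lemma codeVec_mmm (x y z : ResField F) : -codeVec β x + -codeVec β y + -codeVec β z
    = (1, -teichLift β x - teichLift β y - teichLift β z, x ^ 3 + y ^ 3 + z ^ 3) := by
  rw [neg_codeVec, neg_codeVec, neg_codeVec, sub_eq_add_neg, sub_eq_add_neg]; rfl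

lemma codeVec_double_neg (x y : ResField F) : codeVec β x + codeVec β x + -codeVec β y
    = (1, 2 * teichLift β x - teichLift β y, y ^ 3) := by
  rw [codeVec_ppm, cube_add_cube_sub, two_mul]

lemma codeVec_double_pos (x y : ResField F) : codeVec β x + codeVec β x + codeVec β y
    = (3, 2 * teichLift β x + teichLift β y, y ^ 3) := by
  rw [codeVec_ppp, cube_add_cube_sub, two_mul]

lemma double_neg_mem_E6 {x y : ResField F} (h : x ≠ y) :
    codeVec β x + codeVec β x + -codeVec β y ∈ E6 β := by
  refine Or.inl (Or.inl (Or.inl (Or.inl (Or.inl ⟨_, teichLift_mem β x, _, teichLift_mem β y,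
    (teichLift_injective β).ne h, ?_⟩))))
  rw [codeVec_double_neg, red_teichLift]

lemma double_pos_mem_E6 {x y : ResField F} (h : x ≠ y) :
    codeVec β x + codeVec β x + codeVec β y ∈ E6 β := by
  refine Or.inl (Or.inl (Or.inr ⟨_, teichLift_mem β x, _, teichLift_mem β y,
    (teichLift_injective β).ne h, ?_⟩))
  rw [codeVec_double_pos, red_teichLift]

lemma mem_E6_of_ppp {x y z : ResField F}
    (h : codeVec β x + codeVec β y + codeVec β z ∉ codeSet β) :
    codeVec β x + codeVec β y + codeVec β z ∈ E6 β := by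
  have pair : ∀ {x z}, codeVec β x + codeVec β x + codeVec β z ∉ codeSet β →
      codeVec β x + codeVec β x + codeVec β z ∈ E6 β := by
    intro x z h
    refine double_pos_mem_E6 β fun hxz => h ?_
    rw [hxz, add_self_eq_neg_add_neg, neg_add_cancel_right]
    exact neg_codeVec_mem β z
  by_cases hxy : x = y
  · subst hxy; exact pair h
  by_cases hxz : x = z
  · subst hxz; rw [add_right_comm] at h ⊢; exact pair h
  by_cases hyz : y = z
  · subst hyz; rw [add_assoc, add_comm] at h ⊢; exact pair h
  refine Or.inl (Or.inr ⟨_, teichLift_mem β x, _, teichLift_mem β y, _, teichLift_mem β z,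
    (teichLift_injective β).ne hxy, (teichLift_injective β).ne hxz,
    (teichLift_injective β).ne hyz, ?_⟩)
  simp only [red_teichLift, codeVec_ppp]

lemma mem_E6_of_ppm {x y z : ResField F}
    (h : codeVec β x + codeVec β y + -codeVec β z ∉ codeSet β) :
    codeVec β x + codeVec β y + -codeVec β z ∈ E6 β := by
  have hxz : x ≠ z := by
    rintro rfl
    rw [add_right_comm, add_neg_cancel, zero_add] at h
    exact h (codeVec_mem β y)
  have hyz : y ≠ z := by
    rintro rfl
    rw [add_neg_cancel_right] at h
    exact h (codeVec_mem β x)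
  by_cases hxy : x = y
  · subst hxy; exact double_neg_mem_E6 β hxz
  refine Or.inl (Or.inl (Or.inl (Or.inr ⟨_, teichLift_mem β x, _, teichLift_mem β y, _,
    teichLift_mem β z, (teichLift_injective β).ne hxy, (teichLift_injective β).ne hxz,
    (teichLift_injective β).ne hyz, ?_⟩)))
  simp only [red_teichLift, codeVec_ppm]

lemma mem_E6_of_mmp {x y z : ResField F}
    (h : -codeVec β x + -codeVec β y + codeVec β z ∉ codeSet β) :
    -codeVec β x + -codeVec β y + codeVec β z ∈ E6 β := by
  have hxz : x ≠ z := by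
    rintro rfl
    rw [add_right_comm, neg_add_cancel, zero_add] at h
    exact h (neg_codeVec_mem β y)
  have hyz : y ≠ z := by
    rintro rfl
    rw [neg_add_cancel_right] at h
    exact h (neg_codeVec_mem β x)
  by_cases hxy : x = y
  · subst hxy
    rw [← add_self_eq_neg_add_neg]
    exact double_pos_mem_E6 β hxz
  refine Or.inr ⟨_, teichLift_mem β x, _, teichLift_mem β y, _,
    teichLift_mem β z, (teichLift_injective β).ne hxy, (teichLift_injective β).ne hxz,
    (teichLift_injective β).ne hyz, ?_⟩
  simp only [red_teichLift, codeVec_mmp]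

lemma mem_E6_of_mmm {x y z : ResField F}
    (h : -codeVec β x + -codeVec β y + -codeVec β z ∉ codeSet β) :
    -codeVec β x + -codeVec β y + -codeVec β z ∈ E6 β := by
  have pair : ∀ {x z}, -codeVec β x + -codeVec β x + -codeVec β z ∉ codeSet β →
      -codeVec β x + -codeVec β x + -codeVec β z ∈ E6 β := by
    intro x z h
    rw [← add_self_eq_neg_add_neg] at h ⊢
    refine double_neg_mem_E6 β fun hxz => h ?_
    rw [hxz, add_neg_cancel_right]
    exact codeVec_mem β z
  by_cases hxy : x = y
  · subst hxy; exact pair h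
  by_cases hxz : x = z
  · subst hxz; rw [add_right_comm] at h ⊢; exact pair h
  by_cases hyz : y = z
  · subst hyz; rw [add_assoc, add_comm] at h ⊢; exact pair h
  refine Or.inl (Or.inl (Or.inl (Or.inl (Or.inr ⟨_, teichLift_mem β x, _, teichLift_mem β y, _,
    teichLift_mem β z, (teichLift_injective β).ne hxy, (teichLift_injective β).ne hxz,
    (teichLift_injective β).ne hyz, ?_⟩))))
  simp only [red_teichLift, codeVec_mmm]

/-- The projections of the nondegenerate sums of three columns. -/
lemma proj_ne_of_nondegenerate {a b c g : Grp F} (ha : a ∈ codeSet β) (hb : b ∈ codeSet β)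
    (hc : c ∈ codeSet β) (hab : a ≠ -b) (hac : a ≠ -c) (hbc : b ≠ -c) (habc : ¬(a = b ∧ b = c))
    (hg : proj F g = proj F (a + b + c)) : ¬∃ d ∈ codeSet β, proj F g = proj F d := by
  rintro ⟨d, hd, h⟩
  rcases degenerate_of_proj_eq β ha hb hc hd (hg.symm.trans h) with h1 | h1 | h1 | h1
  exacts [hab h1, hac h1, hbc h1, habc h1]

lemma proj_double_neg {x y : ResField F} (h : x ≠ y) {g : Grp F}
    (hg : proj F g = proj F (codeVec β x + codeVec β x + -codeVec β y)) :
    ¬∃ d ∈ codeSet β, proj F g = proj F d := by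
  refine proj_ne_of_nondegenerate β (codeVec_mem β x) (codeVec_mem β x) (neg_codeVec_mem β y)
    (codeVec_ne_neg β _ _) ?_ ?_ (fun h' => codeVec_ne_neg β _ _ h'.2) hg <;>
  simpa [codeVec_inj] using h

lemma proj_double_pos {x y : ResField F} (h : x ≠ y) {g : Grp F}
    (hg : proj F g = proj F (codeVec β x + codeVec β x + codeVec β y)) :
    ¬∃ d ∈ codeSet β, proj F g = proj F d :=
  proj_ne_of_nondegenerate β (codeVec_mem β x) (codeVec_mem β x) (codeVec_mem β y)
    (codeVec_ne_neg β _ _) (codeVec_ne_neg β _ _) (codeVec_ne_neg β _ _)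
    (fun h' => h (codeVec_injective β h'.2)) hg

lemma proj_ppp {x y z : ResField F} (h : x ≠ y) {g : Grp F}
    (hg : proj F g = proj F (codeVec β x + codeVec β y + codeVec β z)) :
    ¬∃ d ∈ codeSet β, proj F g = proj F d :=
  proj_ne_of_nondegenerate β (codeVec_mem β x) (codeVec_mem β y) (codeVec_mem β z)
    (codeVec_ne_neg β _ _) (codeVec_ne_neg β _ _) (codeVec_ne_neg β _ _)
    (fun h' => h (codeVec_injective β h'.1)) hg

lemma proj_ppm {x y z : ResField F} (hxz : x ≠ z) (hyz : y ≠ z) {g : Grp F}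
    (hg : proj F g = proj F (codeVec β x + codeVec β y + -codeVec β z)) :
    ¬∃ d ∈ codeSet β, proj F g = proj F d := by
  refine proj_ne_of_nondegenerate β (codeVec_mem β x) (codeVec_mem β y) (neg_codeVec_mem β z)
    (codeVec_ne_neg β _ _) ?_ ?_ (fun h' => codeVec_ne_neg β _ _ h'.2) hg
  · simpa [codeVec_inj] using hxz
  · simpa [codeVec_inj] using hyz

lemma proj_mmp {x y z : ResField F} (hxz : x ≠ z) (hyz : y ≠ z) {g : Grp F}
    (hg : proj F g = proj F (-codeVec β x + -codeVec β y + codeVec β z)) :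
    ¬∃ d ∈ codeSet β, proj F g = proj F d := by
  refine proj_ne_of_nondegenerate β (neg_codeVec_mem β x) (neg_codeVec_mem β y) (codeVec_mem β z)
    ?_ ?_ ?_ (fun h' => codeVec_ne_neg β _ _ h'.2.symm) hg
  · simpa using (codeVec_ne_neg β y x).symm
  · simpa [codeVec_inj] using hxz
  · simpa [codeVec_inj] using hyz

lemma proj_mmm {x y z : ResField F} (h : x ≠ y) {g : Grp F}
    (hg : proj F g = proj F (-codeVec β x + -codeVec β y + -codeVec β z)) :
    ¬∃ d ∈ codeSet β, proj F g = proj F d := by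
  refine proj_ne_of_nondegenerate β (neg_codeVec_mem β x) (neg_codeVec_mem β y)
    (neg_codeVec_mem β z) ?_ ?_ ?_ (fun h' => h (codeVec_injective β (neg_injective h'.1))) hg
  · simpa using (codeVec_ne_neg β y x).symm
  · simpa using (codeVec_ne_neg β z x).symm
  · simpa using (codeVec_ne_neg β z y).symm

lemma not_mem_codeSet_of_proj {g : Grp F} (h : ¬∃ d ∈ codeSet β, proj F g = proj F d) :
    g ∉ codeSet β := fun hg => h ⟨g, hg, rfl⟩

lemma mem_E6_iff {g : Grp F} : g ∈ E6 β ↔ g ∉ codeSet β ∧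
    ∃ a ∈ codeSet β, ∃ b ∈ codeSet β, ∃ c ∈ codeSet β, g = a + b + c := by
  constructor
  · rintro (((((⟨X, hX, Y, hY, hne, rfl⟩ |
      ⟨X, hX, Y, hY, Z, hZ, hXY, hXZ, hYZ, rfl⟩) |
      ⟨X, hX, Y, hY, Z, hZ, hXY, hXZ, hYZ, rfl⟩) | ⟨X, hX, Y, hY, hne, rfl⟩) |
      ⟨X, hX, Y, hY, Z, hZ, hXY, hXZ, hYZ, rfl⟩) |
      ⟨X, hX, Y, hY, Z, hZ, hXY, hXZ, hYZ, rfl⟩) <;>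
    obtain ⟨x, rfl⟩ := exists_teichLift β hX <;> obtain ⟨y, rfl⟩ := exists_teichLift β hY <;>
    try obtain ⟨z, rfl⟩ := exists_teichLift β hZ
    all_goals simp only [red_teichLift]
    · rw [← codeVec_double_neg]
      exact ⟨not_mem_codeSet_of_proj β (proj_double_neg β (ne_of_apply_ne _ hne) rfl),
        _, codeVec_mem β x, _, codeVec_mem β x, _, neg_codeVec_mem β y, rfl⟩
    · rw [← codeVec_mmm]
      exact ⟨not_mem_codeSet_of_proj β (proj_mmm β (ne_of_apply_ne _ hXY) rfl),
        _, neg_codeVec_mem β x, _, neg_codeVec_mem β y, _, neg_codeVec_mem β z, rfl⟩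
    · rw [← codeVec_ppm]
      exact ⟨not_mem_codeSet_of_proj β
        (proj_ppm β (ne_of_apply_ne _ hXZ) (ne_of_apply_ne _ hYZ) rfl),
        _, codeVec_mem β x, _, codeVec_mem β y, _, neg_codeVec_mem β z, rfl⟩
    · rw [← codeVec_double_pos]
      exact ⟨not_mem_codeSet_of_proj β (proj_double_pos β (ne_of_apply_ne _ hne) rfl),
        _, codeVec_mem β x, _, codeVec_mem β x, _, codeVec_mem β y, rfl⟩
    · rw [← codeVec_ppp]
      exact ⟨not_mem_codeSet_of_proj β (proj_ppp β (ne_of_apply_ne _ hXY) rfl),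
        _, codeVec_mem β x, _, codeVec_mem β y, _, codeVec_mem β z, rfl⟩
    · rw [← codeVec_mmp]
      exact ⟨not_mem_codeSet_of_proj β
        (proj_mmp β (ne_of_apply_ne _ hXZ) (ne_of_apply_ne _ hYZ) rfl),
        _, neg_codeVec_mem β x, _, neg_codeVec_mem β y, _, codeVec_mem β z, rfl⟩
  · rintro ⟨h, a, ha, b, hb, c, hc, rfl⟩
    obtain ⟨x, rfl | rfl⟩ := (mem_codeSet β).mp ha <;>
    obtain ⟨y, rfl | rfl⟩ := (mem_codeSet β).mp hb <;>
    obtain ⟨z, rfl | rfl⟩ := (mem_codeSet β).mp hc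
    · exact mem_E6_of_ppp β h
    · exact mem_E6_of_ppm β h
    · rw [add_right_comm] at h ⊢; exact mem_E6_of_ppm β h
    · rw [add_assoc, add_comm] at h ⊢; exact mem_E6_of_mmp β h
    · rw [add_assoc, add_comm] at h ⊢; exact mem_E6_of_ppm β h
    · rw [add_right_comm] at h ⊢; exact mem_E6_of_mmp β h
    · exact mem_E6_of_mmp β h
    · exact mem_E6_of_mmm β h

lemma mem_E7_iff {g : Grp F} : g ∈ E7 β ↔ g ∉ E6 β ∧ (g.1 = 1 ∨ g.1 = 3) ∧
    ¬∃ d ∈ codeSet β, proj F g = proj F d := by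
  rw [E7, Set.mem_sdiff, and_comm]
  refine and_congr_right fun _ => ?_
  constructor
  · rintro (((((⟨X, hX, Y, hY, r, hne, rfl⟩ |
      ⟨X, hX, Y, hY, Z, hZ, r, hXY, hXZ, hYZ, rfl⟩) |
      ⟨X, hX, Y, hY, Z, hZ, r, hXY, hXZ, hYZ, rfl⟩) | ⟨X, hX, Y, hY, r, hne, rfl⟩) |
      ⟨X, hX, Y, hY, Z, hZ, r, hXY, hXZ, hYZ, rfl⟩) |
      ⟨X, hX, Y, hY, Z, hZ, r, hXY, hXZ, hYZ, rfl⟩) <;>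
    obtain ⟨x, rfl⟩ := exists_teichLift β hX <;> obtain ⟨y, rfl⟩ := exists_teichLift β hY <;>
    try obtain ⟨z, rfl⟩ := exists_teichLift β hZ
    · exact ⟨Or.inl rfl, proj_double_neg β (ne_of_apply_ne _ hne)
        (by rw [codeVec_double_neg]; rfl)⟩
    · exact ⟨Or.inl rfl, proj_mmm β (z := z) (ne_of_apply_ne _ hXY) (by rw [codeVec_mmm]; rfl)⟩
    · exact ⟨Or.inl rfl, proj_ppm β (ne_of_apply_ne _ hXZ) (ne_of_apply_ne _ hYZ)
        (by rw [codeVec_ppm]; rfl)⟩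
    · exact ⟨Or.inr rfl, proj_double_pos β (ne_of_apply_ne _ hne)
        (by rw [codeVec_double_pos]; rfl)⟩
    · exact ⟨Or.inr rfl, proj_ppp β (z := z) (ne_of_apply_ne _ hXY) (by rw [codeVec_ppp]; rfl)⟩
    · exact ⟨Or.inr rfl, proj_mmp β (ne_of_apply_ne _ hXZ) (ne_of_apply_ne _ hYZ)
        (by rw [codeVec_mmp]; rfl)⟩
  · -- an element `A + 2B` with `B ≠ 0` is `2X - Y` with `Y = A` and `x = a + b`
    obtain ⟨u, c, r⟩ := g
    rintro ⟨rfl | rfl, h⟩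
    · obtain ⟨a, b, rfl⟩ := exists_teich_decomp β c
      refine Or.inl (Or.inl (Or.inl (Or.inl (Or.inl ⟨_, teichLift_mem β (a + b), _,
        teichLift_mem β a, r, fun hab => h ?_, ?_⟩))))
      · have hb : b = 0 := by simpa using teichLift_injective β hab
        refine ⟨_, codeVec_mem β a, ?_⟩
        rw [hb, dbl_zero, add_zero]
        rfl
      · refine Prod.ext rfl (Prod.ext ?_ rfl)
        change teichLift β a + dbl β b = dbl β (a + b) - teichLift β a
        rw [dbl_add]
        simp only [dbl]
        ring
    · obtain ⟨a, b, hab⟩ := exists_teich_decomp β (-c)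
      refine Or.inl (Or.inl (Or.inr ⟨_, teichLift_mem β (a + b), _,
        teichLift_mem β a, r, fun hab' => h ?_, ?_⟩))
      · have hb : b = 0 := by simpa using teichLift_injective β hab'
        refine ⟨_, neg_codeVec_mem β a, ?_⟩
        rw [hb, dbl_zero, add_zero] at hab
        rw [neg_codeVec, ← hab, neg_neg]
        rfl
      · refine Prod.ext rfl (Prod.ext ?_ rfl)
        change c = dbl β (a + b) + teichLift β a
        have h1 := neg_dbl β b
        rw [dbl_add]
        simp only [dbl] at h1 hab ⊢
        linear_combination -hab + h1 - teichLift β a * four_eq_zero (F := F)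

lemma teichStar_cases {X : GR F} (hX : X ∈ teichStar β) :
    red F (2 * X) = 0 ∧ 2 * X ≠ 0 := by
  obtain ⟨hX1, hX2⟩ := hX
  obtain ⟨x, rfl⟩ := exists_teichLift β hX1
  refine ⟨red_dbl β x, fun h => hX2 ?_⟩
  have : x = 0 := dbl_injective β (h.trans (dbl_zero β).symm)
  rw [this, teichLift_zero]
  rfl

lemma exists_teichStar {c : GR F} (h1 : red F c = 0) (h2 : c ≠ 0) :
    ∃ X ∈ teichStar β, c = 2 * X := by
  obtain ⟨x, rfl⟩ := exists_dbl β h1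
  refine ⟨teichLift β x, ⟨teichLift_mem β x, fun h => h2 ?_⟩, rfl⟩
  rw [dbl, Set.mem_singleton_iff.mp h, mul_zero]

lemma mem_E9_iff {g : Grp F} :
    g ∈ E9 β ↔ g ∉ E8 β ∧ g.1 = 0 ∧ red F g.2.1 = 0 ∧ g.2.1 ≠ 0 := by
  rw [E9, Set.mem_sdiff, and_comm]
  refine and_congr_right fun _ => ?_
  constructor
  · rintro ⟨X, hX, r, rfl⟩
    exact ⟨rfl, teichStar_cases β hX⟩
  · obtain ⟨u, c, r⟩ := g
    rintro ⟨h1, h2, h3⟩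
    obtain ⟨X, hX, hc⟩ := exists_teichStar β h2 h3
    dsimp only at h1 hc
    subst h1 hc
    exact ⟨X, hX, r, rfl⟩

lemma mem_E8_of_eq {g : Grp F} (h1 : g.1 = 0) (h2 : red F g.2.1 = 0) (h3 : g.2.1 ≠ 0)
    (y : Fin 4 → ResField F) (hy3 : g.2.2 = ∑ i, y i ^ 3)
    (hy : g.2.1 = ∑ i, teichLift β (y i) ∨ g.2.1 = teichLift β (y 0) + teichLift β (y 1)
      - teichLift β (y 2) - teichLift β (y 3)) : g ∈ E8 β := by
  obtain ⟨u, c, r⟩ := g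
  obtain ⟨X, hX, hc⟩ := exists_teichStar β h2 h3
  dsimp only at h1 hc hy hy3
  subst h1 hc
  refine ⟨X, hX, fun i => teichLift β (y i), fun i => teichLift_mem β _, hy, ?_⟩
  simp only [red_teichLift, hy3]

lemma neg_eq_self {g : Grp F} (h1 : g.1 = 0) (h2 : red F g.2.1 = 0) : -g = g := by
  have h3 := two_mul_eq_zero_iff.mpr (red_eq_zero_iff.mp h2)
  refine Prod.ext ?_ (Prod.ext ?_ (CharTwo.neg_eq _))
  · rw [Prod.fst_neg, h1, neg_zero]
  · change -g.2.1 = g.2.1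
    linear_combination -h3

lemma mem_E8_of_pppp {g : Grp F} (h1 : g.1 = 0) (h2 : red F g.2.1 = 0) (h3 : g.2.1 ≠ 0)
    {x y z w : ResField F} (h : g = codeVec β x + codeVec β y + codeVec β z + codeVec β w) :
    g ∈ E8 β := by
  refine mem_E8_of_eq β h1 h2 h3 ![x, y, z, w] ?_ (Or.inl ?_) <;>
  · rw [h, Fin.sum_univ_four]
    rfl

lemma mem_E8_of_ppmm {g : Grp F} (h1 : g.1 = 0) (h2 : red F g.2.1 = 0) (h3 : g.2.1 ≠ 0)
    {x y z w : ResField F} (h : g = codeVec β x + codeVec β y + -codeVec β z + -codeVec β w) :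
    g ∈ E8 β := by
  rw [neg_codeVec, neg_codeVec] at h
  refine mem_E8_of_eq β h1 h2 h3 ![x, y, z, w] ?_ (Or.inr ?_)
  · rw [h, Fin.sum_univ_four]
    rfl
  · rw [h, sub_eq_add_neg, sub_eq_add_neg]
    rfl

lemma mem_E8_iff {g : Grp F} : g ∈ E8 β ↔ (g.1 = 0 ∧ red F g.2.1 = 0 ∧ g.2.1 ≠ 0) ∧
    ∃ a ∈ codeSet β, ∃ b ∈ codeSet β, ∃ c ∈ codeSet β, ∃ d ∈ codeSet β, g = a + b + c + d := by
  constructor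
  · rintro ⟨X, hX, Y, hY, h, rfl⟩
    refine ⟨⟨rfl, teichStar_cases β hX⟩, ?_⟩
    choose y hy using fun i => exists_teichLift β (hY i)
    obtain rfl : Y = fun i => teichLift β (y i) := funext hy
    simp only [red_teichLift, Fin.sum_univ_four] at h ⊢
    rcases h with h | h
    · refine ⟨_, codeVec_mem β (y 0), _, codeVec_mem β (y 1), _, codeVec_mem β (y 2), _,
        codeVec_mem β (y 3), ?_⟩
      rw [h]
      exact Prod.ext (show (0 : ZMod 4) = 1 + 1 + 1 + 1 by decide) rfl
    · refine ⟨_, codeVec_mem β (y 0), _, codeVec_mem β (y 1), _, neg_codeVec_mem β (y 2), _,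
        neg_codeVec_mem β (y 3), ?_⟩
      rw [h, neg_codeVec, neg_codeVec, sub_eq_add_neg, sub_eq_add_neg]
      exact Prod.ext (show (0 : ZMod 4) = 1 + 1 + 3 + 3 by decide) rfl
  · rintro ⟨⟨h1, h2, h3⟩, a, ha, b, hb, c, hc, d, hd, rfl⟩
    have h0 : ∀ {u : ZMod 4}, (a + b + c + d).1 = u → u ≠ 0 → a + b + c + d ∈ E8 β :=
      fun hu hu0 => absurd (hu.symm.trans h1) hu0
    generalize hg : a + b + c + d = g at *
    obtain ⟨x, rfl | rfl⟩ := (mem_codeSet β).mp ha <;>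
    obtain ⟨y, rfl | rfl⟩ := (mem_codeSet β).mp hb <;>
    obtain ⟨z, rfl | rfl⟩ := (mem_codeSet β).mp hc <;>
    obtain ⟨w, rfl | rfl⟩ := (mem_codeSet β).mp hd
    · exact mem_E8_of_pppp β h1 h2 h3 hg.symm
    · exact h0 (u := 2) (by rw [← hg]; change (1 + 1 + 1 + -1 : ZMod 4) = 2; decide) (by decide)
    · exact h0 (u := 2) (by rw [← hg]; change (1 + 1 + -1 + 1 : ZMod 4) = 2; decide) (by decide)
    · exact mem_E8_of_ppmm β h1 h2 h3 hg.symm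
    · exact h0 (u := 2) (by rw [← hg]; change (1 + -1 + 1 + 1 : ZMod 4) = 2; decide) (by decide)
    · exact mem_E8_of_ppmm β h1 h2 h3 (x := x) (y := z) (z := y) (w := w) (by rw [← hg]; abel)
    · exact mem_E8_of_ppmm β h1 h2 h3 (x := x) (y := w) (z := y) (w := z) (by rw [← hg]; abel)
    · exact h0 (u := 2) (by rw [← hg]; change (1 + -1 + -1 + -1 : ZMod 4) = 2; decide) (by decide)
    · exact h0 (u := 2) (by rw [← hg]; change (-1 + 1 + 1 + 1 : ZMod 4) = 2; decide) (by decide)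
    · exact mem_E8_of_ppmm β h1 h2 h3 (x := y) (y := z) (z := x) (w := w) (by rw [← hg]; abel)
    · exact mem_E8_of_ppmm β h1 h2 h3 (x := y) (y := w) (z := x) (w := z) (by rw [← hg]; abel)
    · exact h0 (u := 2) (by rw [← hg]; change (-1 + 1 + -1 + -1 : ZMod 4) = 2; decide) (by decide)
    · exact mem_E8_of_ppmm β h1 h2 h3 (x := z) (y := w) (z := x) (w := y) (by rw [← hg]; abel)
    · exact h0 (u := 2) (by rw [← hg]; change (-1 + -1 + 1 + -1 : ZMod 4) = 2; decide) (by decide)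
    · exact h0 (u := 2) (by rw [← hg]; change (-1 + -1 + -1 + 1 : ZMod 4) = 2; decide) (by decide)
    · refine mem_E8_of_pppp β h1 h2 h3 (x := x) (y := y) (z := z) (w := w) ?_
      rw [← neg_eq_self h1 h2, ← hg]
      abel

end Classes

/-! ### Translations and sums of four columns -/

section Shift

variable {m : ℕ} {F : BasicIrreducible m} (β : (GR F)ˣ) [hm : Fact (3 ≤ m)]
  [hodd : Fact (Odd m)] [hβ : Fact (orderOf β = 2 ^ m - 1)]

/-- The additive map extending the translation `codeVec x ↦ codeVec (x + t²)` of the columns. -/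
def shift (t : ResField F) : Grp F →+ Grp F :=
  AddMonoidHom.mk' (fun g => g + (0,
      algebraMap (ZMod 4) (GR F) g.1 * teichLift β (t ^ 2) +
        dbl β (t * (frobeniusEquiv (ResField F) 2).symm (red F g.2.1)),
      red F (algebraMap (ZMod 4) (GR F) g.1) * t ^ 6 + t ^ 2 * red F g.2.1 ^ 2 +
        t ^ 4 * red F g.2.1))
    fun g h => by
      refine Prod.ext ?_ (Prod.ext ?_ ?_)
      · simp only [Prod.fst_add, add_zero]
      · simp only [Prod.fst_add, Prod.snd_add, map_add, mul_add, add_mul, dbl_add]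
        ring
      · simp only [Prod.fst_add, Prod.snd_add, map_add, CharTwo.add_sq]
        ring

lemma shift_apply (t : ResField F) (g : Grp F) : shift β t g = g + (0,
      algebraMap (ZMod 4) (GR F) g.1 * teichLift β (t ^ 2) +
        dbl β (t * (frobeniusEquiv (ResField F) 2).symm (red F g.2.1)),
      red F (algebraMap (ZMod 4) (GR F) g.1) * t ^ 6 + t ^ 2 * red F g.2.1 ^ 2 +
        t ^ 4 * red F g.2.1) := rfl

lemma shift_codeVec (t x : ResField F) :
    shift β t (codeVec β (x ^ 2)) = codeVec β (x ^ 2 + t ^ 2) := by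
  have hroot : (frobeniusEquiv (ResField F) 2).symm (x ^ 2) = x :=
    (frobeniusEquiv (ResField F) 2).symm_apply_apply x
  rw [shift_apply]
  simp only [codeVec, red_teichLift, map_one, one_mul, hroot]
  refine Prod.ext (add_zero _) (Prod.ext ?_ ?_)
  · change teichLift β (x ^ 2) + (teichLift β (t ^ 2) + dbl β (t * x)) = _
    rw [← CharTwo.add_sq, ← add_assoc, teichLift_sq_add_sq, mul_comm x t]
    have := neg_dbl β (t * x)
    linear_combination -this
  · change (x ^ 2) ^ 3 + (t ^ 6 + t ^ 2 * (x ^ 2) ^ 2 + t ^ 4 * x ^ 2) = _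
    linear_combination (-(x ^ 4 * t ^ 2) - x ^ 2 * t ^ 4) * two_eq_zero_res (F := F)

lemma shift_mem (t : ResField F) {a : Grp F} (ha : a ∈ codeSet β) : shift β t a ∈ codeSet β := by
  obtain ⟨x, rfl | rfl⟩ := (mem_codeSet β).mp ha <;> obtain ⟨x, rfl⟩ := sq_bijective.2 x <;>
  dsimp only
  · rw [shift_codeVec]; exact codeVec_mem β _
  · rw [map_neg, shift_codeVec]; exact neg_codeVec_mem β _

lemma shift_eq_self (t : ResField F) {g : Grp F} (h1 : g.1 = 0) (h2 : red F g.2.1 = 0) :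
    shift β t g = g := by
  rw [shift_apply, h1, h2]
  simp only [map_zero, zero_mul, mul_zero, dbl_zero, add_zero, ne_eq, OfNat.ofNat_ne_zero,
    not_false_eq_true, zero_pow]
  exact add_zero g

/-- Up to sign, translations act transitively on the columns. -/
lemma exists_shift_eq {a e : Grp F} (ha : a ∈ codeSet β) (he : e ∈ codeSet β) :
    ∃ t, shift β t a = e ∨ shift β t (-a) = e := by
  have key : ∀ x y, ∃ t, shift β t (codeVec β x) = codeVec β y := by
    intro x y
    obtain ⟨x, rfl⟩ := sq_bijective.2 x
    obtain ⟨t, ht⟩ := sq_bijective.2 (x ^ 2 + y)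
    refine ⟨t, ?_⟩
    dsimp only at ht ⊢
    rw [shift_codeVec, ht, ← add_assoc, CharTwo.add_self_eq_zero, zero_add]
  obtain ⟨x, rfl | rfl⟩ := (mem_codeSet β).mp ha <;>
  obtain ⟨y, rfl | rfl⟩ := (mem_codeSet β).mp he <;>
  obtain ⟨t, ht⟩ := key x y
  · exact ⟨t, Or.inl ht⟩
  · exact ⟨t, Or.inr (by rw [map_neg, ht])⟩
  · exact ⟨t, Or.inr (by rw [neg_neg, ht])⟩
  · exact ⟨t, Or.inl (by rw [map_neg, ht])⟩

lemma eq_zero_of_add_of_red {a b : Grp F} (ha : a ∈ codeSet β) (hb : b ∈ codeSet β)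
    (h1 : (a + b).1 = 0) (h2 : red F (a + b).2.1 = 0) : a + b = 0 := by
  obtain ⟨x, rfl | rfl⟩ := (mem_codeSet β).mp ha <;>
  obtain ⟨y, rfl | rfl⟩ := (mem_codeSet β).mp hb
  · exact absurd h1 (by change ¬(1 + 1 : ZMod 4) = 0; decide)
  · change red F (teichLift β x + -teichLift β y) = 0 at h2
    simp only [map_add, map_neg, red_teichLift] at h2
    rw [add_neg_eq_zero.mp h2, add_neg_cancel]
  · change red F (-teichLift β x + teichLift β y) = 0 at h2
    simp only [map_add, map_neg, red_teichLift] at h2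
    rw [neg_add_eq_zero.mp h2, neg_add_cancel]
  · exact absurd h1 (by change ¬(-1 + -1 : ZMod 4) = 0; decide)

/-- Every column occurs in a representation of an element of `ℰ_8`, since translating a
representation gives another one. -/
lemma sub_mem_of_mem_E8 {g : Grp F} (hg : g ∈ E8 β) {e : Grp F} (he : e ∈ codeSet β) :
    g - e ∉ codeSet β ∧ 0 < repCount (codeSet β) 2 (g - e) := by
  obtain ⟨⟨h1, h2, h3⟩, a, ha, b, hb, c, hc, d, hd, hs⟩ := (mem_E8_iff β).mp hg
  constructor
  · intro hmem
    have h := eq_zero_of_add_of_red β hmem he (by rwa [sub_add_cancel]) (by rwa [sub_add_cancel])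
    rw [sub_add_cancel] at h
    exact h3 (by rw [h]; rfl)
  · have key : ∀ {a b c d : Grp F} (t : ResField F), b ∈ codeSet β → c ∈ codeSet β →
        d ∈ codeSet β → g = a + b + c + d → shift β t a = e →
        0 < repCount (codeSet β) 2 (g - e) := by
      intro a b c d t hb hc hd hs hte
      refine repCount_two_pos_iff.mpr ⟨_, shift_mem β t hb, _, shift_mem β t hc, _,
        shift_mem β t hd, ?_⟩
      rw [← hte, sub_eq_iff_eq_add, ← shift_eq_self β t h1 h2, hs]
      simp only [map_add]
      abel
    obtain ⟨t, ht | ht⟩ := exists_shift_eq β ha he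
    · exact key t hb hc hd hs ht
    · refine key t (neg_mem_codeSet β hb) (neg_mem_codeSet β hc) (neg_mem_codeSet β hd) ?_ ht
      rw [← neg_eq_self h1 h2, hs]
      abel

end Shift

/-! ### The values of the exponential sum -/

section Dichotomy

variable {m : ℕ} {F : BasicIrreducible m} (β : (GR F)ˣ) [hm : Fact (3 ≤ m)]
  [hodd : Fact (Odd m)] [hβ : Fact (orderOf β = 2 ^ m - 1)]

lemma card_codeSet_eq : ((codeSet β).card : ℂ) = sC m ^ 2 := by
  rw [card_codeSet, sC_sq]; push_cast; rfl

lemma card_Grp_mul_two : 2 * Fintype.card (Grp F) = (codeSet β).card ^ 3 := by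
  rw [card_codeSet, Fintype.card_prod, Fintype.card_prod, card_GR, card_res, ZMod.card,
    show 4 ^ m = (2 ^ m) ^ 2 by rw [← pow_mul, mul_comm, pow_mul]; norm_num]
  ring

lemma expSum_dbl (u : ZMod 4) {x : ResField F} (hx : x ≠ 0) :
    expSum β (u, dbl β x, 0) = 0 := by
  classical
  have h : halfSum β (u, dbl β x, 0) = 0 := by
    have h1 : ∀ y, pairing β (u, dbl β x, 0) (codeVec β y)
        = iPow u * iPow (polar β x 0 1 y) := by
      intro y
      rw [pairing_eq, ← iPow_add, polar_apply, codeVec]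
      simp only [mul_zero, dbl_zero, add_zero, one_mul, zero_mul, mul_one]
      rw [mul_dbl, red_teichLift, mul_comm]
    simp_rw [halfSum, h1]
    rw [← Finset.mul_sum, sum_iPow, if_neg, mul_zero]
    intro hall
    obtain ⟨y, hy⟩ := exists_grTrace_dbl_mul_ne_zero β hx
    apply hy
    have := hall y
    rw [polar_apply] at this
    simpa [mul_comm] using this
  rw [expSum_eq_halfSum, h]
  simp

lemma expSum_zero (u : ZMod 4) :
    expSum β (u, 0, 0) = 2 ^ m * (iPow u + iPow (-u)) := by
  have h : halfSum β (u, 0, 0) = 2 ^ m * iPow u := by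
    have h1 : ∀ y, pairing β (u, 0, 0) (codeVec β y) = iPow u := by
      intro y
      rw [pairing_eq, codeVec]
      simp [dbl_zero, grTrace_zero]
    simp_rw [halfSum, h1]
    rw [Finset.sum_const, Finset.card_univ, card_res, nsmul_eq_mul]
    push_cast
    rfl
  rw [expSum_eq_halfSum, h, iPow_neg, map_mul, map_pow, map_ofNat]
  ring

lemma expSum_zero_eq (u : ZMod 4) : (u = 0 ∧ expSum β (u, 0, 0) = sC m ^ 2) ∨
    (u = 2 ∧ expSum β (u, 0, 0) = -sC m ^ 2) ∨
    (u ≠ 0 ∧ u ≠ 2 ∧ expSum β (u, 0, 0) = 0) := by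
  rw [expSum_zero, sC_sq]
  rcases zmod_four_cases u with rfl | rfl | rfl | rfl
  · left
    rw [neg_zero, iPow_zero]
    exact ⟨rfl, by ring⟩
  · right; right
    rw [show (-1 : ZMod 4) = 3 from rfl, iPow_one, iPow_three]
    exact ⟨by decide, by decide, by ring⟩
  · right; left
    rw [show (-2 : ZMod 4) = 2 from rfl, iPow_two]
    exact ⟨rfl, by ring⟩
  · right; right
    rw [show (-3 : ZMod 4) = 1 from rfl, iPow_one, iPow_three]
    exact ⟨by decide, by decide, by ring⟩

lemma eq_dbl_of_red_eq_zero {g : Grp F} (ha : red F g.2.1 = 0) (hb : g.2.2 = 0) :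
    ∃ u x, g = (u, dbl β x, 0) := by
  obtain ⟨u, a, b⟩ := g
  obtain ⟨x, hx⟩ := exists_dbl β ha
  dsimp only at hx hb
  subst hx hb
  exact ⟨u, x, rfl⟩

/-- Off the elements `(u, a, 0)` with `a ∈ 2R` the squared exponential sum is `n` if the radical
is trivial, and `0` or `4 n` otherwise, where `n = s²`. -/
lemma expSum_dichotomy (g : Grp F) (h : red F g.2.1 ≠ 0 ∨ g.2.2 ≠ 0) :
    (radical β (red F g.2.1) g.2.2 = ⊥ ∧ expSum β g ^ 2 = sC m ^ 2) ∨
    (g.2.2 ≠ 0 ∧ radical β (red F g.2.1) g.2.2 ≠ ⊥ ∧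
      (expSum β g = 0 ∨ expSum β g ^ 2 = 4 * sC m ^ 2)) := by
  by_cases hr : radical β (red F g.2.1) g.2.2 = ⊥
  · exact Or.inl ⟨hr, expSum_sq_of_radical_eq_bot β g hr⟩
  · have hb : g.2.2 ≠ 0 := by
      intro hb
      apply hr
      rw [hb]
      exact radical_eq_bot_of_eq_zero β (h.resolve_right (not_not.mpr hb))
    exact Or.inr ⟨hb, hr, expSum_of_radical_ne_bot β g hb hr⟩

/-- A sum of three columns that is not a column has exactly six representations. -/
lemma repCount_two_codeSet {h : Grp F} (hh : h ∉ codeSet β) :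
    repCount (codeSet β) 2 h = 0 ∨ repCount (codeSet β) 2 h = 6 := by
  have hS : ∀ g, ∑ c ∈ codeSet β, pairingEquiv β g c = expSum β g := sum_pairing_codeSet β
  refine (isSignedSidon_codeSet β).repCount_two_of_not_mem (selfDual_pairingEquiv β)
    (card_Grp_mul_two β) (2, 0, 0) ?_ ?_ ?_ hh
  · intro h0
    exact absurd (congrArg Prod.fst h0) (by change ¬(2 : ZMod 4) = 0; decide)
  · rw [hS, card_codeSet_eq]
    rcases expSum_zero_eq β (F := F) 2 with h1 | h1 | h1
    · exact absurd h1.1 (by decide)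
    · exact h1.2
    · exact absurd rfl h1.2.1
  · intro g hg hg2
    rw [hS, card_codeSet_eq]
    by_cases hab : red F g.2.1 ≠ 0 ∨ g.2.2 ≠ 0
    · rcases expSum_dichotomy β g hab with h1 | h1
      · exact Or.inr (Or.inl h1.2)
      · exact h1.2.2.imp id Or.inr
    · rw [not_or, not_not, not_not] at hab
      obtain ⟨u, x, rfl⟩ := eq_dbl_of_red_eq_zero β hab.1 hab.2
      left
      by_cases hx : x = 0
      · subst hx
        rw [dbl_zero] at hg hg2 ⊢
        rcases expSum_zero_eq β (F := F) u with h1 | h1 | h1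
        · exact absurd (by rw [h1.1]; rfl) hg
        · exact absurd (by rw [h1.1]) hg2
        · exact h1.2.2
      · exact expSum_dbl β u hx

lemma repCount_three_codeSet {g : Grp F} (hg : g ∈ E8 β) :
    repCount (codeSet β) 3 g = 6 * (codeSet β).card :=
  repCount_three_eq (fun _ => repCount_two_codeSet β) fun _ he => sub_mem_of_mem_E8 β hg he

lemma proj_injOn {a b : Grp F} (ha : a ∈ codeSet β) (hb : b ∈ codeSet β)
    (h : proj F a = proj F b) : a = b := by
  have h0 : proj F (a + -b) = 0 := by rw [map_add, h, ← map_add, add_neg_cancel, map_zero]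
  have := eq_zero_of_add_of_red β ha (neg_mem_codeSet β hb) (congrArg Prod.fst h0)
    (by rw [show (a + -b).2.1 = 0 from congrArg Prod.snd h0, map_zero])
  exact add_neg_eq_zero.mp this

/-- Apart from zero, no element projecting to zero is a sum of four columns. -/
lemma repCount_three_of_proj_eq_zero {g : Grp F} (hg : proj F g = 0) (h0 : g ≠ 0) :
    repCount (codeSet β) 3 g = 0 := by
  by_contra hne
  obtain ⟨a, ha, b, hb, c, hc, d, hd, rfl⟩ := repCount_three_pos_iff.mp (Nat.pos_of_ne_zero hne)
  have h1 : proj F (a + b + c) = proj F (-d) := by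
    rw [map_neg, eq_neg_iff_add_eq_zero, ← map_add, hg]
  have pair : ∀ {x y}, x ∈ codeSet β → y ∈ codeSet β → proj F (x + y) = 0 → x + y = 0 := by
    intro x y hx hy hxy
    have h2 : proj F x = proj F (-y) := by
      rw [map_neg, eq_neg_iff_add_eq_zero, ← map_add, hxy]
    rw [proj_injOn β hx (neg_mem_codeSet β hy) h2, neg_add_cancel]
  rcases degenerate_of_proj_eq β ha hb hc (neg_mem_codeSet β hd) h1 with h2 | h2 | h2 | ⟨h2, h3⟩
  · rw [h2, neg_add_cancel, zero_add] at hg h0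
    exact h0 (pair hc hd hg)
  · rw [h2, show -c + b + c + d = b + d by abel] at hg h0
    exact h0 (pair hb hd hg)
  · rw [h2, show a + -c + c + d = a + d by abel] at hg h0
    exact h0 (pair ha hd hg)
  · subst h2 h3
    rw [add_self_eq_neg_add_neg a, neg_add_cancel_right] at hg h0
    exact h0 (pair (neg_mem_codeSet β ha) hd hg)

lemma repCount_three_zero :
    (repCount (codeSet β) 3 0 : ℂ) = sC m ^ 2 * (3 * sC m ^ 2 - 2) := by
  have h1 : repCount (codeSet β) 3 0 + 2 * (codeSet β).card
      = (codeSet β).card * (3 * (codeSet β).card) := by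
    rw [repCount_succ]
    have h2 : ∀ c ∈ codeSet β, repCount (codeSet β) 2 (0 - c) + 2 = 3 * (codeSet β).card := by
      intro c hc
      rw [zero_sub]
      exact (isSignedSidon_codeSet β).repCount_two_of_mem (neg_mem_codeSet β hc)
    calc _ = ∑ c ∈ codeSet β, (repCount (codeSet β) 2 (0 - c) + 2) := by
            rw [Finset.sum_add_distrib, Finset.sum_const, smul_eq_mul, mul_comm 2]
      _ = _ := by rw [Finset.sum_congr rfl h2, Finset.sum_const, smul_eq_mul]
  have h3 := congrArg (Nat.cast (R := ℂ)) h1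
  push_cast at h3
  rw [card_codeSet_eq] at h3
  linear_combination h3

end Dichotomy

/-! ### Character sums over the classes `ℰ_i` -/

section ClassSums

variable {m : ℕ} {F : BasicIrreducible m} (β : (GR F)ˣ) [hm : Fact (3 ≤ m)]
  [hodd : Fact (Odd m)] [hβ : Fact (orderOf β = 2 ^ m - 1)]

lemma charSum_union {X : Type*} [AddCommGroup X] [Fintype X] (χ : X → ℂ) {A B C : Set X}
    (h : ∀ x, x ∈ A ↔ x ∈ B ∨ x ∈ C) (hd : ∀ x, x ∈ B → x ∉ C) :
    charSum χ A = charSum χ B + charSum χ C := by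
  classical
  rw [charSum_eq_sum_ite, charSum_eq_sum_ite, charSum_eq_sum_ite, ← Finset.sum_add_distrib]
  refine Finset.sum_congr rfl fun x _ => ?_
  by_cases hB : x ∈ B
  · simp [h, hB, hd x hB]
  · by_cases hC : x ∈ C <;> simp [h, hB, hC]

lemma sum_repCount_mul_pairing (k : ℕ) (g : Grp F) :
    ∑ h, (repCount (codeSet β) k h : ℂ) * pairing β g h = expSum β g ^ (k + 1) := by
  rw [← sum_pairing_codeSet]
  exact sum_repCount_mul (Φ := pairingEquiv β) (codeSet β) k g

lemma charSum_E0 (g : Grp F) : charSum (pairing β g) (E0 F) = 1 := by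
  classical
  rw [charSum_eq_sum_ite]
  have : ∀ h : Grp F, h ∈ E0 F ↔ h = 0 := fun h => Iff.rfl
  simp only [this, Finset.sum_ite_eq', Finset.mem_univ, if_true, pairing_zero_right]

lemma charSum_E2 (g : Grp F) : charSum (pairing β g) (E2 β) = expSum β g := by
  classical
  rw [← sum_pairing_codeSet, charSum_eq_sum_ite]
  simp_rw [← mem_codeSet_iff_mem_E2]
  simp

/-- Among the sums of two columns, `0` has `s²` representations and every other one has two. -/
lemma charSum_E4 (g : Grp F) :
    2 * charSum (pairing β g) (E4 β) + sC m ^ 2 = expSum β g ^ 2 := by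
  classical
  have h1 : ∀ h, (repCount (codeSet β) 1 h : ℂ) = 2 * (if h ∈ E4 β then 1 else 0)
      + (if h = 0 then sC m ^ 2 else 0) := by
    intro h
    by_cases h0 : h = 0
    · subst h0
      have : (0 : Grp F) ∉ E4 β := fun h => ((mem_E4_iff β).mp h).1 rfl
      rw [(isSignedSidon_codeSet β).repCount_one_zero, card_codeSet_eq]
      simp [this]
    · by_cases h4 : h ∈ E4 β
      · obtain ⟨-, a, ha, b, hb, rfl⟩ := (mem_E4_iff β).mp h4
        rw [(isSignedSidon_codeSet β).repCount_one_eq_two ha hb h0]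
        simp [h0, h4]
      · have : repCount (codeSet β) 1 h = 0 := by
          by_contra hne
          obtain ⟨a, ha, b, hb, hab⟩ := repCount_one_pos_iff.mp (Nat.pos_of_ne_zero hne)
          exact h4 ((mem_E4_iff β).mpr ⟨h0, a, ha, b, hb, hab⟩)
        simp [this, h0, h4]
  rw [← sum_repCount_mul_pairing, charSum_eq_sum_mul]
  simp_rw [h1, add_mul, Finset.sum_add_distrib, mul_assoc, ← Finset.mul_sum]
  simp [pairing_zero_right]

/-- Among the sums of three columns, a column has `3 s² - 2` representations and every other one
has six. -/
lemma charSum_E6 (g : Grp F) : 6 * charSum (pairing β g) (E6 β)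
    + (3 * sC m ^ 2 - 2) * expSum β g = expSum β g ^ 3 := by
  classical
  have h1 : ∀ h, (repCount (codeSet β) 2 h : ℂ) = 6 * (if h ∈ E6 β then 1 else 0)
      + (3 * sC m ^ 2 - 2) * (if h ∈ codeSet β then 1 else 0) := by
    intro h
    by_cases hD : h ∈ codeSet β
    · have h6 : h ∉ E6 β := fun h' => ((mem_E6_iff β).mp h').1 hD
      have := congrArg (Nat.cast (R := ℂ)) ((isSignedSidon_codeSet β).repCount_two_of_mem hD)
      push_cast at this
      rw [card_codeSet_eq] at this
      simp only [h6, hD, if_true, if_false]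
      linear_combination this
    · by_cases h6 : h ∈ E6 β
      · have hpos := repCount_two_pos_iff.mpr ((mem_E6_iff β).mp h6).2
        rw [(repCount_two_codeSet β hD).resolve_left hpos.ne']
        simp [h6, hD]
      · have : repCount (codeSet β) 2 h = 0 := by
          by_contra hne
          exact h6 ((mem_E6_iff β).mpr
            ⟨hD, repCount_two_pos_iff.mp (Nat.pos_of_ne_zero hne)⟩)
        simp [this, h6, hD]
  rw [← sum_repCount_mul_pairing, charSum_eq_sum_mul]
  simp_rw [h1, add_mul, Finset.sum_add_distrib, mul_assoc, ← Finset.mul_sum]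
  rw [← sum_pairing_codeSet]
  simp

/-! Averaging over the annihilator `{(u, 2x, 0)}` of the subgroup `{(0, 2x, r)}` restricts the
representation counts to that subgroup. -/

open Classical in
lemma sum_annihilator (h : Grp F) :
    ∑ u : ZMod 4, ∑ x : ResField F, pairing β (u, dbl β x, 0) h
      = if h.1 = 0 ∧ red F h.2.1 = 0 then 2 * sC m ^ 2 else 0 := by
  have h1 : ∀ (u : ZMod 4) (x : ResField F), pairing β (u, dbl β x, 0) h
      = iPow (AddMonoidHom.mulLeft h.1 u) * iPow (polar β (red F h.2.1) 0 1 x) := by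
    intro u x
    rw [pairing_eq, ← iPow_add, polar_apply]
    simp only [mul_zero, dbl_zero, add_zero, zero_mul, mul_one, AddMonoidHom.coe_mulLeft]
    rw [mul_dbl]
  simp_rw [h1]
  rw [← Finset.sum_mul_sum, sum_iPow, sum_iPow, ZMod.card, card_res, sC_sq]
  have e1 : (∀ u : ZMod 4, AddMonoidHom.mulLeft h.1 u = 0) ↔ h.1 = 0 :=
    ⟨fun hu => by simpa using hu 1, fun hu u => by simp [hu]⟩
  have e2 : (∀ x, polar β (red F h.2.1) 0 1 x = 0) ↔ red F h.2.1 = 0 := by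
    constructor
    · intro hall
      by_contra hne
      obtain ⟨y, hy⟩ := exists_grTrace_dbl_mul_ne_zero β hne
      apply hy
      have := hall y
      rw [polar_apply] at this
      simpa [mul_comm] using this
    · intro h0 x
      rw [polar_apply, h0]
      simp [dbl_zero, grTrace_zero]
  simp only [e1, e2]
  by_cases c1 : h.1 = 0 <;> by_cases c2 : red F h.2.1 = 0 <;> simp [c1, c2]
  ring

open Classical in
lemma sum_annihilator_expSum_pow (k : ℕ) (g : Grp F) :
    ∑ u : ZMod 4, ∑ x : ResField F, expSum β (g + (u, dbl β x, 0)) ^ (k + 1)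
      = 2 * sC m ^ 2 * ∑ h : Grp F, if h.1 = 0 ∧ red F h.2.1 = 0 then
          (repCount (codeSet β) k h : ℂ) * pairing β g h else 0 := by
  simp_rw [← sum_repCount_mul_pairing, pairing_add_left]
  rw [Finset.mul_sum]
  have : ∀ u : ZMod 4, ∑ x : ResField F, ∑ h : Grp F, (repCount (codeSet β) k h : ℂ) *
      (pairing β g h * pairing β (u, dbl β x, 0) h) = ∑ h : Grp F, ∑ x : ResField F,
      (repCount (codeSet β) k h : ℂ) * (pairing β g h * pairing β (u, dbl β x, 0) h) :=
    fun u => Finset.sum_comm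
  simp_rw [this]
  rw [Finset.sum_comm]
  refine Finset.sum_congr rfl fun h _ => ?_
  simp_rw [← mul_assoc, ← Finset.mul_sum, sum_annihilator]
  split_ifs <;> ring

lemma sum_annihilator_expSum_sq (g : Grp F) :
    ∑ u : ZMod 4, ∑ x : ResField F, expSum β (g + (u, dbl β x, 0)) ^ 2 = 2 * sC m ^ 4 := by
  classical
  rw [sum_annihilator_expSum_pow β 1 g, Finset.sum_eq_single 0]
  · rw [if_pos ⟨rfl, map_zero (red F)⟩, (isSignedSidon_codeSet β).repCount_one_zero,
      card_codeSet_eq, pairing_zero_right]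
    ring
  · intro h _ h0
    split_ifs with hh
    · have : repCount (codeSet β) 1 h = 0 := by
        by_contra hne
        obtain ⟨a, ha, b, hb, rfl⟩ := repCount_one_pos_iff.mp (Nat.pos_of_ne_zero hne)
        exact h0 (eq_zero_of_add_of_red β ha hb hh.1 hh.2)
      simp [this]
    · rfl
  · simp

lemma sum_annihilator_expSum_four (g : Grp F) :
    ∑ u : ZMod 4, ∑ x : ResField F, expSum β (g + (u, dbl β x, 0)) ^ 4
      = 2 * sC m ^ 4 * (6 * charSum (pairing β g) (E8 β) + 3 * sC m ^ 2 - 2) := by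
  classical
  have h1 : ∀ h : Grp F, (if h.1 = 0 ∧ red F h.2.1 = 0 then
      (repCount (codeSet β) 3 h : ℂ) * pairing β g h else 0)
      = 6 * sC m ^ 2 * (if h ∈ E8 β then pairing β g h else 0)
        + (if h = 0 then sC m ^ 2 * (3 * sC m ^ 2 - 2) else 0) := by
    intro h
    by_cases hh : h.1 = 0 ∧ red F h.2.1 = 0
    · rw [if_pos hh]
      by_cases h0 : h = 0
      · subst h0
        have : (0 : Grp F) ∉ E8 β := fun h' => ((mem_E8_iff β).mp h').1.2.2 rfl
        simp [this, repCount_three_zero, pairing_zero_right]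
      · rw [if_neg h0]
        by_cases h8 : h ∈ E8 β
        · have := congrArg (Nat.cast (R := ℂ)) (repCount_three_codeSet β h8)
          push_cast at this
          rw [card_codeSet_eq] at this
          rw [this, if_pos h8, add_zero]
        · have : repCount (codeSet β) 3 h = 0 := by
            by_cases hc : h.2.1 = 0
            · exact repCount_three_of_proj_eq_zero β (Prod.ext hh.1 hc) h0
            · by_contra hne
              exact h8 ((mem_E8_iff β).mpr ⟨⟨hh.1, hh.2, hc⟩,
                repCount_three_pos_iff.mp (Nat.pos_of_ne_zero hne)⟩)
          simp [this, h8]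
    · have h0 : h ≠ 0 := by
        rintro rfl
        exact hh ⟨rfl, map_zero (red F)⟩
      have h8 : h ∉ E8 β := fun h' => hh ⟨((mem_E8_iff β).mp h').1.1, ((mem_E8_iff β).mp h').1.2.1⟩
      simp [hh, h0, h8]
  rw [sum_annihilator_expSum_pow β 3 g]
  simp_rw [h1]
  rw [Finset.sum_add_distrib, ← Finset.mul_sum, ← charSum_eq_sum_ite, Finset.sum_ite_eq',
    if_pos (Finset.mem_univ _)]
  ring

lemma sC_ne_zero : sC m ≠ 0 := by
  intro h
  have := sC_sq (m := m)
  rw [h] at this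
  norm_num at this

lemma red_add_dbl (g : Grp F) (u : ZMod 4) (x : ResField F) :
    red F (g + (u, dbl β x, 0)).2.1 = red F g.2.1 := by
  change red F (g.2.1 + dbl β x) = _
  rw [map_add, red_dbl, add_zero]

lemma add_dbl_snd (g : Grp F) (u : ZMod 4) (x : ResField F) :
    (g + (u, dbl β x, 0)).2.2 = g.2.2 := add_zero _

lemma sum_annihilator_const (c : ℂ) :
    ∑ _u : ZMod 4, ∑ _x : ResField F, c = 2 * sC m ^ 2 * c := by
  rw [Finset.sum_const, Finset.sum_const, Finset.card_univ, Finset.card_univ, ZMod.card, card_res,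
    sC_sq, nsmul_eq_mul, nsmul_eq_mul]
  push_cast
  ring

lemma charSum_E8_of_radical_eq_bot (g : Grp F) (hr : radical β (red F g.2.1) g.2.2 = ⊥) :
    charSum (pairing β g) (E8 β) = 1 / 3 - sC m ^ 2 / 3 := by
  have h := sum_annihilator_expSum_four β g
  have h1 : ∀ (u : ZMod 4) (x : ResField F), expSum β (g + (u, dbl β x, 0)) ^ 4 = sC m ^ 4 := by
    intro u x
    have := expSum_sq_of_radical_eq_bot β (g + (u, dbl β x, 0))
      (by rw [red_add_dbl, add_dbl_snd]; exact hr)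
    linear_combination (expSum β (g + (u, dbl β x, 0)) ^ 2 + sC m ^ 2) * this
  simp_rw [h1] at h
  rw [sum_annihilator_const] at h
  have h4 : (2 * sC m ^ 4 : ℂ) ≠ 0 := mul_ne_zero two_ne_zero (pow_ne_zero _ sC_ne_zero)
  have h5 : sC m ^ 2 = 6 * charSum (pairing β g) (E8 β) + 3 * sC m ^ 2 - 2 := by
    apply mul_left_cancel₀ h4
    linear_combination h
  linear_combination (-1 / 6 : ℂ) * h5

lemma charSum_E8_of_radical_ne_bot (g : Grp F) (hb : g.2.2 ≠ 0)
    (hr : radical β (red F g.2.1) g.2.2 ≠ ⊥) :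
    charSum (pairing β g) (E8 β) = sC m ^ 2 / 6 + 1 / 3 := by
  have h := sum_annihilator_expSum_four β g
  have h1 : ∀ (u : ZMod 4) (x : ResField F), expSum β (g + (u, dbl β x, 0)) ^ 4
      = 4 * sC m ^ 2 * expSum β (g + (u, dbl β x, 0)) ^ 2 := by
    intro u x
    rcases expSum_of_radical_ne_bot β (g + (u, dbl β x, 0)) (by rw [add_dbl_snd]; exact hb)
      (by rw [red_add_dbl, add_dbl_snd]; exact hr) with h2 | h2
    · rw [h2]; ring
    · linear_combination expSum β (g + (u, dbl β x, 0)) ^ 2 * h2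
  simp_rw [h1, ← Finset.mul_sum] at h
  rw [sum_annihilator_expSum_sq] at h
  have h4 : (2 * sC m ^ 4 : ℂ) ≠ 0 := mul_ne_zero two_ne_zero (pow_ne_zero _ sC_ne_zero)
  have h5 : 4 * sC m ^ 2 = 6 * charSum (pairing β g) (E8 β) + 3 * sC m ^ 2 - 2 := by
    apply mul_left_cancel₀ h4
    linear_combination h
  linear_combination (-1 / 6 : ℂ) * h5

lemma charSum_E8_of_red_eq_zero (g : Grp F) (ha : red F g.2.1 = 0) (hb : g.2.2 = 0) :
    charSum (pairing β g) (E8 β) = sC m ^ 4 / 6 - sC m ^ 2 / 2 + 1 / 3 := by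
  classical
  obtain ⟨v, y, rfl⟩ := eq_dbl_of_red_eq_zero β ha hb
  have h := sum_annihilator_expSum_four β (v, dbl β y, 0)
  have h1 : ∑ u : ZMod 4, ∑ x : ResField F,
      expSum β ((v, dbl β y, 0) + (u, dbl β x, 0)) ^ 4 = 2 * sC m ^ 8 := by
    have e : ∀ (u : ZMod 4) (x : ResField F), ((v, dbl β y, 0) + (u, dbl β x, 0) : Grp F)
        = (v + u, dbl β (y + x), 0) := by
      intro u x
      rw [dbl_add]
      exact Prod.ext rfl (Prod.ext rfl (add_zero _))
    simp_rw [e]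
    have s1 : ∀ u : ZMod 4, ∑ x : ResField F, expSum β (v + u, dbl β (y + x), 0) ^ 4
        = expSum β (v + u, 0, 0) ^ 4 := by
      intro u
      have := Equiv.sum_comp (Equiv.addLeft y) (fun x => expSum β (v + u, dbl β x, 0) ^ 4)
      simp only [Equiv.coe_addLeft] at this
      rw [this, Finset.sum_eq_single 0]
      · rw [dbl_zero]
      · intro x _ hx
        rw [expSum_dbl β _ hx]
        norm_num
      · simp
    simp_rw [s1]
    have s2 := Equiv.sum_comp (Equiv.addLeft v) (fun u => expSum β (F := F) (u, 0, 0) ^ 4)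
    simp only [Equiv.coe_addLeft] at s2
    rw [s2]
    have hu : ∀ u : ZMod 4, expSum β (u, 0, 0) ^ 4
        = if u = 0 ∨ u = 2 then sC m ^ 8 else 0 := by
      intro u
      rcases expSum_zero_eq β (F := F) u with h1 | h1 | h1
      · rw [h1.2, if_pos (Or.inl h1.1)]; ring
      · rw [h1.2, if_pos (Or.inr h1.1)]; ring
      · rw [h1.2.2, if_neg (not_or.mpr ⟨h1.1, h1.2.1⟩)]; norm_num
    simp_rw [hu]
    rw [← Finset.sum_filter, show Finset.univ.filter (fun u : ZMod 4 => u = 0 ∨ u = 2) = {0, 2}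
      from by decide, Finset.sum_pair (by decide)]
    ring
  rw [h1] at h
  have h4 : (2 * sC m ^ 4 : ℂ) ≠ 0 := mul_ne_zero two_ne_zero (pow_ne_zero _ sC_ne_zero)
  have h5 : sC m ^ 4 = 6 * charSum (pairing β (v, dbl β y, 0)) (E8 β) + 3 * sC m ^ 2 - 2 := by
    apply mul_left_cancel₀ h4
    linear_combination h
  linear_combination (-1 / 6 : ℂ) * h5

/-! Unions of classes that are inverse images under `proj`. -/

open Classical in
/-- `q` if `b = 0`, and `0` otherwise. -/
def qIfZero (b : ResField F) : ℂ := if b = 0 then sC m ^ 2 / 2 else 0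

open Classical in
lemma charSum_proj_preimage (K : ZMod 4 × GR F → Prop) (g : Grp F) :
    charSum (pairing β g) {h | K (proj F h)}
      = qIfZero g.2.2 * ∑ u, ∑ c, if K (u, c) then
          iPow (u * g.1) * iPow (grTrace β (c * g.2.1)) else 0 := by
  rw [charSum_eq_sum_ite, Fintype.sum_prod_type, Finset.mul_sum]
  refine Finset.sum_congr rfl fun u _ => ?_
  rw [Fintype.sum_prod_type, Finset.mul_sum]
  refine Finset.sum_congr rfl fun c _ => ?_
  simp only [Set.mem_ofPred_eq, proj_apply, pairing_eq]
  by_cases hK : K (u, c)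
  · simp only [hK, if_true, grTrace_add, ← iPow_add]
    simp_rw [← add_assoc, iPow_add _ (grTrace β (dbl β _)), ← Finset.mul_sum]
    have h1 : ∀ r : ResField F, iPow (grTrace β (dbl β (r * g.2.2)))
        = iPow (polar β g.2.2 0 1 r) := by
      intro r
      rw [polar_apply]
      simp [mul_comm]
    simp_rw [h1]
    rw [sum_iPow, mul_comm, card_res, qIfZero, sC_sq]
    congr 1
    have e2 : (∀ x, polar β g.2.2 0 1 x = 0) ↔ g.2.2 = 0 := by
      constructor
      · intro hall
        by_contra hne
        obtain ⟨y, hy⟩ := exists_grTrace_dbl_mul_ne_zero β hne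
        apply hy
        have := hall y
        rw [polar_apply] at this
        simpa [mul_comm] using this
      · intro h0 x
        rw [polar_apply, h0]
        simp [dbl_zero, grTrace_zero]
    simp only [e2]
    split_ifs
    · push_cast; ring
    · rfl
  · simp [hK]

lemma charSum_proj_preimage' (K : ZMod 4 × GR F → Prop) [DecidablePred K] (g : Grp F) :
    charSum (pairing β g) {h | K (proj F h)}
      = qIfZero g.2.2 * ∑ x, if K x then
          iPow (x.1 * g.1) * iPow (grTrace β (x.2 * g.2.1)) else 0 := by
  classical
  rw [charSum_proj_preimage, Fintype.sum_prod_type]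
  congr! 6

end ClassSums

/-! ### The partition of `G` into the classes `ℰ_i` -/

section Partition

variable {m : ℕ} {F : BasicIrreducible m} (β : (GR F)ˣ) [hm : Fact (3 ≤ m)]
  [hodd : Fact (Odd m)] [hβ : Fact (orderOf β = 2 ^ m - 1)]

lemma fst_of_mem_codeSet {g : Grp F} (hg : g ∈ codeSet β) : g.1 = 1 ∨ g.1 = 3 := by
  obtain ⟨x, rfl | rfl⟩ := (mem_codeSet β).mp hg
  · exact Or.inl rfl
  · rw [neg_codeVec]; exact Or.inr rfl

/-- The elements with the same projection as some column. -/
def overCode (g : Grp F) : Prop := ∃ d ∈ codeSet β, proj F g = proj F d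

lemma overCode_of_mem {g : Grp F} (hg : g ∈ codeSet β) : overCode β g := ⟨g, hg, rfl⟩

lemma fst_of_overCode {g : Grp F} (hg : overCode β g) : g.1 = 1 ∨ g.1 = 3 := by
  obtain ⟨d, hd, h⟩ := hg
  have h1 : g.1 = d.1 := congrArg (fun x : ZMod 4 × GR F => x.1) h
  rw [h1]
  exact fst_of_mem_codeSet β hd

lemma fst_of_mem_E6 {g : Grp F} (hg : g ∈ E6 β) : g.1 = 1 ∨ g.1 = 3 := by
  obtain ⟨-, a, ha, b, hb, c, hc, rfl⟩ := (mem_E6_iff β).mp hg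
  change a.1 + b.1 + c.1 = 1 ∨ a.1 + b.1 + c.1 = 3
  rcases fst_of_mem_codeSet β ha with h1 | h1 <;> rcases fst_of_mem_codeSet β hb with h2 | h2 <;>
  rcases fst_of_mem_codeSet β hc with h3 | h3 <;> rw [h1, h2, h3] <;> decide

lemma not_overCode_of_mem_E6 {g : Grp F} (hg : g ∈ E6 β) : ¬overCode β g := by
  obtain ⟨h, a, ha, b, hb, c, hc, rfl⟩ := (mem_E6_iff β).mp hg
  rintro ⟨d, hd, hp⟩
  rcases degenerate_of_proj_eq β ha hb hc hd hp with h1 | h1 | h1 | ⟨h1, h2⟩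
  · rw [h1, neg_add_cancel, zero_add] at h
    exact h hc
  · rw [h1, show -c + b + c = b by abel] at h
    exact h hb
  · rw [h1, show a + -c + c = a by abel] at h
    exact h ha
  · subst h1 h2
    rw [add_self_eq_neg_add_neg a, neg_add_cancel_right] at h
    exact h (neg_mem_codeSet β ha)

lemma fst_of_mem_E4 {g : Grp F} (hg : g ∈ E4 β) : (g.1 = 0 ∧ red F g.2.1 ≠ 0) ∨ g.1 = 2 := by
  obtain ⟨h0, a, ha, b, hb, rfl⟩ := (mem_E4_iff β).mp hg
  have h1 : (a + b).1 = 0 ∨ (a + b).1 = 2 := by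
    change a.1 + b.1 = 0 ∨ a.1 + b.1 = 2
    rcases fst_of_mem_codeSet β ha with h1 | h1 <;>
    rcases fst_of_mem_codeSet β hb with h2 | h2 <;> rw [h1, h2] <;> decide
  exact h1.imp_left fun h => ⟨h, fun h2 => h0 (eq_zero_of_add_of_red β ha hb h h2)⟩

/-! Each of the five blocks `ℰ_0 ∪ ℰ_1`, `ℰ_2 ∪ ℰ_3`, `ℰ_4 ∪ ℰ_5`, `ℰ_6 ∪ ℰ_7`, `ℰ_8 ∪ ℰ_9` is an
inverse image under the projection `G → ℤ/4 × R`. -/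

lemma mem_block01 (g : Grp F) : proj F g = 0 ↔ g ∈ E0 F ∨ g ∈ E1 F := by
  rw [mem_E1_iff, show g ∈ E0 F ↔ g = 0 from Iff.rfl, proj_apply, Prod.mk_eq_zero]
  constructor
  · intro h
    by_cases h0 : g = 0
    exacts [Or.inl h0, Or.inr ⟨h0, h⟩]
  · rintro (rfl | h)
    exacts [⟨rfl, rfl⟩, h.2]

lemma mem_block23 (g : Grp F) : overCode β g ↔ g ∈ E2 β ∨ g ∈ E3 β := by
  rw [mem_E3_iff, ← mem_codeSet_iff_mem_E2]
  constructor
  · intro h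
    by_cases h0 : g ∈ codeSet β
    exacts [Or.inl h0, Or.inr ⟨h0, h⟩]
  · rintro (h | h)
    exacts [overCode_of_mem β h, h.2]

lemma mem_block45 (g : Grp F) :
    (g.1 = 0 ∧ red F g.2.1 ≠ 0) ∨ g.1 = 2 ↔ g ∈ E4 β ∨ g ∈ E5 β := by
  rw [mem_E5_iff]
  constructor
  · intro h
    by_cases h0 : g ∈ E4 β
    exacts [Or.inl h0, Or.inr ⟨h0, h⟩]
  · rintro (h | h)
    exacts [fst_of_mem_E4 β h, h.2]

lemma mem_block67 (g : Grp F) :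
    (g.1 = 1 ∨ g.1 = 3) ∧ ¬overCode β g ↔ g ∈ E6 β ∨ g ∈ E7 β := by
  rw [mem_E7_iff]
  constructor
  · intro h
    by_cases h0 : g ∈ E6 β
    exacts [Or.inl h0, Or.inr ⟨h0, h⟩]
  · rintro (h | h)
    exacts [⟨fst_of_mem_E6 β h, not_overCode_of_mem_E6 β h⟩, h.2]

lemma mem_block89 (g : Grp F) :
    g.1 = 0 ∧ red F g.2.1 = 0 ∧ g.2.1 ≠ 0 ↔ g ∈ E8 β ∨ g ∈ E9 β := by
  rw [mem_E9_iff]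
  constructor
  · intro h
    by_cases h0 : g ∈ E8 β
    exacts [Or.inl h0, Or.inr ⟨h0, h⟩]
  · rintro (h | h)
    exacts [((mem_E8_iff β).mp h).1, h.2]

lemma not_mem_E1_of_mem_E0 {g : Grp F} (h : g ∈ E0 F) : g ∉ E1 F := fun h' =>
  (mem_E1_iff.mp h').1 h

lemma not_mem_E3_of_mem_E2 {g : Grp F} (h : g ∈ E2 β) : g ∉ E3 β := fun h' => h'.2 h

lemma not_mem_E5_of_mem_E4 {g : Grp F} (h : g ∈ E4 β) : g ∉ E5 β := fun h' => h'.2 h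

lemma not_mem_E7_of_mem_E6 {g : Grp F} (h : g ∈ E6 β) : g ∉ E7 β := fun h' => h'.2 h

lemma not_mem_E9_of_mem_E8 {g : Grp F} (h : g ∈ E8 β) : g ∉ E9 β := fun h' => h'.2 h

open Classical in
/-- The index of the class `ℰ_i` that contains a given element. -/
def classIndex (g : Grp F) : Fin 10 :=
  if proj F g = 0 then if g ∈ E0 F then 0 else 1
  else if g.1 = 0 ∧ red F g.2.1 = 0 then if g ∈ E8 β then 8 else 9
  else if g.1 = 0 ∨ g.1 = 2 then if g ∈ E4 β then 4 else 5
  else if overCode β g then if g ∈ E2 β then 2 else 3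
  else if g ∈ E6 β then 6 else 7

lemma mem_classE_classIndex (g : Grp F) : g ∈ classE β (classIndex β g) := by
  rw [classIndex]
  split_ifs with h1 h2 h2 h3 h3 h4 h4 h5 h5
  · exact h2
  · exact ((mem_block01 g).mp h1).resolve_left h2
  · exact h3
  · refine ((mem_block89 β g).mp ⟨h2.1, h2.2, fun h => h1 ?_⟩).resolve_left h3
    exact Prod.ext h2.1 h
  · exact h4
  · refine ((mem_block45 β g).mp (h3.imp_left fun h => ⟨h, fun h' => h2 ⟨h, h'⟩⟩)).resolve_left h4
  · exact h5
  · exact ((mem_block23 β g).mp h4).resolve_left h5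
  · assumption
  · refine ((mem_block67 β g).mp ⟨?_, h4⟩).resolve_left h5
    rcases zmod_four_cases g.1 with h | h | h | h
    exacts [absurd (Or.inl h) h3, Or.inl h, absurd (Or.inr h) h3, Or.inr h]

lemma classIndex_eq_of_mem {i : Fin 10} {g : Grp F} (hg : g ∈ classE β i) :
    classIndex β g = i := by
  have hp : ∀ {u : ZMod 4}, g.1 = u → u ≠ 0 → ¬proj F g = 0 := fun hu h0 h =>
    h0 (hu.symm.trans (congrArg Prod.fst h))
  have even : g.1 = 0 ∨ g.1 = 2 → ¬(g.1 = 1 ∨ g.1 = 3) := by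
    rintro (h | h) <;> rw [h] <;> decide
  have zero : g.1 = 0 → ¬(g.1 = 1 ∨ g.1 = 3) := fun h => even (Or.inl h)
  have hproj : ∀ {w}, w = g.2.1 → w ≠ 0 → ¬proj F g = 0 := by
    rintro _ rfl hw h
    exact hw (congrArg Prod.snd h)
  rw [classIndex]
  fin_cases i
  · have h1 := (mem_block01 g).mpr (Or.inl hg)
    rw [if_pos h1, if_pos (show g ∈ E0 F from hg)]; rfl
  · have h1 := (mem_block01 g).mpr (Or.inr hg)
    rw [if_pos h1, if_neg fun h => not_mem_E1_of_mem_E0 h hg]; rfl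
  · have h1 := (mem_block23 β g).mpr (Or.inl hg)
    have h2 := fst_of_overCode β h1
    rw [if_neg (by rintro h; exact zero (congrArg Prod.fst h) h2),
      if_neg fun h => zero h.1 h2, if_neg fun h => even h h2, if_pos h1, if_pos (show g ∈ E2 β from hg)]; rfl
  · have h1 := (mem_block23 β g).mpr (Or.inr hg)
    have h2 := fst_of_overCode β h1
    rw [if_neg (by rintro h; exact zero (congrArg Prod.fst h) h2),
      if_neg fun h => zero h.1 h2, if_neg fun h => even h h2, if_pos h1,
      if_neg fun h => not_mem_E3_of_mem_E2 β h hg]; rfl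
  · have h1 := (mem_block45 β g).mpr (Or.inl hg)
    have h2 : ¬(g.1 = 0 ∧ red F g.2.1 = 0) := by
      rintro ⟨h, h'⟩
      rcases h1 with h1 | h1
      exacts [h1.2 h', absurd (h.symm.trans h1) (by decide)]
    rw [if_neg fun h => h2 ⟨congrArg Prod.fst h, by rw [show g.2.1 = 0 from congrArg Prod.snd h,
      map_zero]⟩, if_neg h2, if_pos (h1.imp_left And.left), if_pos (show g ∈ E4 β from hg)]; rfl
  · have h1 := (mem_block45 β g).mpr (Or.inr hg)
    have h2 : ¬(g.1 = 0 ∧ red F g.2.1 = 0) := by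
      rintro ⟨h, h'⟩
      rcases h1 with h1 | h1
      exacts [h1.2 h', absurd (h.symm.trans h1) (by decide)]
    rw [if_neg fun h => h2 ⟨congrArg Prod.fst h, by rw [show g.2.1 = 0 from congrArg Prod.snd h,
      map_zero]⟩, if_neg h2, if_pos (h1.imp_left And.left),
      if_neg fun h => not_mem_E5_of_mem_E4 β h hg]; rfl
  · have h1 := (mem_block67 β g).mpr (Or.inl hg)
    rw [if_neg (by rintro h; exact zero (congrArg Prod.fst h) h1.1),
      if_neg fun h => zero h.1 h1.1, if_neg fun h => even h h1.1, if_neg h1.2, if_pos (show g ∈ E6 β from hg)]; rfl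
  · have h1 := (mem_block67 β g).mpr (Or.inr hg)
    rw [if_neg (by rintro h; exact zero (congrArg Prod.fst h) h1.1),
      if_neg fun h => zero h.1 h1.1, if_neg fun h => even h h1.1, if_neg h1.2,
      if_neg fun h => not_mem_E7_of_mem_E6 β h hg]; rfl
  · have h1 := (mem_block89 β g).mpr (Or.inl hg)
    rw [if_neg (hproj rfl h1.2.2), if_pos ⟨h1.1, h1.2.1⟩, if_pos (show g ∈ E8 β from hg)]; rfl
  · have h1 := (mem_block89 β g).mpr (Or.inr hg)
    rw [if_neg (hproj rfl h1.2.2), if_pos ⟨h1.1, h1.2.1⟩,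
      if_neg fun h => not_mem_E9_of_mem_E8 β h hg]; rfl

lemma existsUnique_mem_classE (g : Grp F) : ∃! i, g ∈ classE β i :=
  ⟨classIndex β g, mem_classE_classIndex β g, fun _ h => (classIndex_eq_of_mem β h).symm⟩

lemma neg_overCode {g : Grp F} (hg : overCode β g) : overCode β (-g) := by
  obtain ⟨d, hd, h⟩ := hg
  exact ⟨-d, neg_mem_codeSet β hd, by rw [map_neg, map_neg, h]⟩

lemma neg_mem_E4 {g : Grp F} (hg : g ∈ E4 β) : -g ∈ E4 β := by
  obtain ⟨h0, a, ha, b, hb, rfl⟩ := (mem_E4_iff β).mp hg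
  exact (mem_E4_iff β).mpr ⟨neg_ne_zero.mpr h0, _, neg_mem_codeSet β ha, _, neg_mem_codeSet β hb,
    neg_add _ _⟩

lemma neg_mem_E6 {g : Grp F} (hg : g ∈ E6 β) : -g ∈ E6 β := by
  obtain ⟨h0, a, ha, b, hb, c, hc, rfl⟩ := (mem_E6_iff β).mp hg
  refine (mem_E6_iff β).mpr ⟨fun h => h0 ?_, _, neg_mem_codeSet β ha, _, neg_mem_codeSet β hb,
    _, neg_mem_codeSet β hc, by rw [neg_add, neg_add]⟩
  simpa using neg_mem_codeSet β h

lemma neg_mem_classE (i : Fin 10) (g : Grp F) (hg : g ∈ classE β i) : -g ∈ classE β i := by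
  have odd : g.1 = 1 ∨ g.1 = 3 → (-g).1 = 1 ∨ (-g).1 = 3 := by
    rw [Prod.fst_neg]
    rintro (h | h) <;> rw [h] <;> decide
  fin_cases i
  · change g = 0 at hg
    change -g = 0
    rw [hg, neg_zero]
  · rw [show -g = g from neg_eq_self (mem_E1_iff.mp hg).2.1
      (by rw [(mem_E1_iff.mp hg).2.2, map_zero])]
    exact hg
  · exact (mem_codeSet_iff_mem_E2 β).mp
      (neg_mem_codeSet β ((mem_codeSet_iff_mem_E2 β).mpr hg))
  · obtain ⟨h0, h⟩ := (mem_E3_iff β).mp hg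
    refine (mem_E3_iff β).mpr ⟨fun h' => h0 ?_, neg_overCode β h⟩
    simpa using neg_mem_codeSet β h'
  · exact neg_mem_E4 β hg
  · obtain ⟨h0, h⟩ := (mem_E5_iff β).mp hg
    refine (mem_E5_iff β).mpr ⟨fun h' => h0 ?_, ?_⟩
    · simpa using neg_mem_E4 β h'
    · rw [Prod.fst_neg, Prod.snd_neg, Prod.fst_neg, map_neg]
      rcases h with h | h
      · rw [h.1, neg_zero]
        exact Or.inl ⟨rfl, neg_ne_zero.mpr h.2⟩
      · rw [h]
        exact Or.inr (by decide)
  · exact neg_mem_E6 β hg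
  · obtain ⟨h0, h, h'⟩ := (mem_E7_iff β).mp hg
    refine (mem_E7_iff β).mpr ⟨fun h6 => h0 ?_, odd h, fun h2 => h' ?_⟩
    · simpa using neg_mem_E6 β h6
    · have := neg_overCode β h2
      rwa [neg_neg] at this
  · have := ((mem_E8_iff β).mp hg).1
    rw [neg_eq_self this.1 this.2.1]
    exact hg
  · have := ((mem_E9_iff β).mp hg).2
    rw [neg_eq_self this.1 this.2.1]
    exact hg

end Partition

/-! ### Character sums over the blocks -/

section Blocks

variable {m : ℕ} {F : BasicIrreducible m} (β : (GR F)ˣ) [hm : Fact (3 ≤ m)]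
  [hodd : Fact (Odd m)] [hβ : Fact (orderOf β = 2 ^ m - 1)]

lemma charSum_block01 (g : Grp F) :
    charSum (pairing β g) (E0 F) + charSum (pairing β g) (E1 F) = qIfZero g.2.2 := by
  classical
  have h := charSum_proj_preimage' β (fun x => x = 0) g
  beta_reduce at h
  rw [Finset.sum_ite_eq', if_pos (Finset.mem_univ _)] at h
  rw [← charSum_union _ (A := {h : Grp F | proj F h = 0}) mem_block01 fun _ => not_mem_E1_of_mem_E0, h]
  simp [iPow_zero, grTrace_zero]

lemma charSum_block23 (g : Grp F) :
    charSum (pairing β g) (E2 β) + charSum (pairing β g) (E3 β)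
      = qIfZero g.2.2 * expSum β g := by
  classical
  have h := charSum_proj_preimage' β (fun x => ∃ d ∈ codeSet β, x = proj F d) g
  rw [← charSum_union _ (A := {h : Grp F | overCode β h}) (mem_block23 β)
    fun _ => not_mem_E3_of_mem_E2 β]
  refine h.trans ?_
  by_cases hb : g.2.2 = 0
  · congr 1
    rw [← Finset.sum_filter, ← sum_pairing_codeSet]
    have : Finset.univ.filter (fun x => ∃ d ∈ codeSet β, x = proj F d)
        = (codeSet β).image (proj F) := by
      ext x
      simp [eq_comm]
    rw [this, Finset.sum_image fun a ha b hb hab => proj_injOn β ha hb hab]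
    refine Finset.sum_congr rfl fun d _ => ?_
    rw [pairing_eq, hb, mul_zero, dbl_zero, add_zero, ← iPow_add]
    rfl
  · rw [qIfZero, if_neg hb, zero_mul, zero_mul]

open Classical in
lemma charSum_red_eq_zero (g : Grp F) :
    charSum (pairing β g) {h | h.1 = 0 ∧ red F h.2.1 = 0}
      = qIfZero g.2.2 * if red F g.2.1 = 0 then sC m ^ 2 / 2 else 0 := by
  have h := charSum_proj_preimage β (fun x => x.1 = 0 ∧ red F x.2 = 0) g
  refine h.trans ?_
  congr 1
  rw [Finset.sum_eq_single 0]
  · simp only [true_and, zero_mul, iPow_zero, one_mul]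
    rw [← Finset.sum_filter]
    have h1 : Finset.univ.filter (fun c => red F c = 0) = Finset.univ.image (dbl β) := by
      ext c
      simp only [Finset.mem_filter, Finset.mem_univ, true_and, Finset.mem_image]
      constructor
      · intro hc
        obtain ⟨x, rfl⟩ := exists_dbl β hc
        exact ⟨x, rfl⟩
      · rintro ⟨x, rfl⟩
        exact red_dbl β x
    rw [h1, Finset.sum_image fun a _ b _ hab => dbl_injective β hab]
    have h2 : ∀ x, iPow (grTrace β (dbl β x * g.2.1))
        = iPow (polar β (red F g.2.1) 0 1 x) := by
      intro x
      rw [polar_apply, mul_comm, mul_dbl]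
      simp
    simp_rw [h2]
    have h3 : (∀ x, polar β (red F g.2.1) 0 1 x = 0) ↔ red F g.2.1 = 0 := by
      constructor
      · intro hall
        by_contra hne
        obtain ⟨y, hy⟩ := exists_grTrace_dbl_mul_ne_zero β hne
        apply hy
        have := hall y
        rw [polar_apply] at this
        simpa [mul_comm] using this
      · intro h0 x
        rw [polar_apply, h0]
        simp [dbl_zero, grTrace_zero]
    rw [sum_iPow, card_res, sC_sq]
    simp only [h3]
    push_cast
    congr 1
    ring
  · intro u _ hu
    simp [hu]
  · simp

lemma charSum_block89 (g : Grp F) :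
    charSum (pairing β g) (E8 β) + charSum (pairing β g) (E9 β)
      = charSum (pairing β g) {h | h.1 = 0 ∧ red F h.2.1 = 0} - qIfZero g.2.2 := by
  rw [← charSum_union _ (A := {h : Grp F | h.1 = 0 ∧ red F h.2.1 = 0 ∧ h.2.1 ≠ 0}) (mem_block89 β)
    fun _ => not_mem_E9_of_mem_E8 β, eq_sub_iff_add_eq, ← charSum_block01 β,
    ← charSum_union _ (A := {h : Grp F | proj F h = 0}) mem_block01 fun _ => not_mem_E1_of_mem_E0]
  refine (charSum_union _ (fun h => ?_) fun h h1 h2 => ?_).symm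
  · change h.1 = 0 ∧ red F h.2.1 = 0 ↔ (h.1 = 0 ∧ red F h.2.1 = 0 ∧ h.2.1 ≠ 0) ∨ proj F h = 0
    rw [proj_apply, Prod.mk_eq_zero]
    by_cases h0 : h.2.1 = 0 <;> simp [h0]
  · exact h1.2.2 (congrArg Prod.snd h2)

open Classical in
/-- The sum over the elements whose first coordinate is `u` or `u'`. -/
lemma charSum_fst {u u' : ZMod 4} (huu : u ≠ u') (g : Grp F) :
    charSum (pairing β g) {h | h.1 = u ∨ h.1 = u'}
      = qIfZero g.2.2 * ((iPow (u * g.1) + iPow (u' * g.1)) *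
          if g.2.1 = 0 then (sC m ^ 2 / 2) ^ 2 else 0) := by
  have h := charSum_proj_preimage β (fun x => x.1 = u ∨ x.1 = u') g
  refine h.trans ?_
  congr 1
  have h1 : ∑ c, iPow (grTrace β (c * g.2.1)) = if g.2.1 = 0 then (sC m ^ 2 / 2) ^ 2 else 0 := by
    have h2 := sum_iPow ((traceHom β).comp (AddMonoidHom.mulRight g.2.1))
    have h3 : (∀ c, (traceHom β).comp (AddMonoidHom.mulRight g.2.1) c = 0) ↔ g.2.1 = 0 := by
      constructor
      · intro hall
        by_contra hne
        obtain ⟨c, hc⟩ := exists_grTrace_mul_ne_zero β hne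
        exact hc (hall c)
      · intro h0 c
        change grTrace β (c * g.2.1) = 0
        rw [h0, mul_zero, grTrace_zero]
    simp only [h3] at h2
    refine h2.trans ?_
    rw [card_GR, sC_sq]
    congr 1
    push_cast
    rw [show (4 : ℂ) ^ m = (2 ^ m) ^ 2 by rw [← pow_mul, mul_comm m, pow_mul]; norm_num]
    ring
  refine (Finset.sum_congr rfl fun v _ => (?_ : _ = if v = u ∨ v = u' then iPow (v * g.1) *
    (if g.2.1 = 0 then (sC m ^ 2 / 2) ^ 2 else 0) else 0)).trans ?_
  · by_cases hv : v = u ∨ v = u'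
    · simp only [hv, if_true]
      rw [← Finset.mul_sum, h1]
    · simp [hv]
  rw [← Finset.sum_filter, show Finset.univ.filter (fun v => v = u ∨ v = u') = {u, u'} by
    ext; simp, Finset.sum_pair huu]
  ring

lemma charSum_block45 (g : Grp F) :
    charSum (pairing β g) (E4 β) + charSum (pairing β g) (E5 β)
      = charSum (pairing β g) {h | h.1 = 0 ∨ h.1 = 2}
        - charSum (pairing β g) {h | h.1 = 0 ∧ red F h.2.1 = 0} := by
  rw [← charSum_union _ (A := {h : Grp F | (h.1 = 0 ∧ red F h.2.1 ≠ 0) ∨ h.1 = 2}) (mem_block45 β)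
    fun _ => not_mem_E5_of_mem_E4 β, eq_sub_iff_add_eq]
  refine (charSum_union _ (fun h => ?_) fun h h1 h2 => ?_).symm
  · change h.1 = 0 ∨ h.1 = 2 ↔ ((h.1 = 0 ∧ red F h.2.1 ≠ 0) ∨ h.1 = 2) ∨
      (h.1 = 0 ∧ red F h.2.1 = 0)
    tauto
  · rcases h1 with h1 | h1
    exacts [h1.2 h2.2, absurd (h1.symm.trans h2.1) (by decide)]

lemma charSum_block67 (g : Grp F) :
    charSum (pairing β g) (E6 β) + charSum (pairing β g) (E7 β)
      = charSum (pairing β g) {h | h.1 = 1 ∨ h.1 = 3} - qIfZero g.2.2 * expSum β g := by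
  rw [← charSum_union _ (A := {h : Grp F | (h.1 = 1 ∨ h.1 = 3) ∧ ¬overCode β h}) (mem_block67 β)
    fun _ => not_mem_E7_of_mem_E6 β, eq_sub_iff_add_eq, ← charSum_block23,
    ← charSum_union _ (A := {h : Grp F | overCode β h}) (mem_block23 β) fun _ => not_mem_E3_of_mem_E2 β]
  refine (charSum_union _ (fun h => ?_) fun h h1 h2 => h1.2 h2).symm
  change h.1 = 1 ∨ h.1 = 3 ↔ ((h.1 = 1 ∨ h.1 = 3) ∧ ¬overCode β h) ∨ overCode β h
  have := fst_of_overCode β (g := h)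
  tauto

end Blocks

/-! ### The eigenmatrices -/

section Matrices

lemma sum_univ_ten (f : Fin 10 → ℂ) :
    ∑ k, f k = f 0 + f 1 + f 2 + f 3 + f 4 + f 5 + f 6 + f 7 + f 8 + f 9 := by
  simp only [Fin.sum_univ_castSucc, Fin.sum_univ_zero, zero_add]
  rfl

set_option maxHeartbeats 4000000 in
lemma matQ_mul_matP (s : ℂ) :
    matQ s * matP s = (s ^ 6 / 2) • (1 : Matrix (Fin 10) (Fin 10) ℂ) := by
  ext i j
  rw [Matrix.mul_apply, sum_univ_ten]
  fin_cases i <;> fin_cases j <;> simp [matP, matQ] <;> ring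

lemma matP_zero_ne {s : ℂ} (h0 : s ^ 2 ≠ 0) (h1 : s ^ 2 - 1 ≠ 0) (h2 : s ^ 2 - 2 ≠ 0)
    (h3 : s ^ 2 + 2 ≠ 0) (j : Fin 10) : matP s 0 j ≠ 0 := by
  have a := mul_ne_zero (mul_ne_zero h0 h1) h2
  have b := mul_ne_zero h0 h2
  have c := mul_ne_zero (mul_ne_zero h0 h2) h3
  intro h
  fin_cases j
  · exact one_ne_zero (α := ℂ) h
  · replace h : s ^ 6 / 24 - s ^ 4 / 8 + s ^ 2 / 12 = 0 := h
    exact a (by linear_combination 24 * h)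
  · replace h : s ^ 4 / 2 - s ^ 2 = 0 := h
    exact b (by linear_combination 2 * h)
  · replace h : s ^ 6 / 12 - s ^ 2 / 3 = 0 := h
    exact c (by linear_combination 12 * h)
  · replace h : -2 + 2 * s ^ 2 = 0 := h
    exact h1 (by linear_combination h / 2)
  · replace h : s ^ 6 / 4 - 3 * s ^ 4 / 4 + s ^ 2 / 2 = 0 := h
    exact a (by linear_combination 4 * h)
  · replace h : s ^ 6 / 12 - s ^ 2 / 3 = 0 := h
    exact c (by linear_combination 12 * h)
  · replace h : s ^ 4 / 2 - s ^ 2 = 0 := h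
    exact b (by linear_combination 2 * h)
  · replace h : s ^ 6 / 24 - s ^ 4 / 8 + s ^ 2 / 12 = 0 := h
    exact a (by linear_combination 24 * h)
  · exact one_ne_zero (α := ℂ) h

lemma matQ_zero_ne {s : ℂ} (h0 : s ^ 2 ≠ 0) (h1 : s ^ 2 - 1 ≠ 0) (h2 : s ^ 2 - 2 ≠ 0)
    (h3 : s ^ 2 + 2 ≠ 0) (j : Fin 10) : matQ s 0 j ≠ 0 := by
  have a := mul_ne_zero (mul_ne_zero h0 h1) h2
  have b := mul_ne_zero h0 h2
  have c := mul_ne_zero (mul_ne_zero h0 h2) h3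
  have d := mul_ne_zero h1 h2
  have e := mul_ne_zero h2 h3
  intro h
  fin_cases j
  · exact one_ne_zero (α := ℂ) h
  · replace h : s ^ 2 / 2 - 1 = 0 := h
    exact h2 (by linear_combination 2 * h)
  · exact h0 h
  · replace h : (s ^ 2 - 2) * s ^ 2 / 2 = 0 := h
    exact b (by linear_combination 2 * h)
  · replace h : s ^ 2 * (s ^ 2 - 1) / 2 = 0 := h
    exact mul_ne_zero h0 h1 (by linear_combination 2 * h)
  · replace h : s ^ 2 * (s ^ 4 - 3 * s ^ 2 + 2) / 4 = 0 := h
    exact a (by linear_combination 4 * h)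
  · replace h : s ^ 2 * (s ^ 4 - 3 * s ^ 2 + 2) / 6 = 0 := h
    exact a (by linear_combination 6 * h)
  · replace h : s ^ 2 * (s ^ 4 - 4) / 12 = 0 := h
    exact c (by linear_combination 12 * h)
  · replace h : s ^ 4 / 6 - s ^ 2 / 2 + 1 / 3 = 0 := h
    exact d (by linear_combination 6 * h)
  · replace h : s ^ 4 / 12 - 1 / 3 = 0 := h
    exact e (by linear_combination 12 * h)

/-- The character sums of `χ_g` over the classes `ℰ_0, …, ℰ_9` in terms of the value `S` of the
exponential sum at `g`, of the sum `e` over `ℰ_8` and of the sums over the following inverse images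
under `G → ℤ/4 × R`: `δ` over that of `0`, `ρ` over that of `{0} × 2R`, and `v` and `o` over those
of the pairs with even and with odd first entry. -/
def classRow (s S δ ρ v o e : ℂ) : Fin 10 → ℂ :=
  ![1, δ - 1, S, δ * S - S, (S ^ 2 - s ^ 2) / 2, v - ρ - (S ^ 2 - s ^ 2) / 2,
    (S ^ 3 - (3 * s ^ 2 - 2) * S) / 6, o - δ * S - (S ^ 3 - (3 * s ^ 2 - 2) * S) / 6, e, ρ - δ - e]

lemma classRow_zero (s : ℂ) : classRow s (s ^ 2) (s ^ 2 / 2) (s ^ 4 / 4) (s ^ 6 / 4) (s ^ 6 / 4)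
    (s ^ 4 / 6 - s ^ 2 / 2 + 1 / 3) = matQ s 0 := by
  ext j; fin_cases j <;> simp [classRow, matQ] <;> ring

lemma classRow_one (s : ℂ) : classRow s (2 * s) 0 0 0 0 (s ^ 2 / 6 + 1 / 3) = matQ s 1 := by
  ext j; fin_cases j <;> simp [classRow, matQ] <;> ring

lemma classRow_two (s : ℂ) :
    classRow s s (s ^ 2 / 2) 0 0 0 (1 / 3 - s ^ 2 / 3) = matQ s 2 := by
  ext j; fin_cases j <;> simp [classRow, matQ] <;> ring

lemma classRow_three (s : ℂ) : classRow s s 0 0 0 0 (1 / 3 - s ^ 2 / 3) = matQ s 3 := by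
  ext j; fin_cases j <;> simp [classRow, matQ] <;> ring

lemma classRow_four (s : ℂ) : classRow s 0 (s ^ 2 / 2) (s ^ 4 / 4) 0 0
    (s ^ 4 / 6 - s ^ 2 / 2 + 1 / 3) = matQ s 4 := by
  ext j; fin_cases j <;> simp [classRow, matQ] <;> ring

lemma classRow_five (s : ℂ) : classRow s 0 0 0 0 0 (s ^ 2 / 6 + 1 / 3) = matQ s 5 := by
  ext j; fin_cases j <;> simp [classRow, matQ] <;> ring

lemma classRow_six (s : ℂ) : classRow s (-s) 0 0 0 0 (1 / 3 - s ^ 2 / 3) = matQ s 6 := by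
  ext j; fin_cases j <;> simp [classRow, matQ] <;> ring

lemma classRow_seven (s : ℂ) :
    classRow s (-s) (s ^ 2 / 2) 0 0 0 (1 / 3 - s ^ 2 / 3) = matQ s 7 := by
  ext j; fin_cases j <;> simp [classRow, matQ] <;> ring

lemma classRow_eight (s : ℂ) :
    classRow s (-(2 * s)) 0 0 0 0 (s ^ 2 / 6 + 1 / 3) = matQ s 8 := by
  ext j; fin_cases j <;> simp [classRow, matQ] <;> ring

lemma classRow_nine (s : ℂ) : classRow s (-s ^ 2) (s ^ 2 / 2) (s ^ 4 / 4) (s ^ 6 / 4)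
    (-(s ^ 6 / 4)) (s ^ 4 / 6 - s ^ 2 / 2 + 1 / 3) = matQ s 9 := by
  ext j; fin_cases j <;> simp [classRow, matQ] <;> ring

end Matrices

/-! ### The two partitions are dual to each other -/

section Duality

variable {m : ℕ} {F : BasicIrreducible m} (β : (GR F)ˣ) [hm : Fact (3 ≤ m)]
  [hodd : Fact (Odd m)] [hβ : Fact (orderOf β = 2 ^ m - 1)]

lemma two_mul_qC : 2 * qC m = sC m ^ 2 := sC_sq.symm

lemma charSum_classE (g : Grp F) (j : Fin 10) : charSum (pairing β g) (classE β j)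
    = classRow (sC m) (expSum β g) (qIfZero g.2.2)
        (charSum (pairing β g) {h | h.1 = 0 ∧ red F h.2.1 = 0})
        (charSum (pairing β g) {h | h.1 = 0 ∨ h.1 = 2})
        (charSum (pairing β g) {h | h.1 = 1 ∨ h.1 = 3}) (charSum (pairing β g) (E8 β)) j := by
  have h0 := charSum_E0 β g
  have h2 := charSum_E2 β g
  have h4 := charSum_E4 β g
  have h6 := charSum_E6 β g
  have h01 := charSum_block01 β g
  have h23 := charSum_block23 β g
  have h45 := charSum_block45 β g
  have h67 := charSum_block67 β g
  have h89 := charSum_block89 β g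
  fin_cases j
  · exact h0
  · change charSum (pairing β g) (E1 F) = _ - 1
    linear_combination h01 - h0
  · exact h2
  · change charSum (pairing β g) (E3 β) = _ - _
    linear_combination h23 - h2
  · change charSum (pairing β g) (E4 β) = _ / 2
    linear_combination h4 / 2
  · change charSum (pairing β g) (E5 β) = _ - _ - _ / 2
    linear_combination h45 - h4 / 2
  · change charSum (pairing β g) (E6 β) = _ / 6
    linear_combination h6 / 6
  · change charSum (pairing β g) (E7 β) = _ - _ - _ / 6
    linear_combination h67 - h6 / 6
  · rfl
  · change charSum (pairing β g) (E9 β) = _ - _ - _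
    linear_combination h89

lemma charSum_classE_of_snd_ne_zero {g : Grp F} (hb : g.2.2 ≠ 0) (j : Fin 10) :
    charSum (pairing β g) (classE β j)
      = classRow (sC m) (expSum β g) 0 0 0 0 (charSum (pairing β g) (E8 β)) j := by
  rw [charSum_classE, charSum_red_eq_zero, charSum_fst β (by decide), charSum_fst β (by decide),
    qIfZero, if_neg hb, zero_mul, zero_mul, zero_mul]

lemma charSum_classE_of_red_ne_zero {g : Grp F} (ha : red F g.2.1 ≠ 0) (hb : g.2.2 = 0)
    (j : Fin 10) : charSum (pairing β g) (classE β j)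
      = classRow (sC m) (expSum β g) (sC m ^ 2 / 2) 0 0 0 (charSum (pairing β g) (E8 β)) j := by
  have ha' : g.2.1 ≠ 0 := fun h => ha (by rw [h, map_zero])
  rw [charSum_classE, charSum_red_eq_zero, charSum_fst β (by decide), charSum_fst β (by decide),
    qIfZero, if_pos hb, if_neg ha, if_neg ha']
  simp only [mul_zero]

lemma charSum_classE_of_dbl (u : ZMod 4) {x : ResField F} (hx : x ≠ 0) (j : Fin 10) :
    charSum (pairing β (u, dbl β x, 0)) (classE β j) = matQ (sC m) 4 j := by
  have hx' : dbl β x ≠ 0 := fun h => hx (dbl_injective β (h.trans (dbl_zero β).symm))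
  rw [charSum_classE, charSum_red_eq_zero, charSum_fst β (by decide), charSum_fst β (by decide),
    qIfZero, charSum_E8_of_red_eq_zero β _ (red_dbl β x) rfl, if_pos rfl, if_pos (red_dbl β x),
    if_neg hx', expSum_dbl β u hx, ← classRow_four]
  simp only [mul_zero]
  congr 1
  ring

lemma charSum_classE_of_zero (u : ZMod 4) (j : Fin 10) :
    charSum (pairing β ((u, 0, 0) : Grp F)) (classE β j)
      = classRow (sC m) (expSum β (u, 0, 0)) (sC m ^ 2 / 2) (sC m ^ 4 / 4)
        (sC m ^ 6 / 8 * (1 + iPow (2 * u))) (sC m ^ 6 / 8 * (iPow u + iPow (3 * u)))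
        (sC m ^ 4 / 6 - sC m ^ 2 / 2 + 1 / 3) j := by
  rw [charSum_classE, charSum_red_eq_zero, charSum_fst β (by decide), charSum_fst β (by decide),
    qIfZero, charSum_E8_of_red_eq_zero β _ (map_zero _) rfl, if_pos rfl, if_pos (map_zero _),
    if_pos rfl, zero_mul, one_mul, iPow_zero]
  congr 1 <;> ring

/-- Every element lies in some `ℛ_i`, and its character sums over the `ℰ_j` are row `i` of `Q`. -/
lemma exists_mem_classR (g : Grp F) : ∃ i, g ∈ classR β i ∧
    ∀ j, charSum (pairing β g) (classE β j) = matQ (sC m) i j := by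
  by_cases hb : g.2.2 = 0
  · by_cases ha : red F g.2.1 = 0
    · obtain ⟨u, x, rfl⟩ := eq_dbl_of_red_eq_zero β ha hb
      by_cases hx : x = 0
      · subst hx
        rw [dbl_zero]
        have hrow := charSum_classE_of_zero β (F := F) u
        rcases expSum_zero_eq β (F := F) u with ⟨hu, hS⟩ | ⟨hu, hS⟩ | ⟨hu0, hu2, hS⟩
        · refine ⟨0, hS.trans two_mul_qC.symm, fun j => ?_⟩
          rw [hrow, hS, ← classRow_zero, hu, mul_zero, mul_zero, iPow_zero]
          congr 1 <;> ring
        · refine ⟨9, ?_, fun j => ?_⟩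
          · change expSum β (u, 0, 0) = -(2 * qC m)
            rw [hS, two_mul_qC]
          · rw [hrow, hS, ← classRow_nine, hu, show (2 * 2 : ZMod 4) = 0 from rfl,
              show (3 * 2 : ZMod 4) = 2 from rfl, iPow_zero, iPow_two]
            congr 1 <;> ring
        · refine ⟨4, ⟨hS, rfl⟩, fun j => ?_⟩
          rw [hrow, hS, ← classRow_four]
          rcases zmod_four_cases u with rfl | rfl | rfl | rfl
          · exact absurd rfl hu0
          · rw [mul_one, mul_one, iPow_one, iPow_two, iPow_three]
            congr 1 <;> ring
          · exact absurd rfl hu2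
          · rw [show (2 * 3 : ZMod 4) = 2 from rfl, show (3 * 3 : ZMod 4) = 1 from rfl, iPow_one,
              iPow_two, iPow_three]
            congr 1 <;> ring
      · exact ⟨4, ⟨expSum_dbl β u hx, rfl⟩, charSum_classE_of_dbl β u hx⟩
    · have hr := radical_eq_bot_of_eq_zero β ha
      rw [← hb] at hr
      have hrow := charSum_classE_of_red_ne_zero β ha hb
      rw [charSum_E8_of_radical_eq_bot β g hr] at hrow
      rcases sq_eq_sq_iff_eq_or_eq_neg.mp (expSum_sq_of_radical_eq_bot β g hr) with hS | hS
      · exact ⟨2, ⟨hS, hb⟩, fun j => by rw [hrow, hS, classRow_two]⟩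
      · exact ⟨7, ⟨hS, hb⟩, fun j => by rw [hrow, hS, classRow_seven]⟩
  · have hrow := charSum_classE_of_snd_ne_zero β hb
    by_cases hr : radical β (red F g.2.1) g.2.2 = ⊥
    · rw [charSum_E8_of_radical_eq_bot β g hr] at hrow
      rcases sq_eq_sq_iff_eq_or_eq_neg.mp (expSum_sq_of_radical_eq_bot β g hr) with hS | hS
      · exact ⟨3, ⟨hS, hb⟩, fun j => by rw [hrow, hS, classRow_three]⟩
      · exact ⟨6, ⟨hS, hb⟩, fun j => by rw [hrow, hS, classRow_six]⟩
    · rw [charSum_E8_of_radical_ne_bot β g hb hr] at hrow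
      rcases expSum_of_radical_ne_bot β g hb hr with hS | hS
      · exact ⟨5, ⟨hS, hb⟩, fun j => by rw [hrow, hS, classRow_five]⟩
      · rw [show 4 * sC m ^ 2 = (2 * sC m) ^ 2 by ring] at hS
        rcases sq_eq_sq_iff_eq_or_eq_neg.mp hS with hS | hS
        · exact ⟨1, hS, fun j => by rw [hrow, hS, classRow_one]⟩
        · exact ⟨8, hS, fun j => by rw [hrow, hS, classRow_eight]⟩

lemma exists_real_sC : ∃ t : ℝ, sC m = t ∧ 4 ≤ t := by
  refine ⟨_, rfl, Real.le_sqrt_of_sq_le ?_⟩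
  have h : (2 : ℝ) ^ 3 ≤ 2 ^ m := pow_le_pow_right₀ one_le_two hm.out
  linarith

/-- The classes `ℛ_i` are told apart by the value of the exponential sum, together with the
vanishing of the last coordinate for those of its values that are attained in two classes. -/
lemma eq_of_mem_classR {g : Grp F} {i j : Fin 10} (hi : g ∈ classR β i) (hj : g ∈ classR β j) :
    i = j := by
  obtain ⟨t, ht, ht4⟩ := exists_real_sC (m := m)
  have ht0 : (t : ℂ) ≠ 0 := by rw [← ht]; exact sC_ne_zero
  let v : Fin 10 → ℝ := ![t, 2, 1, 1, 0, 0, -1, -1, -2, -t]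
  let w : Fin 10 → Prop := ![True, True, g.2.2 = 0, g.2.2 ≠ 0, g.2.2 = 0, g.2.2 ≠ 0,
    g.2.2 ≠ 0, g.2.2 = 0, True, True]
  have key : ∀ i, g ∈ classR β i → expSum β g = t * v i ∧ w i := by
    intro i hi
    rw [← ht]
    have hq := two_mul_qC (m := m)
    fin_cases i
    · replace hi : expSum β g = _ := hi
      refine ⟨?_, trivial⟩
      change expSum β g = sC m * t
      rw [← ht]
      linear_combination hi + hq
    · replace hi : expSum β g = _ := hi
      refine ⟨?_, trivial⟩
      change expSum β g = sC m * (2 : ℝ)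
      push_cast
      linear_combination hi
    · refine ⟨?_, hi.2⟩
      change expSum β g = sC m * (1 : ℝ)
      push_cast
      linear_combination hi.1
    · refine ⟨?_, hi.2⟩
      change expSum β g = sC m * (1 : ℝ)
      push_cast
      linear_combination hi.1
    · refine ⟨?_, hi.2⟩
      change expSum β g = sC m * (0 : ℝ)
      push_cast
      linear_combination hi.1
    · refine ⟨?_, hi.2⟩
      change expSum β g = sC m * (0 : ℝ)
      push_cast
      linear_combination hi.1
    · refine ⟨?_, hi.2⟩
      change expSum β g = sC m * (-1 : ℝ)
      push_cast
      linear_combination hi.1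
    · refine ⟨?_, hi.2⟩
      change expSum β g = sC m * (-1 : ℝ)
      push_cast
      linear_combination hi.1
    · replace hi : expSum β g = _ := hi
      refine ⟨?_, trivial⟩
      change expSum β g = sC m * (-2 : ℝ)
      push_cast
      linear_combination hi
    · replace hi : expSum β g = _ := hi
      refine ⟨?_, trivial⟩
      change expSum β g = sC m * (-t : ℝ)
      push_cast
      rw [← ht]
      linear_combination hi - hq
  obtain ⟨hvi, hwi⟩ := key i hi
  obtain ⟨hvj, hwj⟩ := key j hj
  have hv : v i = v j := by
    exact_mod_cast mul_left_cancel₀ ht0 (hvi.symm.trans hvj)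
  clear hvi hvj hi hj key
  fin_cases i <;> fin_cases j <;> first
    | rfl
    | (exfalso; revert hv hwi hwj; simp [v, w]; done)
    | (exfalso; revert hv; simp [v]; intro h; linarith)

lemma existsUnique_mem_classR (g : Grp F) : ∃! i, g ∈ classR β i := by
  obtain ⟨i, hi, -⟩ := exists_mem_classR β g
  exact ⟨i, hi, fun j hj => eq_of_mem_classR β hj hi⟩

lemma charSum_classE_of_mem_classR (i : Fin 10) (g : Grp F) (hg : g ∈ classR β i) (j : Fin 10) :
    charSum (pairing β g) (classE β j) = matQ (sC m) i j := by
  obtain ⟨k, hk, h⟩ := exists_mem_classR β g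
  rw [h, eq_of_mem_classR β hk hg]

lemma expSum_neg (g : Grp F) : expSum β (-g) = expSum β g := by
  have h : halfSum β (-g) = (starRingEnd ℂ) (halfSum β g) := by
    rw [halfSum, halfSum, map_sum]
    refine Finset.sum_congr rfl fun x _ => ?_
    rw [pairing_comm, pairing_neg_right, pairing_comm]
  rw [expSum_eq_halfSum, expSum_eq_halfSum, h, Complex.conj_conj, add_comm]

lemma neg_mem_classR (i : Fin 10) (g : Grp F) (hg : g ∈ classR β i) : -g ∈ classR β i := by
  have hS := expSum_neg β g
  have hb : (-g).2.2 = g.2.2 := CharTwo.neg_eq _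
  fin_cases i
  · exact hS.trans hg
  · exact hS.trans hg
  · exact ⟨hS.trans hg.1, hb.trans hg.2⟩
  · exact ⟨hS.trans hg.1, fun h => hg.2 (hb.symm.trans h)⟩
  · exact ⟨hS.trans hg.1, hb.trans hg.2⟩
  · exact ⟨hS.trans hg.1, fun h => hg.2 (hb.symm.trans h)⟩
  · exact ⟨hS.trans hg.1, fun h => hg.2 (hb.symm.trans h)⟩
  · exact ⟨hS.trans hg.1, hb.trans hg.2⟩
  · exact hS.trans hg
  · exact hS.trans hg

lemma zero_mem_classR : (0 : Grp F) ∈ classR β 0 := by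
  have h : expSum β ((0, 0, 0) : Grp F) = sC m ^ 2 := by
    rcases expSum_zero_eq β (F := F) 0 with h | h | h
    exacts [h.2, absurd h.1 (by decide), absurd rfl h.1]
  exact h.trans two_mul_qC.symm

/-- For `g ∈ ℛ_0` the sums of `χ_g` over the classes `ℰ_j` are the class sizes, so the sum of `χ_g`
over `G` is `|G|`, which forces `g = 0`. -/
lemma classR_zero : classR β 0 = {0} := by
  ext g
  rw [Set.mem_singleton_iff]
  refine ⟨fun hg => ?_, ?_⟩
  · by_contra h0
    have h1 : ∀ h : Grp F, ∑ x, pairing β h x = ∑ j, charSum (pairing β h) (classE β j) := by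
      classical
      intro h
      simp_rw [charSum_eq_sum_ite]
      exact sum_partition (existsUnique_mem_classE β) _
    have h2 : ∑ x, pairing β g x = ∑ x, pairing β 0 x := by
      rw [h1, h1]
      refine Finset.sum_congr rfl fun j _ => ?_
      rw [charSum_classE_of_mem_classR β 0 g hg, charSum_classE_of_mem_classR β 0 0
        (zero_mem_classR β)]
    have h3 := sum_apply (Φ := pairingEquiv β) g
    have h4 := sum_apply (Φ := pairingEquiv β) 0
    rw [if_neg h0] at h3
    rw [if_pos rfl] at h4
    have h5 : (Fintype.card (Grp F) : ℂ) = 0 := h4.symm.trans (h2.symm.trans h3)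
    exact Fintype.card_ne_zero (Nat.cast_eq_zero.mp h5)
  · rintro rfl
    exact zero_mem_classR β

/-- The two partitions of `G` are dual to each other under the pairing of `G` with itself. -/
theorem dualPartitions :
    DualPartitions (pairingEquiv β) (classR β) (classE β) (matP (sC m)) (matQ (sC m)) := by
  have hQP : matQ (sC m) * matP (sC m) = (Fintype.card (Grp F) : ℂ) • 1 := by
    have h := congrArg (Nat.cast (R := ℂ)) (card_Grp_mul_two β)
    push_cast at h
    rw [card_codeSet_eq] at h
    rw [matQ_mul_matP]
    congr 1
    linear_combination -h / 2
  have hP : ∀ i, ∀ g ∈ classE β i, ∀ j,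
      charSum (pairing β g) (classR β j) = matP (sC m) i j :=
    charSum_of_mul_eq (selfDual_pairingEquiv β) (existsUnique_mem_classR β)
      (existsUnique_mem_classE β) (neg_mem_classE β) (charSum_classE_of_mem_classR β)
      hQP
  obtain ⟨t, ht, ht4⟩ := exists_real_sC (m := m)
  have n0 : sC m ^ 2 ≠ 0 := pow_ne_zero _ sC_ne_zero
  have n1 : sC m ^ 2 - 1 ≠ 0 := by
    rw [ht]
    exact_mod_cast (by nlinarith : t ^ 2 - 1 ≠ 0)
  have n2 : sC m ^ 2 - 2 ≠ 0 := by
    rw [ht]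
    exact_mod_cast (by nlinarith : t ^ 2 - 2 ≠ 0)
  have n3 : sC m ^ 2 + 2 ≠ 0 := by
    rw [ht]
    exact_mod_cast (by positivity : t ^ 2 + 2 ≠ 0)
  have empty : ∀ S : Set (Grp F), charSum (pairing β 0) S ≠ 0 → S.Nonempty := by
    intro S hS
    by_contra h
    rw [Set.not_nonempty_iff_eq_empty] at h
    apply hS
    simp [h, charSum]
  exact ⟨selfDual_pairingEquiv β, existsUnique_mem_classR β, existsUnique_mem_classE β,
    classR_zero β, rfl, neg_mem_classR β, neg_mem_classE β,
    fun j => empty _ (by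
      rw [hP 0 0 rfl]
      exact matP_zero_ne n0 n1 n2 n3 j),
    fun j => empty _ (by
      rw [charSum_classE_of_mem_classR β 0 0 (zero_mem_classR β)]
      exact matQ_zero_ne n0 n1 n2 n3 j),
    hP, charSum_classE_of_mem_classR β⟩

end Duality

end DGScheme

end

open DGScheme

theorem mainTheorem1 (m : ℕ) (hm_odd : Odd m) (hm : 3 ≤ m)
    (F : BasicIrreducible m) (β : (GR F)ˣ) (hβ : orderOf β = 2 ^ m - 1) :
    -- the relations given by the value of the exponential sum form a 9-class scheme
    IsAssociationScheme (translationRel (classR β)) ∧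
    HasEigenmatrices (translationRel (classR β)) (matP (sC m)) (matQ (sC m)) ∧
    -- row `i` of `P` is the row of the characters labelled by the elements of `ℰ_i`
    (∀ i, ∀ g ∈ classE β i, ∀ j, charSum (pairing β g) (classR β j) = matP (sC m) i j) ∧
    -- the second family is a scheme with the two eigenmatrices interchanged
    IsAssociationScheme (translationRel (classE β)) ∧
    HasEigenmatrices (translationRel (classE β)) (matQ (sC m)) (matP (sC m)) ∧
    (∀ i, ∀ g ∈ classR β i, ∀ j, charSum (pairing β g) (classE β j) = matQ (sC m) i j) ∧
    -- it is the dual of the first, where `G` is identified with its character group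
    ∃ Φ : Grp F ≃+ AddChar (Grp F) ℂ,
      (∀ g h, Φ g h = pairing β g h) ∧
      IsDualPartition (classR β) (fun i => Φ '' classE β i) := by
  have : Fact (3 ≤ m) := ⟨hm⟩
  have : Fact (Odd m) := ⟨hm_odd⟩
  have : Fact (orderOf β = 2 ^ m - 1) := ⟨hβ⟩
  have h := dualPartitions β
  exact ⟨h.isAssociationScheme, h.hasEigenmatrices, h.sumR, h.swap.isAssociationScheme,
    h.swap.hasEigenmatrices, h.sumE, pairingEquiv β, pairingEquiv_apply β, h.isDualPartition⟩
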